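/- **Setting.** Let $P(t)=\{p_1(t),\dots,p_n(t)\}$ be points moving continuously in the plane, in general position: every pair has equal $x$-coordinates, and every triple is collinear, only at finitely many times, and no two such degeneracies (equal $x$-coordinates of a pair, collinearity of a triple) occur at the same time. The points receive priorities $1,\dots,n$ by a uniformly random permutation $\pi$, chosen independently of the motion; dummy points $p_{-\infty}=(-\infty,-\infty)$ and $p_{\infty}=(\infty,-\infty)$ with priorities $-1,0$ are added. Points are ordered lexicographically by their coordinates. *The pseudo-triangulation $\mathcal{PT}^+(P(t))$.* Start with the whole augmented set. A set $Q$ of consecutive points with leftmost point $a$ and rightmost point $c$, and with at least one further point, yields a pseudo-triangle with endpoints $a,c$ and with apex the point $b$ of minimum priority strictly between $a$ and $c$; then recurse on $Q_L=\{q\in Q: q\le b\}$ and $Q_R=\{q\in Q:q\ge b\}$. If $b$ is not on the upper hull of $Q$, the *funnel* of the pseudo-triangle is bounded by the *bridge* $uv$ (the upper common tangent segment of $Q_L$ and $Q_R$), the left chain $\mathcal L$ (the part of the upper hull of $Q_L$ from $u$ to $b$) and the right chain $\mathcal R$ (the part of the upper hull of $Q_R$ from $b$ to $v$); otherwise the funnel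 is empty. *The triangulation $\mathcal T(\tau)$ of the funnel.* Let $q$ be the vertex of minimum priority of the funnel other than its apex and the endpoints of its base. Draw the chord $q\nu(q)$, where $\nu(q)$ is the vertex of the opposite chain that is visible from $q$ inside the funnel and is farthest from the apex along that chain. The chord splits the funnel into an upper one (apex $q$, same base) and a lower one (base $q\nu(q)$, same apex), which are triangulated recursively, with visibility restricted to the respective sub-funnel (sub-pseudo-triangle). The edges of $\mathcal T(\tau)$ are the boundary edges of the funnel and the chords. *Kinetic pseudo-triangles.* A pseudo-triangle $\tau$ is given by two endpoints, an apex and a lifespan $I(\tau)$; it *appears* for $\pi$ if $I(\tau)$ is a maximal time interval during which the triple is in $\mathcal{PT}^+(P(t))$. Let $N_\tau$ be the number of points of $P$ other than the apex that lie strictly between the endpoints of $\tau$ in the $x$-order at some time in $I(\tau)$. An *envelope event* of $\tau$ is a time at which one of the chains $\mathcal L,\mathcal R$ of its funnel has three collinear vertices; the middle one is the point involved. A *visibility event* is a time at which a vertex of $\mathcal R$ (the point involved) is collinear with an edge of the upper hull of $Q_L$ (that is, of the left chain or the left tail), or symmetrically. **Proposition.** There is an absolute constant $C>0$ such that the following holds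 for all $n$, all such motions, every pseudo-triangle $\tau$ that appears for at least one permutation, and every time $t_0\in I(\tau)$ of an envelope or visibility event of $\tau$, with involved point $p_0$. Let $t_0^-$, $t_0^+$ be times right before and right after $t_0$. Conditioned on $\tau$ appearing, the expected number of edges that are inserted into or deleted from $\mathcal T(\tau)$ between $t_0^-$ and $t_0^+$ is at most $C\log(N_\tau+2)$, hence at most $C\log(n+2)$. Moreover, at each of the times $t_0^-,t_0^+$ and for every integer $k\ge 1$, conditioned on $\tau$ appearing, the probability that $p_0$ generates a chord of $\mathcal T(\tau)$ and that the sub-pseudo-triangle in which it does so has more than $k$ vertices is at most $C/k$. -/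

import Mathlib

open Filter Topology

noncomputable section

namespace KineticTriangulation

/-- The augmented point set: `n` moving points and two dummy points at infinity. -/
inductive Pt (n : ℕ) : Type
  | negInf : Pt n
  | pt (i : Fin n) : Pt n
  | posInf : Pt n

/-- Twice the signed area of the triangle `o q r`: positive iff `r` is to the left of the directed
line `o q`; if `o.1 < q.1`, it is positive iff `r` is strictly above the line through `o` and `q`. -/
def det (o q r : ℝ × ℝ) : ℝ :=
  (q.1 - o.1) * (r.2 - o.2) - (q.2 - o.2) * (r.1 - o.1)

section Motion

variable {n : ℕ} (p : Fin n → ℝ → ℝ × ℝ)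

/-- The set `s` of points is degenerate at time `t`: it is a pair with a common `x`-coordinate,
or a collinear triple. -/
def Degenerate (t : ℝ) (s : Finset (Fin n)) : Prop :=
  (s.card = 2 ∧ ∀ i ∈ s, ∀ j ∈ s, (p i t).1 = (p j t).1) ∨
  (s.card = 3 ∧ Collinear ℝ ((fun i => p i t) '' (s : Set (Fin n))))

/-- Continuous motions in general position: each pair swaps in the `x`-order, and each triple is
collinear, only finitely often, and distinct degeneracies occur at distinct times. -/
structure GeneralPosition : Prop where
  continuous : ∀ i, Continuous (p i)
  finite_times : ∀ s : Finset (Fin n), {t : ℝ | Degenerate p t s}.Finite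
  distinct_times : ∀ t : ℝ, {s : Finset (Fin n) | Degenerate p t s}.Subsingleton

/-- Position of an augmented point; the order on `EReal ×ₗ EReal` is lexicographic. -/
def pos (t : ℝ) : Pt n → EReal ×ₗ EReal
  | Pt.negInf => toLex (⊥, ⊥)
  | Pt.pt i => toLex (((p i t).1 : EReal), ((p i t).2 : EReal))
  | Pt.posInf => toLex (⊤, ⊥)

/-- Priorities: ranks `1, …, n` for the moving points, `-1` and `0` for the dummy points. -/
def priority (π : Equiv.Perm (Fin n)) : Pt n → ℤ
  | Pt.negInf => -1
  | Pt.pt i => ((π i : ℕ) : ℤ) + 1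
  | Pt.posInf => 0

/-- `b` is the point of minimum priority strictly between `a` and `c` in the `x`-order. -/
def IsMid (π : Equiv.Perm (Fin n)) (t : ℝ) (a b c : Pt n) : Prop :=
  (pos p t a < pos p t b ∧ pos p t b < pos p t c) ∧
  ∀ q : Pt n, pos p t a < pos p t q → pos p t q < pos p t c → priority π b ≤ priority π q

/-- The subsets `Q` processed by the recursive construction of `PT⁺(P(t))`; `Q` is a contiguous
range of the `x`-order and is given by its leftmost and its rightmost point. -/
inductive IsRange (π : Equiv.Perm (Fin n)) (t : ℝ) : Pt n → Pt n → Prop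
  | root : IsRange π t Pt.negInf Pt.posInf
  | left {a b c : Pt n} : IsRange π t a c → IsMid p π t a b c → IsRange π t a b
  | right {a b c : Pt n} : IsRange π t a c → IsMid p π t a b c → IsRange π t b c

/-- `PT⁺(P(t))` contains the pseudo-triangle with endpoints `a`, `c` and apex `b`. -/
def InPT (π : Equiv.Perm (Fin n)) (t : ℝ) (a b c : Pt n) : Prop :=
  IsRange p π t a c ∧ IsMid p π t a b c

end Motion

/-- A kinetic pseudo-triangle: its endpoints, its apex and its lifespan. -/
structure PseudoTriangle (n : ℕ) where
  left : Pt n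
  apex : Fin n
  right : Pt n
  life : Set ℝ

/-- A funnel, given by its left chain, from the left endpoint of the base to the apex, and its
right chain, from the apex to the right endpoint of the base; the apex belongs to both. -/
structure Funnel (n : ℕ) where
  left : List (Fin n)
  right : List (Fin n)

namespace Funnel

variable {n : ℕ}

/-- `ij` is an edge of the boundary: of the left chain, of the right chain, or the base. -/
def IsEdge (F : Funnel n) (i j : Fin n) : Prop :=
  [i, j] <:+: F.left ∨ [i, j] <:+: F.right ∨
    (F.left.head? = some i ∧ F.right.getLast? = some j)

/-- The vertices other than the apex and the two endpoints of the base. -/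
def IsNonCorner (F : Funnel n) (i : Fin n) : Prop :=
  i ∈ F.left.tail.dropLast ∨ i ∈ F.right.tail.dropLast

/-- The number of vertices. -/
def numVertices (F : Funnel n) : ℕ :=
  (F.left ++ F.right).toFinset.card

end Funnel

section Static

variable {n : ℕ} (p : Fin n → ℝ → ℝ × ℝ)

/-- The moving points in the `x`-range of `τ`. -/
def range (t : ℝ) (τ : PseudoTriangle n) : Set (Fin n) :=
  {i | pos p t τ.left ≤ pos p t (Pt.pt i) ∧ pos p t (Pt.pt i) ≤ pos p t τ.right}

/-- The part of the range up to the apex, apex included. -/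
def rangeL (t : ℝ) (τ : PseudoTriangle n) : Set (Fin n) :=
  {i ∈ range p t τ | pos p t (Pt.pt i) ≤ pos p t (Pt.pt τ.apex)}

/-- The part of the range from the apex on, apex included. -/
def rangeR (t : ℝ) (τ : PseudoTriangle n) : Set (Fin n) :=
  {i ∈ range p t τ | pos p t (Pt.pt τ.apex) ≤ pos p t (Pt.pt i)}

/-- `i` lies on the upper hull of `S`: it is below no segment that connects two points of `S`. -/
def OnUpperHull (t : ℝ) (S : Set (Fin n)) (i : Fin n) : Prop :=
  i ∈ S ∧ ∀ j ∈ S, ∀ k ∈ S, (p j t).1 < (p k t).1 →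
    (p j t).1 ≤ (p i t).1 → (p i t).1 ≤ (p k t).1 → 0 ≤ det (p j t) (p k t) (p i t)

/-- `ik` is an edge of the upper hull of `S`, with `i` on the left. -/
def HullEdge (t : ℝ) (S : Set (Fin n)) (i k : Fin n) : Prop :=
  OnUpperHull p t S i ∧ OnUpperHull p t S k ∧ (p i t).1 < (p k t).1 ∧
    ∀ j, OnUpperHull p t S j → ¬ ((p i t).1 < (p j t).1 ∧ (p j t).1 < (p k t).1)

/-- `uv` is the bridge of `τ`: the upper common tangent of the left and the right part of its range
touches them at `u` and `v`. There is none (the funnel is empty) if the apex is strictly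
above every segment that connects a point on its left to a point on its right. -/
def IsBridge (t : ℝ) (τ : PseudoTriangle n) (u v : Fin n) : Prop :=
  u ∈ rangeL p t τ ∧ v ∈ rangeR p t τ ∧
  (p u t).1 < (p τ.apex t).1 ∧ (p τ.apex t).1 < (p v t).1 ∧
  ∀ i ∈ range p t τ, det (p u t) (p v t) (p i t) ≤ 0

/-- `i` is a vertex of the left chain of the funnel with bridge `uv`. -/
def OnLeftChain (t : ℝ) (τ : PseudoTriangle n) (u i : Fin n) : Prop :=
  OnUpperHull p t (rangeL p t τ) i ∧ (p u t).1 ≤ (p i t).1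

/-- `i` is a vertex of the right chain of the funnel with bridge `uv`. -/
def OnRightChain (t : ℝ) (τ : PseudoTriangle n) (v i : Fin n) : Prop :=
  OnUpperHull p t (rangeR p t τ) i ∧ (p i t).1 ≤ (p v t).1

/-- `F` is the funnel of `τ` at time `t`. -/
def IsFunnel (t : ℝ) (τ : PseudoTriangle n) (F : Funnel n) : Prop :=
  ∃ u v, IsBridge p t τ u v ∧
    F.left.Pairwise (fun i j => (p i t).1 < (p j t).1) ∧
    (∀ i, i ∈ F.left ↔ OnLeftChain p t τ u i) ∧
    F.right.Pairwise (fun i j => (p i t).1 < (p j t).1) ∧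
    (∀ i, i ∈ F.right ↔ OnRightChain p t τ v i)

/-- The boundary of a funnel as a closed polygonal curve. -/
def boundary (t : ℝ) (F : Funnel n) : Set (ℝ × ℝ) :=
  {z | ∃ i j, F.IsEdge i j ∧ z ∈ segment ℝ (p i t) (p j t)}

/-- Visibility inside a funnel: the segment meets the boundary at its endpoints only. -/
def Visible (t : ℝ) (F : Funnel n) (i j : Fin n) : Prop :=
  Disjoint (openSegment ℝ (p i t) (p j t)) (boundary p t F)

/-- One step of the triangulation of a funnel: `q`, the non-corner vertex of minimum priority,
generates the chord `qw`, where `w = ν(q)` is the extreme vertex of the opposite chain that is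
visible from `q` (rightmost if `q` is on the left chain, leftmost if `q` is on the right chain).
The chord splits `F` into the part `Fu` above it, with apex `q` and the same base, and the part
`Fl` below it, with base `qw` and the same apex. -/
def Split (π : Equiv.Perm (Fin n)) (t : ℝ) (F : Funnel n) (q w : Fin n) (Fu Fl : Funnel n) :
    Prop :=
  F.IsNonCorner q ∧ (∀ i, F.IsNonCorner i → π q ≤ π i) ∧ Visible p t F q w ∧
  ∃ l₁ l₂ r₁ r₂ : List (Fin n),
    (l₁ ≠ [] ∧ l₂ ≠ [] ∧ F.left = l₁ ++ q :: l₂ ∧ F.right = r₁ ++ w :: r₂ ∧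
      (∀ z ∈ r₂, ¬ Visible p t F q z) ∧
      Fu = ⟨l₁ ++ [q], q :: w :: r₂⟩ ∧ Fl = ⟨q :: l₂, r₁ ++ [w]⟩) ∨
    (r₁ ≠ [] ∧ r₂ ≠ [] ∧ F.left = l₁ ++ w :: l₂ ∧ F.right = r₁ ++ q :: r₂ ∧
      (∀ z ∈ l₁, ¬ Visible p t F q z) ∧
      Fu = ⟨l₁ ++ [w, q], q :: r₂⟩ ∧ Fl = ⟨w :: l₂, r₁ ++ [q]⟩)

/-- The sub-pseudo-triangles that arise when the funnel `F₀` is triangulated recursively. -/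
inductive SubFunnel (π : Equiv.Perm (Fin n)) (t : ℝ) (F₀ : Funnel n) : Funnel n → Prop
  | refl : SubFunnel π t F₀ F₀
  | upper {F Fu Fl : Funnel n} {q w : Fin n} :
      SubFunnel π t F₀ F → Split p π t F q w Fu Fl → SubFunnel π t F₀ Fu
  | lower {F Fu Fl : Funnel n} {q w : Fin n} :
      SubFunnel π t F₀ F → Split p π t F q w Fu Fl → SubFunnel π t F₀ Fl

/-- The edges of the triangulation `T(τ)` at time `t`: the boundary edges of the funnel of `τ` and
the chords generated in its recursive splitting. -/
def triangulation (π : Equiv.Perm (Fin n)) (t : ℝ) (τ : PseudoTriangle n) :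
    Set (Sym2 (Fin n)) :=
  {e | ∃ F₀, IsFunnel p t τ F₀ ∧
    ((∃ i j, F₀.IsEdge i j ∧ e = s(i, j)) ∨
      ∃ F q w Fu Fl, SubFunnel p π t F₀ F ∧ Split p π t F q w Fu Fl ∧ e = s(q, w))}

/-- `F` is the sub-pseudo-triangle of `τ` in which `q` generates its chord. -/
def GeneratesIn (π : Equiv.Perm (Fin n)) (t : ℝ) (τ : PseudoTriangle n) (q : Fin n)
    (F : Funnel n) : Prop :=
  ∃ F₀, IsFunnel p t τ F₀ ∧ SubFunnel p π t F₀ F ∧ ∃ w Fu Fl, Split p π t F q w Fu Fl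

end Static

section Kinetic

variable {n : ℕ} (p : Fin n → ℝ → ℝ × ℝ)

/-- For the priorities `π`, the pseudo-triangle `τ` appears in the kinetic pseudo-triangulation:
`τ.life` is a maximal interval of times `t` at which the triple of `τ` is in `PT⁺(P(t))`. -/
def Appears (π : Equiv.Perm (Fin n)) (τ : PseudoTriangle n) : Prop :=
  Maximal (fun I : Set ℝ => I.Nonempty ∧ I.OrdConnected ∧
    ∀ t ∈ I, InPT p π t τ.left (Pt.pt τ.apex) τ.right) τ.life

/-- `P_τ`: the points other than the apex that are between the endpoints of `τ` at some time of
the lifespan. -/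
def pointSet (τ : PseudoTriangle n) : Set (Fin n) :=
  {i | i ≠ τ.apex ∧ ∃ t ∈ τ.life,
    pos p t τ.left < pos p t (Pt.pt i) ∧ pos p t (Pt.pt i) < pos p t τ.right}

/-- Envelope event at time `t`: a chain of the funnel has three collinear vertices; the middle
one, `q`, is the point involved. -/
def EnvelopeEvent (t : ℝ) (τ : PseudoTriangle n) (q : Fin n) : Prop :=
  ∃ u v, IsBridge p t τ u v ∧ ∃ i k,
    (p i t).1 < (p q t).1 ∧ (p q t).1 < (p k t).1 ∧ Collinear ℝ {p i t, p q t, p k t} ∧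
    ((OnLeftChain p t τ u i ∧ OnLeftChain p t τ u q ∧ OnLeftChain p t τ u k) ∨
     (OnRightChain p t τ v i ∧ OnRightChain p t τ v q ∧ OnRightChain p t τ v k))

/-- Visibility event at time `t`: a vertex `q` of one chain of the funnel, the point involved, is
collinear with an edge `ik` of the opposite chain or of the tail that continues it. -/
def VisibilityEvent (t : ℝ) (τ : PseudoTriangle n) (q : Fin n) : Prop :=
  ∃ u v, IsBridge p t τ u v ∧ ∃ i k,
    q ≠ i ∧ q ≠ k ∧ Collinear ℝ {p q t, p i t, p k t} ∧
    ((OnRightChain p t τ v q ∧ HullEdge p t (rangeL p t τ) i k) ∨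
     (OnLeftChain p t τ u q ∧ HullEdge p t (rangeR p t τ) i k))

/-- The number of edges inserted into or deleted from `T(τ)` between times `t` and `t'`. -/
def changes (π : Equiv.Perm (Fin n)) (τ : PseudoTriangle n) (t t' : ℝ) : ℕ :=
  (symmDiff (triangulation p π t τ) (triangulation p π t' τ)).ncard

open Classical in
/-- The permutations for which `τ` appears. -/
def appearing (τ : PseudoTriangle n) : Finset (Equiv.Perm (Fin n)) :=
  Finset.univ.filter fun π => Appears p π τ

/-- Expectation over a uniformly random permutation, conditioned on the appearance of `τ`. -/
def condExpect (τ : PseudoTriangle n) (f : Equiv.Perm (Fin n) → ℝ) : ℝ :=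
  (∑ π ∈ appearing p τ, f π) / ((appearing p τ).card : ℝ)

open Classical in
/-- Probability over a uniformly random permutation, conditioned on the appearance of `τ`. -/
def condProb (τ : PseudoTriangle n) (E : Equiv.Perm (Fin n) → Prop) : ℝ :=
  (((appearing p τ).filter E).card : ℝ) / ((appearing p τ).card : ℝ)

end Kinetic

end KineticTriangulation

end

/-! Combinatorial model. Number the left chain `a 0, …, a l` and the right chain `c 0, …, c r` from
the apex outwards, so that `a l` and `c r` span the bridge. Let `f i` be the index on the right
chain of the point of tangency from `a i`, and `g j` the index on the left chain of that from `c j`.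
Up to its apex, every sub-pseudo-triangle of the recursion is an interval of indices on each chain
(`Box`), and a chord from `a i` inside it ends at `f i` clamped to the interval of the other chain.
The recursion thus becomes a process on pairs of intervals driven by `f`, `g` and the priorities. It
uses only that `f` and `g` are monotone and that for all `i`, `j` one of `j < f i`, `i < g j` holds
(`Chains.Wf`). `Chains.GoodPart.split_iff` translates between the geometric and the combinatorial
recursion.

Randomness. When `τ` appears, its apex has smaller priority than every point of `pointSet p τ`, and
exchanging the priorities of two of these points does not affect the appearance
(`Appears.mul_swap`). Hence, conditioned on the appearance, a given point of a set `S` of such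
points is the first of `S` with probability at most 1/|S|, and a given ordered pair is the first two
with probability at most 1/(|S|(|S|-1)).

Tail bound (`Chains.card_generatesLarge_le`). Suppose `a i` generates its chord in a part with more
than `k` vertices. Then it has minimum priority on one of four windows of about `k/4` consecutive
vertices whose position is fixed by the geometry: next to `i` on its own chain, or next to the
position on the other chain from which on the tangents pass beyond `a i`. The exception is a part
that was cut off from this position by an earlier chord from some `a m` with `m < i`. Then `a m` and
`a i` are the first two points of a window that `m` determines, and the probabilities of these
events telescope in `m`. Altogether the probability is O(1/k).

Changes. At an event a single triple changes its orientation. Either one tangent changes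
(`Chains.simulation_tangent`), or the bridge moves to the neighbouring vertex
(`Chains.simulation_cut`), or a chain loses or gains a vertex (`Chains.simulation_delete`), or a
funnel that is a triangle appears or vanishes (`controlled_vanish`). In the first three cases the
recursions before and after the event run in lockstep until one fixed vertex `x` is chosen for
splitting. So the chords differ only inside the part in which `x` generates its chord, and at most
three boundary edges change. Summing the tail bound over `k` gives a harmonic sum and hence the
logarithm.

Statements about the right chain follow from those about the left one by reflection at the vertical
axis (`mirror`, `Chains.swap`). -/

open Filter Topology

noncomputable section

namespace KineticTriangulation

/-! ### Exchangeable priorities -/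

section Priorities

variable {n : ℕ}

/-- A set of permutations that is invariant under exchanging the values at two points of `V`. -/
def SwapClosed (X : Finset (Equiv.Perm (Fin n))) (V : Set (Fin n)) : Prop :=
  ∀ π ∈ X, ∀ x ∈ V, ∀ y ∈ V, π * Equiv.swap x y ∈ X

/-- `x` has the least value on `S`. -/
def MinOn (π : Equiv.Perm (Fin n)) (S : Finset (Fin n)) (x : Fin n) : Prop :=
  ∀ y ∈ S, π x ≤ π y

open Classical in
-- Right multiplication by `Equiv.swap x y` is injective and carries the permutations with minimum
-- at `x` to permutations with minimum at `y`.
theorem card_minOn_eq {X : Finset (Equiv.Perm (Fin n))} {V : Set (Fin n)} (hX : SwapClosed X V)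
    {S : Finset (Fin n)} (hS : (S : Set (Fin n)) ⊆ V) {x y : Fin n} (hx : x ∈ S) (hy : y ∈ S) :
    (X.filter fun π => MinOn π S x).card ≤ (X.filter fun π => MinOn π S y).card := by
  refine Finset.card_le_card_of_injOn (fun π => π * Equiv.swap x y) ?_ ?_
  · intro π hπ
    simp only [Finset.coe_filter, Set.mem_ofPred_eq] at hπ ⊢
    refine ⟨hX π hπ.1 x (hS hx) y (hS hy), fun z hz => ?_⟩
    simp only [Equiv.Perm.mul_apply, Equiv.swap_apply_right]
    refine hπ.2 _ ?_
    rcases eq_or_ne z x with rfl | hzx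
    · simpa using hy
    rcases eq_or_ne z y with rfl | hzy
    · simpa using hx
    rwa [Equiv.swap_apply_of_ne_of_ne hzx hzy]
  · intro π _ π' _ h
    exact mul_right_cancel h

open Classical in
/-- The point `x` is the minimum of `S` with probability at most `1 / |S|`. -/
theorem card_minOn_mul_le {X : Finset (Equiv.Perm (Fin n))} {V : Set (Fin n)}
    (hX : SwapClosed X V) {S : Finset (Fin n)} (hS : (S : Set (Fin n)) ⊆ V) {x : Fin n}
    (hx : x ∈ S) : (X.filter fun π => MinOn π S x).card * S.card ≤ X.card := by
  -- The minimum on `S` is attained at a single point, so the events for the different points of `S`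
  -- are disjoint; each is at least as large as the one for `x`.
  have hdisj : (S : Set (Fin n)).PairwiseDisjoint (fun y => X.filter fun π => MinOn π S y) := by
    intro y hy z hz hyz
    refine Finset.disjoint_left.2 fun π h₁ h₂ => hyz ?_
    simp only [Finset.mem_filter] at h₁ h₂
    exact π.injective (le_antisymm (h₁.2 z hz) (h₂.2 y hy))
  calc (X.filter fun π => MinOn π S x).card * S.card
      = ∑ _y ∈ S, (X.filter fun π => MinOn π S x).card := by simp [mul_comm]
    _ ≤ ∑ y ∈ S, (X.filter fun π => MinOn π S y).card :=
        Finset.sum_le_sum fun y hy => card_minOn_eq hX hS hx hy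
    _ = (S.biUnion fun y => X.filter fun π => MinOn π S y).card :=
        (Finset.card_biUnion hdisj).symm
    _ ≤ X.card := Finset.card_le_card (Finset.biUnion_subset.2 fun y _ => Finset.filter_subset _ _)

open Classical in
/-- The points `y` and `x` are the two first points of `S`, in this order, with probability at
most `1 / (|S| (|S| - 1))`. -/
theorem card_minOn_pair_mul_le {X : Finset (Equiv.Perm (Fin n))} {V : Set (Fin n)}
    (hX : SwapClosed X V) {S : Finset (Fin n)} (hS : (S : Set (Fin n)) ⊆ V) {x y : Fin n}
    (hx : x ∈ S.erase y) (hy : y ∈ S) :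
    (X.filter fun π => MinOn π S y ∧ MinOn π (S.erase y) x).card * ((S.card - 1) * S.card) ≤
      X.card := by
  -- Exchanging two points of `S` other than `y` leaves `y` the minimum, so the one-point bound can
  -- be applied a second time, inside this event and to `S.erase y`.
  have hY : SwapClosed (X.filter fun π => MinOn π S y) (S.erase y : Finset (Fin n)) := by
    intro π hπ a ha b hb
    simp only [Finset.mem_filter, Finset.mem_coe, Finset.mem_erase] at hπ ha hb ⊢
    refine ⟨hX π hπ.1 a (hS ha.2) b (hS hb.2), fun z hz => ?_⟩
    simp only [Equiv.Perm.mul_apply, Equiv.swap_apply_of_ne_of_ne ha.1.symm hb.1.symm]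
    refine hπ.2 _ ?_
    rcases eq_or_ne z a with rfl | hza
    · simpa using hb.2
    rcases eq_or_ne z b with rfl | hzb
    · simpa using ha.2
    rwa [Equiv.swap_apply_of_ne_of_ne hza hzb]
  have h₁ := card_minOn_mul_le hY subset_rfl hx
  rw [Finset.filter_filter, Finset.card_erase_of_mem hy] at h₁
  rw [← mul_assoc]
  exact (Nat.mul_le_mul_right _ h₁).trans (card_minOn_mul_le hX hS hy)

end Priorities

/-! ### The combinatorial recursion on pairs of index intervals -/

/-- Projection of `x` to the interval `[lo, hi]`. -/
def clamp (lo hi x : ℕ) : ℕ := max lo (min hi x)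

/-- A contiguous part of each of the two chains of a funnel. -/

structure Box where
  i₁ : ℕ
  i₂ : ℕ
  j₁ : ℕ
  j₂ : ℕ

/-- The number of non-corner vertices. -/
def Box.size (s : Box) : ℕ := (s.i₂ - s.i₁) + (s.j₂ - s.j₁)

/-- Exchange of the two chains. -/
def Box.swap (s : Box) : Box := ⟨s.j₁, s.j₂, s.i₁, s.i₂⟩

/-- The chains of a funnel, enumerated from the apex outwards; `f i` is the index on the chain `c`
of the point of tangency from `a i`, and `g j` is the index on `a` of that from `c j`. -/

structure Chains (n : ℕ) where
  a : ℕ → Fin n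
  c : ℕ → Fin n
  f : ℕ → ℕ
  g : ℕ → ℕ

namespace Chains

variable {n : ℕ}

/-- Exchange of the two chains. -/
def swap (d : Chains n) : Chains n := ⟨d.c, d.a, d.g, d.f⟩

/-- `x` is a non-corner vertex of the part `s`. -/
def Inner (d : Chains n) (s : Box) (x : Fin n) : Prop :=
  (∃ i, s.i₁ ≤ i ∧ i < s.i₂ ∧ x = d.a i) ∨ (∃ j, s.j₁ ≤ j ∧ j < s.j₂ ∧ x = d.c j)

/-- The chord `qw` generated by the non-corner vertex `q` of minimum priority splits `s` into an
upper and a lower part. -/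
inductive Step (d : Chains n) (π : Equiv.Perm (Fin n)) : Box → Fin n → Fin n → Box → Box → Prop
  | left {s : Box} {i : ℕ} (h₁ : s.i₁ ≤ i) (h₂ : i < s.i₂)
      (hm : ∀ x, d.Inner s x → π (d.a i) ≤ π x) :
      Step d π s (d.a i) (d.c (clamp s.j₁ s.j₂ (d.f i)))
        ⟨i + 1, s.i₂, clamp s.j₁ s.j₂ (d.f i), s.j₂⟩ ⟨s.i₁, i, s.j₁, clamp s.j₁ s.j₂ (d.f i)⟩
  | right {s : Box} {j : ℕ} (h₁ : s.j₁ ≤ j) (h₂ : j < s.j₂)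
      (hm : ∀ x, d.Inner s x → π (d.c j) ≤ π x) :
      Step d π s (d.c j) (d.a (clamp s.i₁ s.i₂ (d.g j)))
        ⟨clamp s.i₁ s.i₂ (d.g j), s.i₂, j + 1, s.j₂⟩ ⟨s.i₁, clamp s.i₁ s.i₂ (d.g j), s.j₁, j⟩

/-- `s'` is one of the two parts into which `s` is split. -/
def Child (d : Chains n) (π : Equiv.Perm (Fin n)) (s s' : Box) : Prop :=
  ∃ q w u l, d.Step π s q w u l ∧ (s' = u ∨ s' = l)

/-- `s'` arises from `s` by repeated splitting. -/
def Reach (d : Chains n) (π : Equiv.Perm (Fin n)) : Box → Box → Prop :=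
  Relation.ReflTransGen (d.Child π)

/-- Distinct indices denote distinct points. -/
structure Inj (d : Chains n) (l r : ℕ) : Prop where
  a_inj : ∀ i ≤ l, ∀ i' ≤ l, d.a i = d.a i' → i = i'
  c_inj : ∀ j ≤ r, ∀ j' ≤ r, d.c j = d.c j' → j = j'
  a_ne_c : ∀ i ≤ l, ∀ j ≤ r, d.a i ≠ d.c j

/-- Combinatorial properties of the tangents of a funnel. -/
structure Wf (d : Chains n) (l r : ℕ) : Prop extends Inj d l r where
  f_le : ∀ i < l, d.f i ≤ r
  g_le : ∀ j < r, d.g j ≤ l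
  f_mono : ∀ i i', i ≤ i' → i' < l → d.f i ≤ d.f i'
  g_mono : ∀ j j', j ≤ j' → j' < r → d.g j ≤ d.g j'
  cross : ∀ i < l, ∀ j < r, j < d.f i ∨ i < d.g j

theorem Wf.swap {d : Chains n} {l r : ℕ} (h : d.Wf l r) : d.swap.Wf r l where
  a_inj := h.c_inj
  c_inj := h.a_inj
  a_ne_c := fun i hi j hj e => h.a_ne_c j hj i hi e.symm
  f_le := h.g_le
  g_le := h.f_le
  f_mono := h.g_mono
  g_mono := h.f_mono
  cross := fun i hi j hj => (h.cross j hj i hi).symm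

theorem inner_swap {d : Chains n} {s : Box} {x : Fin n} : d.swap.Inner s.swap x ↔ d.Inner s x :=
  or_comm

theorem Step.swap {d : Chains n} {π : Equiv.Perm (Fin n)} {s u l : Box} {q w : Fin n}
    (h : d.Step π s q w u l) : d.swap.Step π s.swap q w u.swap l.swap := by
  cases h with
  | left h₁ h₂ hm =>
    exact Step.right (d := d.swap) (s := s.swap) h₁ h₂ fun x hx => hm x (inner_swap.1 hx)
  | right h₁ h₂ hm =>
    exact Step.left (d := d.swap) (s := s.swap) h₁ h₂ fun x hx => hm x (inner_swap.1 hx)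

theorem Reach.swap {d : Chains n} {π : Equiv.Perm (Fin n)} {s s' : Box} (h : d.Reach π s s') :
    d.swap.Reach π s.swap s'.swap := by
  induction h with
  | refl => exact Relation.ReflTransGen.refl
  | tail _ hc ih =>
    obtain ⟨q, w, u, l, hs, h⟩ := hc
    exact ih.tail ⟨q, w, u.swap, l.swap, hs.swap, h.imp (congrArg _) (congrArg _)⟩

/-- `s` is a part of the funnel with outermost indices `l` and `r`. -/
structure Within (s : Box) (l r : ℕ) : Prop where
  hi : s.i₁ ≤ s.i₂
  hj : s.j₁ ≤ s.j₂
  hl : s.i₂ ≤ l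
  hr : s.j₂ ≤ r

theorem Step.within {d : Chains n} {π : Equiv.Perm (Fin n)} {s u l : Box} {q w : Fin n}
    {L R : ℕ} (h : d.Step π s q w u l) (hs : Within s L R) : Within u L R ∧ Within l L R := by
  obtain ⟨h1, h2, h3, h4⟩ := hs
  cases h with
  | left h₁ h₂ hm => constructor <;> constructor <;> simp only [clamp] <;> omega
  | right h₁ h₂ hm => constructor <;> constructor <;> simp only [clamp] <;> omega

theorem Reach.within {d : Chains n} {π : Equiv.Perm (Fin n)} {s s' : Box} {L R : ℕ}
    (h : d.Reach π s s') (hs : Within s L R) : Within s' L R := by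
  induction h with
  | refl => exact hs
  | tail _ hc ih =>
    obtain ⟨q, w, u, l, hst, rfl | rfl⟩ := hc
    exacts [(hst.within ih).1, (hst.within ih).2]

/-- Position of the parts that have `a i` as a non-corner vertex, relative to the first index `s₀`
from which on the points of the other chain see beyond `a i`. -/
theorem Reach.window {d : Chains n} {π : Equiv.Perm (Fin n)} {l r : ℕ} (hd : d.Wf l r) {s : Box}
    (h : d.Reach π ⟨0, l, 0, r⟩ s) {i s₀ : ℕ} (hi : i < l) (hs₀ : s₀ ≤ r)
    (hlow : ∀ j < s₀, d.g j ≤ i) (hhigh : ∀ j, s₀ ≤ j → j < r → i < d.g j)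
    (h₁ : s.i₁ ≤ i) (h₂ : i < s.i₂) :
    s₀ ≤ s.j₂ ∧ (s.j₁ ≤ s₀ ∨ ∃ k, k < i ∧ s.i₁ = k + 1 ∧ π (d.a k) ≤ π (d.a i) ∧
      (s.j₁ = d.f k ∨ s.j₁ = s.j₂)) := by
  have hw0 : Within ⟨0, l, 0, r⟩ l r := ⟨by simp, by simp, le_rfl, le_rfl⟩
  induction h with
  | refl => exact ⟨hs₀, Or.inl (Nat.zero_le _)⟩
  | @tail s s' hreach hc ih =>
    obtain ⟨q, w, u, l', hst, hs'⟩ := hc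
    have hw : Within s l r := Reach.within hreach hw0
    obtain ⟨w1, w2, w3, w4⟩ := hw
    -- `c (s₀ - 1)` does not see beyond `a i`; by `cross`, `a i` then sees beyond `c (s₀ - 1)`.
    have hsf : s₀ ≤ d.f i := by
      rcases Nat.eq_zero_or_pos s₀ with h0 | h0
      · omega
      · have := hd.cross i hi (s₀ - 1) (by omega)
        have := hlow (s₀ - 1) (by omega)
        omega
    cases hst with
    | @left k k₁ k₂ hm =>
      rcases hs' with rfl | rfl
      · simp only at h₁ h₂ ⊢
        -- Upper part of a split at `a k`: here `k < i`, and the new lower index on the other chain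
        -- is the clamped `f k`. If an earlier witness `k'` exists, monotonicity of `f` excludes
        -- clamping from below, so the most recent `k` always takes over as the witness.
        have hk : π (d.a k) ≤ π (d.a i) := hm _ (Or.inl ⟨i, by omega, h₂, rfl⟩)
        obtain ⟨hs2, ih⟩ := ih (by omega) h₂
        refine ⟨hs2, ?_⟩
        simp only [clamp]
        rcases ih with ih | ⟨k', hk', hk'', _, ih⟩
        · by_cases hf : s.j₁ ≤ d.f k
          · right; exact ⟨k, by omega, rfl, hk, by omega⟩
          · left; omega
        · have := hd.f_mono k' k (by omega) (by omega)
          right; exact ⟨k, by omega, rfl, hk, by omega⟩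
      · simp only at h₁ h₂ ⊢
        obtain ⟨hs2, ih⟩ := ih h₁ (by omega)
        -- Lower part, `i < k`: the upper index on the other chain is cut to the clamped `f k`, and
        -- `f k ≥ f i ≥ s₀`.
        have := hd.f_mono i k (by omega) (by omega)
        simp only [clamp]
        refine ⟨by omega, ?_⟩
        rcases ih with ih | ⟨k', hk', hk'', hp, ih⟩
        · exact Or.inl ih
        · right; exact ⟨k', hk', hk'', hp, by omega⟩
    | @right j j₁ j₂ hm =>
      rcases hs' with rfl | rfl
      · simp only [clamp] at h₁ h₂ ⊢
        obtain ⟨hs2, ih⟩ := ih (by omega) h₂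
        -- A chord from `c j` leaves `a i` above it only if its tangent stops at or before `a i`,
        -- that is, below `s₀`; it leaves `a i` below it only if `j ≥ s₀`. Hence splits on the other
        -- chain never move the interval past `s₀`.
        have hj : j < s₀ := by
          by_contra hj
          have := hhigh j (by omega) (by omega)
          omega
        exact ⟨hs2, by omega⟩
      · simp only [clamp] at h₁ h₂ ⊢
        obtain ⟨hs2, ih⟩ := ih h₁ (by omega)
        have hj : s₀ ≤ j := by
          by_contra hj
          have := hlow j (by omega)
          omega
        refine ⟨hj, ?_⟩
        rcases ih with ih | ⟨k', hk', hk'', hp, ih⟩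
        · exact Or.inl ih
        · right; exact ⟨k', hk', hk'', hp, by omega⟩

end Chains

/-! ### Tail bound for the size of the part in which a vertex generates its chord -/

namespace Chains

variable {n : ℕ}

open Classical in
-- `G` is the part of the event that does not depend on the permutation, namely that the window fits
-- into its chain. Without it the event is empty.
theorem card_filter_le_of_minOn {X : Finset (Equiv.Perm (Fin n))} {V : Set (Fin n)}
    (hX : SwapClosed X V) {E : Equiv.Perm (Fin n) → Prop} [DecidablePred E] {G : Prop}
    {S : Finset (Fin n)}
    {x : Fin n} {m : ℕ} (hE : ∀ π, E π → G ∧ MinOn π S x)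
    (hG : G → (S : Set (Fin n)) ⊆ V ∧ x ∈ S ∧ m ≤ S.card) :
    (X.filter E).card * m ≤ X.card := by
  by_cases g : G
  · obtain ⟨h₁, h₂, h₃⟩ := hG g
    refine (Nat.mul_le_mul (Finset.card_le_card ?_) h₃).trans (card_minOn_mul_le hX h₁ h₂)
    exact Finset.monotone_filter_right _ fun π _ h => (hE π h).2
  · rw [Finset.filter_false_of_mem fun π _ h => g (hE π h).1]
    simp

open Classical in
theorem card_filter_le_of_minOn_pair {X : Finset (Equiv.Perm (Fin n))} {V : Set (Fin n)}
    (hX : SwapClosed X V) {E : Equiv.Perm (Fin n) → Prop} [DecidablePred E] {G : Prop}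
    {S : Finset (Fin n)}
    {x y : Fin n} {m : ℕ} (hE : ∀ π, E π → G ∧ MinOn π S y ∧ MinOn π (S.erase y) x)
    (hG : G → (S : Set (Fin n)) ⊆ V ∧ x ∈ S.erase y ∧ y ∈ S ∧ m + 1 ≤ S.card) :
    (X.filter E).card * (m * (m + 1)) ≤ X.card := by
  by_cases g : G
  · obtain ⟨h₁, h₂, h₃, h₄⟩ := hG g
    refine (Nat.mul_le_mul (Finset.card_le_card ?_) (Nat.mul_le_mul ?_ h₄)).trans
      (card_minOn_pair_mul_le hX h₁ h₂ h₃)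
    · exact Finset.monotone_filter_right _ fun π _ h => (hE π h).2
    · omega
  · rw [Finset.filter_false_of_mem fun π _ h => g (hE π h).1]
    simp

/-- The terms are 1/m - 1/(m+1) for `m` from `h + 1` to `h + i`. -/
theorem sum_telescope_le (h i : ℕ) :
    ∑ k ∈ Finset.range i, (1 : ℝ) / (((i - k + h : ℕ) : ℝ) * ((i - k + h : ℕ) + 1)) ≤
      1 / (h + 1) := by
  have key : ∀ m : ℕ, ∑ k ∈ Finset.range m,
      (1 : ℝ) / (((k + 1 + h : ℕ) : ℝ) * ((k + 1 + h : ℕ) + 1)) = 1 / (h + 1) - 1 / (m + h + 1) := by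
    intro m
    induction m with
    | zero => simp
    | succ m ih =>
      rw [Finset.sum_range_succ, ih]
      push_cast
      have h1 : (0 : ℝ) < m + h + 1 := by positivity
      have h2 : (0 : ℝ) < h + 1 := by positivity
      field_simp
      ring
  rw [← Finset.sum_range_reflect]
  have : ∀ k ∈ Finset.range i,
      (1 : ℝ) / (((i - (i - 1 - k) + h : ℕ) : ℝ) * ((i - (i - 1 - k) + h : ℕ) + 1)) =
      (1 : ℝ) / (((k + 1 + h : ℕ) : ℝ) * ((k + 1 + h : ℕ) + 1)) := by
    intro k hk
    rw [Finset.mem_range] at hk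
    rw [show i - (i - 1 - k) = k + 1 by omega]
  rw [Finset.sum_congr rfl this, key]
  have : (0 : ℝ) ≤ 1 / (i + h + 1) := by positivity
  linarith

/-- `x` generates a chord in a part of the funnel with more than `k` vertices (up to a constant). -/
def GeneratesLarge (d : Chains n) (l r : ℕ) (π : Equiv.Perm (Fin n)) (x : Fin n) (k : ℕ) : Prop :=
  ∃ s w u v, d.Reach π ⟨0, l, 0, r⟩ s ∧ d.Step π s x w u v ∧ k < s.size + 4

theorem GeneratesLarge.swap {d : Chains n} {l r : ℕ} {π : Equiv.Perm (Fin n)} {x : Fin n} {k : ℕ}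
    (h : d.GeneratesLarge l r π x k) : d.swap.GeneratesLarge r l π x k := by
  obtain ⟨s, w, u, v, h₁, h₂, h₃⟩ := h
  refine ⟨s.swap, w, u.swap, v.swap, h₁.swap, h₂.swap, ?_⟩
  simp only [Box.size, Box.swap] at h₃ ⊢
  omega

theorem within_root (l r : ℕ) : Within ⟨0, l, 0, r⟩ l r := ⟨by simp, by simp, le_rfl, le_rfl⟩

/-- If `a i` generates a chord in a large part, then it has minimum priority on one of a few
windows of size `h + 1`, or it comes second after some `a k` on a window that `k` determines. -/
theorem GeneratesLarge.cases {d : Chains n} {l r : ℕ} (hd : d.Wf l r) {π : Equiv.Perm (Fin n)}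
    {i h k s₀ : ℕ} (hi : i < l) (hs₀ : s₀ ≤ r)
    (hlow : ∀ j < s₀, d.g j ≤ i) (hhigh : ∀ j, s₀ ≤ j → j < r → i < d.g j)
    (hk : 4 * h + 2 ≤ k) (H : d.GeneratesLarge l r π (d.a i) k) :
    (h ≤ i ∧ MinOn π ((Finset.Icc (i - h) i).image d.a) (d.a i)) ∨
    (i + h < l ∧ MinOn π ((Finset.Icc i (i + h)).image d.a) (d.a i)) ∨
    (h ≤ s₀ ∧ MinOn π (insert (d.a i) ((Finset.Ico (s₀ - h) s₀).image d.c)) (d.a i)) ∨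
    (s₀ + h ≤ r ∧ MinOn π (insert (d.a i) ((Finset.Ico s₀ (s₀ + h)).image d.c)) (d.a i)) ∨
    ∃ m < i, d.f m + h ≤ r ∧
      MinOn π ((Finset.Icc m i).image d.a ∪ (Finset.Ico (d.f m) (d.f m + h)).image d.c) (d.a m) ∧
      MinOn π (((Finset.Icc m i).image d.a ∪
        (Finset.Ico (d.f m) (d.f m + h)).image d.c).erase (d.a m)) (d.a i) := by
  obtain ⟨s, w, u, v, hreach, hst, hsize⟩ := H
  obtain ⟨w1, w2, w3, w4⟩ := Reach.within hreach (within_root l r)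
  have : s.i₁ ≤ i ∧ i < s.i₂ ∧ ∀ x, d.Inner s x → π (d.a i) ≤ π x := by
    generalize hx : d.a i = x at hst
    cases hst with
    | @left i' h₁ h₂ hm =>
      obtain rfl := hd.a_inj _ (by omega) _ (by omega) hx
      exact ⟨h₁, h₂, hm⟩
    | @right j h₁ h₂ hm => exact (hd.a_ne_c i (by omega) j (by omega) hx).elim
  obtain ⟨h₁, h₂, hm⟩ := this
  have ha : ∀ i', s.i₁ ≤ i' → i' < s.i₂ → π (d.a i) ≤ π (d.a i') :=
    fun i' h h' => hm _ (Or.inl ⟨i', h, h', rfl⟩)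
  have hc : ∀ j, s.j₁ ≤ j → j < s.j₂ → π (d.a i) ≤ π (d.c j) :=
    fun i' h h' => hm _ (Or.inr ⟨i', h, h', rfl⟩)
  simp only [Box.size] at hsize
  -- The part has at least `4 * h - 1` non-corner vertices, so one of its chains contributes at
  -- least `2 * h` of them, and hence about `h` on one side of `a i`, or of the position `s₀` on the
  -- other chain.
  by_cases he : 2 * h ≤ s.i₂ - s.i₁
  · by_cases hl : h ≤ i - s.i₁
    · left
      refine ⟨by omega, fun y hy => ?_⟩
      simp only [Finset.mem_image, Finset.mem_Icc] at hy
      obtain ⟨i', hi', rfl⟩ := hy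
      exact ha _ (by omega) (by omega)
    · right; left
      refine ⟨by omega, fun y hy => ?_⟩
      simp only [Finset.mem_image, Finset.mem_Icc] at hy
      obtain ⟨i', hi', rfl⟩ := hy
      exact ha _ (by omega) (by omega)
  · right; right
    obtain ⟨hs2, hw⟩ := hreach.window hd hi hs₀ hlow hhigh h₁ h₂
    rcases hw with hw | ⟨m, hmi, hm1, hmp, hw⟩
    · by_cases hl : h ≤ s₀ - s.j₁
      · left
        refine ⟨by omega, fun y hy => ?_⟩
        simp only [Finset.mem_insert, Finset.mem_image, Finset.mem_Ico] at hy
        obtain rfl | ⟨i', hi', rfl⟩ := hy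
        · exact le_rfl
        exact hc _ (by omega) (by omega)
      · right; left
        refine ⟨by omega, fun y hy => ?_⟩
        simp only [Finset.mem_insert, Finset.mem_image, Finset.mem_Ico] at hy
        obtain rfl | ⟨i', hi', rfl⟩ := hy
        · exact le_rfl
        exact hc _ (by omega) (by omega)
    · right; right
      -- The alternative `s.j₁ = s.j₂` is impossible, since the right chain contributes at least `2
      -- * h > 0` non-corner vertices.
      have hj : s.j₁ = d.f m := by omega
      have hmin : MinOn π (((Finset.Icc m i).image d.a ∪
          (Finset.Ico (d.f m) (d.f m + h)).image d.c).erase (d.a m)) (d.a i) := by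
        intro y hy
        simp only [Finset.mem_erase, Finset.mem_union, Finset.mem_image, Finset.mem_Icc,
          Finset.mem_Ico] at hy
        obtain ⟨hne, ⟨i', hi', rfl⟩ | ⟨j, hj, rfl⟩⟩ := hy
        · have : i' ≠ m := fun e => hne (by rw [e])
          exact ha _ (by omega) (by omega)
        · exact hc _ (by omega) (by omega)
      refine ⟨m, hmi, by omega, fun y hy => ?_, hmin⟩
      by_cases hy' : y = d.a m
      · rw [hy']
      · exact hmp.trans (hmin y (Finset.mem_erase.2 ⟨hy', hy⟩))

open Classical in
-- Union bound over the cases of `GeneratesLarge.cases`. The four windows cost 1/(h+1) each, and the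
-- pairs together cost at most 1/(h+1) by telescoping. The total 5/(h+1) is at most 25/k.
theorem card_generatesLarge_left_le {d : Chains n} {l r : ℕ} (hd : d.Wf l r)
    {X : Finset (Equiv.Perm (Fin n))} {V : Set (Fin n)} (hX : SwapClosed X V)
    (hV : ∀ x, d.Inner ⟨0, l, 0, r⟩ x → x ∈ V) {i k : ℕ} (hi : i < l) (hk : 0 < k) :
    ((X.filter fun π => d.GeneratesLarge l r π (d.a i) k).card : ℝ) ≤ 25 / k * X.card := by
  have hk' : (0 : ℝ) < k := by exact_mod_cast hk
  -- The largest `h` with `4 * h + 2 ≤ k`. If it is 0 (truncated subtraction included), then `k ≤ 5`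
  -- and the asserted bound exceeds the trivial one.
  obtain ⟨h, hh⟩ : ∃ h, h = (k - 2) / 4 := ⟨_, rfl⟩
  rcases Nat.eq_zero_or_pos h with h0 | h0
  · have h5 : (k : ℝ) ≤ 5 := by exact_mod_cast (by omega : k ≤ 5)
    have h1 : ((X.filter fun π => d.GeneratesLarge l r π (d.a i) k).card : ℝ) ≤ X.card := by
      exact_mod_cast Finset.card_filter_le _ _
    have h2 : (1 : ℝ) ≤ 25 / k := by rw [le_div_iff₀ hk']; linarith
    nlinarith [Nat.cast_nonneg (α := ℝ) X.card]
  have hVa : ∀ i < l, d.a i ∈ V := fun i hi => hV _ (Or.inl ⟨i, Nat.zero_le _, hi, rfl⟩)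
  have hVc : ∀ j < r, d.c j ∈ V := fun i hi => hV _ (Or.inr ⟨i, Nat.zero_le _, hi, rfl⟩)
  have hex : ∃ j, r ≤ j ∨ i < d.g j := ⟨r, Or.inl le_rfl⟩
  -- The first `j` whose tangent passes beyond `a i`, or `r` if there is none; by monotonicity of
  -- `g` it separates the two kinds of `j`.
  obtain ⟨s₀, hs₀⟩ : ∃ s₀, s₀ = Nat.find hex := ⟨_, rfl⟩
  have hlow : ∀ j < s₀, j < r ∧ d.g j ≤ i := fun j hj => by
    have := Nat.find_min hex (hs₀ ▸ hj)
    omega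
  have hs₀r : s₀ ≤ r := hs₀ ▸ Nat.find_min' hex (Or.inl le_rfl)
  have hhigh : ∀ j, s₀ ≤ j → j < r → i < d.g j := fun j hj hjr => by
    have := Nat.find_spec hex
    rw [← hs₀] at this
    have := hd.g_mono s₀ j hj hjr
    omega
  have haInj : ∀ (A : Finset ℕ), (∀ j ∈ A, j ≤ l) → (A.image d.a).card = A.card := fun A hA =>
    Finset.card_image_of_injOn fun x hx y hy e => hd.a_inj x (hA x hx) y (hA y hy) e
  have hcInj : ∀ (A : Finset ℕ), (∀ j ∈ A, j ≤ r) → (A.image d.c).card = A.card := fun A hA =>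
    Finset.card_image_of_injOn fun x hx y hy e => hd.c_inj x (hA x hx) y (hA y hy) e
  have hnc : ∀ (A : Finset ℕ), (∀ j ∈ A, j ≤ r) → ∀ i ≤ l, d.a i ∉ A.image d.c := by
    intro A hA i hi hmem
    obtain ⟨j, hj, e⟩ := Finset.mem_image.1 hmem
    exact hd.a_ne_c i hi j (hA j hj) e.symm
  set E1 := X.filter fun π => h ≤ i ∧ MinOn π ((Finset.Icc (i - h) i).image d.a) (d.a i) with hE1
  set E2 := X.filter fun π => i + h < l ∧ MinOn π ((Finset.Icc i (i + h)).image d.a) (d.a i)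
    with hE2
  set E3 := X.filter fun π => h ≤ s₀ ∧
    MinOn π (insert (d.a i) ((Finset.Ico (s₀ - h) s₀).image d.c)) (d.a i) with hE3
  set E4 := X.filter fun π => s₀ + h ≤ r ∧
    MinOn π (insert (d.a i) ((Finset.Ico s₀ (s₀ + h)).image d.c)) (d.a i) with hE4
  set E5 : ℕ → Finset (Equiv.Perm (Fin n)) := fun m => X.filter fun π => d.f m + h ≤ r ∧
      MinOn π ((Finset.Icc m i).image d.a ∪ (Finset.Ico (d.f m) (d.f m + h)).image d.c) (d.a m) ∧
      MinOn π (((Finset.Icc m i).image d.a ∪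
        (Finset.Ico (d.f m) (d.f m + h)).image d.c).erase (d.a m)) (d.a i) with hE5
  have hsub : (X.filter fun π => d.GeneratesLarge l r π (d.a i) k) ⊆
      E1 ∪ (E2 ∪ (E3 ∪ (E4 ∪ (Finset.range i).biUnion E5))) := by
    intro π hπ
    rw [Finset.mem_filter] at hπ
    have := hπ.2.cases (h := h) hd hi hs₀r (fun j hj => (hlow j hj).2) hhigh (by omega)
    simp only [hE1, hE2, hE3, hE4, hE5, Finset.mem_union, Finset.mem_filter, Finset.mem_biUnion,
      Finset.mem_range, hπ.1, true_and]
    exact this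
  have b1 : E1.card * (h + 1) ≤ X.card := by
    refine card_filter_le_of_minOn hX (fun π H => H) fun g => ⟨?_, ?_, ?_⟩
    · intro y hy
      simp only [Finset.coe_image, Finset.coe_Icc, Set.mem_image, Set.mem_Icc] at hy
      obtain ⟨i', hi', rfl⟩ := hy
      exact hVa _ (by omega)
    · exact Finset.mem_image_of_mem _ (Finset.mem_Icc.2 (by omega))
    · rw [haInj _ fun j hj => by rw [Finset.mem_Icc] at hj; omega, Nat.card_Icc]
      omega
  have b2 : E2.card * (h + 1) ≤ X.card := by
    refine card_filter_le_of_minOn hX (fun π H => H) fun g => ⟨?_, ?_, ?_⟩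
    · intro y hy
      simp only [Finset.coe_image, Finset.coe_Icc, Set.mem_image, Set.mem_Icc] at hy
      obtain ⟨i', hi', rfl⟩ := hy
      exact hVa _ (by omega)
    · exact Finset.mem_image_of_mem _ (Finset.mem_Icc.2 (by omega))
    · rw [haInj _ fun j hj => by rw [Finset.mem_Icc] at hj; omega, Nat.card_Icc]
      omega
  have bc : ∀ A : Finset ℕ, (∀ j ∈ A, j < r) → A.card = h →
      ((insert (d.a i) (A.image d.c) : Finset (Fin n)) : Set (Fin n)) ⊆ V ∧
      d.a i ∈ insert (d.a i) (A.image d.c) ∧ h + 1 ≤ (insert (d.a i) (A.image d.c)).card := by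
    intro A hA hcard
    refine ⟨?_, Finset.mem_insert_self _ _, ?_⟩
    · intro y hy
      simp only [Finset.coe_insert, Finset.coe_image, Set.mem_insert_iff, Set.mem_image,
        Finset.mem_coe] at hy
      obtain rfl | ⟨j, hj, rfl⟩ := hy
      · exact hVa _ hi
      · exact hVc _ (hA j hj)
    · rw [Finset.card_insert_of_notMem (hnc A (fun j hj => (hA j hj).le) i hi.le),
        hcInj A (fun j hj => (hA j hj).le), hcard]
  have b3 : E3.card * (h + 1) ≤ X.card := by
    refine card_filter_le_of_minOn hX (fun π H => H) fun g => bc _ ?_ ?_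
    · intro j hj; rw [Finset.mem_Ico] at hj; omega
    · rw [Nat.card_Ico]; omega
  have b4 : E4.card * (h + 1) ≤ X.card := by
    refine card_filter_le_of_minOn hX (fun π H => H) fun g => bc _ ?_ ?_
    · intro j hj; rw [Finset.mem_Ico] at hj; omega
    · rw [Nat.card_Ico]; omega
  -- The window consists of `i - m + 1` points of the left chain and `h` points of the right chain.
  have b5 : ∀ m ∈ Finset.range i, ((E5 m).card : ℝ) ≤
      X.card * (1 / (((i - m + h : ℕ) : ℝ) * ((i - m + h : ℕ) + 1))) := by
    intro m hm
    rw [Finset.mem_range] at hm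
    have : (E5 m).card * ((i - m + h) * ((i - m + h) + 1)) ≤ X.card := by
      refine card_filter_le_of_minOn_pair hX (fun π H => H) fun g => ⟨?_, ?_, ?_, ?_⟩
      · intro y hy
        simp only [Finset.coe_union, Finset.coe_image, Finset.coe_Icc, Finset.coe_Ico,
          Set.mem_union, Set.mem_image, Set.mem_Icc, Set.mem_Ico] at hy
        obtain ⟨j, hj, rfl⟩ | ⟨j, hj, rfl⟩ := hy
        · exact hVa _ (by omega)
        · exact hVc _ (by omega)
      · refine Finset.mem_erase.2 ⟨fun e => ?_, Finset.mem_union_left _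
          (Finset.mem_image_of_mem _ (Finset.mem_Icc.2 (by omega)))⟩
        have := hd.a_inj i hi.le m (by omega) e
        omega
      · exact Finset.mem_union_left _ (Finset.mem_image_of_mem _ (Finset.mem_Icc.2 (by omega)))
      · rw [Finset.card_union_of_disjoint, haInj, hcInj, Nat.card_Icc, Nat.card_Ico]
        · omega
        · intro j hj; rw [Finset.mem_Ico] at hj; omega
        · intro j hj; rw [Finset.mem_Icc] at hj; omega
        · refine Finset.disjoint_left.2 fun y hy hy' => ?_
          obtain ⟨j, hj, rfl⟩ := Finset.mem_image.1 hy
          rw [Finset.mem_Icc] at hj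
          refine hnc _ ?_ j (by omega) hy'
          intro j hj; rw [Finset.mem_Ico] at hj; omega
    have hpos : (0 : ℝ) < ((i - m + h : ℕ) : ℝ) * ((i - m + h : ℕ) + 1) := by
      have : (0 : ℝ) < ((i - m + h : ℕ) : ℝ) := by exact_mod_cast (by omega : 0 < i - m + h)
      positivity
    rw [mul_one_div, le_div_iff₀ hpos]
    exact_mod_cast this
  have b5' : (((Finset.range i).biUnion E5).card : ℝ) ≤ X.card * (1 / (h + 1)) := by
    calc (((Finset.range i).biUnion E5).card : ℝ)
        ≤ ∑ m ∈ Finset.range i, ((E5 m).card : ℝ) := by exact_mod_cast Finset.card_biUnion_le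
      _ ≤ ∑ m ∈ Finset.range i,
          X.card * (1 / (((i - m + h : ℕ) : ℝ) * ((i - m + h : ℕ) + 1))) :=
          Finset.sum_le_sum b5
      _ ≤ X.card * (1 / (h + 1)) := by
          rw [← Finset.mul_sum]
          exact mul_le_mul_of_nonneg_left (sum_telescope_le h i) (Nat.cast_nonneg _)
  have hpos : (0 : ℝ) < h + 1 := by positivity
  have conv : ∀ E : Finset (Equiv.Perm (Fin n)), E.card * (h + 1) ≤ X.card →
      (E.card : ℝ) ≤ X.card * (1 / (h + 1)) := by
    intro E hE
    rw [mul_one_div, le_div_iff₀ hpos]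
    exact_mod_cast hE
  have htot : ((X.filter fun π => d.GeneratesLarge l r π (d.a i) k).card : ℝ) ≤
      E1.card + (E2.card + (E3.card + (E4.card + ((Finset.range i).biUnion E5).card))) := by
    have := (Finset.card_le_card hsub).trans (Finset.card_union_le _ _)
    have h2 := Finset.card_union_le E2 (E3 ∪ (E4 ∪ (Finset.range i).biUnion E5))
    have h3 := Finset.card_union_le E3 (E4 ∪ (Finset.range i).biUnion E5)
    have h4 := Finset.card_union_le E4 ((Finset.range i).biUnion E5)
    exact_mod_cast (by omega)
  have h5 : (5 : ℝ) * (1 / (h + 1)) ≤ 25 / k := by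
    rw [mul_one_div, div_le_div_iff₀ hpos hk']
    have : (k : ℝ) ≤ 5 * (h + 1) := by exact_mod_cast (by omega : k ≤ 5 * (h + 1))
    linarith
  have := conv _ b1
  have := conv _ b2
  have := conv _ b3
  have := conv _ b4
  have h6 := mul_le_mul_of_nonneg_right h5 (Nat.cast_nonneg (α := ℝ) X.card)
  linarith

open Classical in
/-- A vertex generates its chord in a part with more than `k` vertices with probability `O(1/k)`. -/
theorem card_generatesLarge_le {d : Chains n} {l r : ℕ} (hd : d.Wf l r)
    {X : Finset (Equiv.Perm (Fin n))} {V : Set (Fin n)} (hX : SwapClosed X V)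
    (hV : ∀ x, d.Inner ⟨0, l, 0, r⟩ x → x ∈ V) (x : Fin n) {k : ℕ} (hk : 0 < k) :
    ((X.filter fun π => d.GeneratesLarge l r π x k).card : ℝ) ≤ 25 / k * X.card := by
  by_cases hx : ∃ i < l, x = d.a i
  · obtain ⟨i, hi, rfl⟩ := hx
    exact card_generatesLarge_left_le hd hX hV hi hk
  by_cases hx' : ∃ j < r, x = d.c j
  · obtain ⟨j, hj, rfl⟩ := hx'
    refine le_trans ?_ (card_generatesLarge_left_le hd.swap hX (i := j)
      (fun x hx => hV x (inner_swap.1 hx)) hj hk)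
    exact_mod_cast Finset.card_le_card (Finset.monotone_filter_right _
      fun π _ (h : d.GeneratesLarge l r π (d.c j) k) => h.swap)
  · rw [Finset.filter_false_of_mem]
    · simpa using by positivity
    rintro π - ⟨s, w, u, v, hr, hst, -⟩
    have hw := Reach.within hr (within_root l r)
    have := hw.hl
    have := hw.hr
    cases hst with
    | @left i h₁ h₂ _ => exact hx ⟨i, by omega, rfl⟩
    | @right j h₁ h₂ _ => exact hx' ⟨j, by omega, rfl⟩

end Chains

/-! ### Comparison of the recursions before and after an event -/

namespace Chains

variable {n : ℕ}

/-- The chords generated when the part `s` is split recursively. -/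
def edges (d : Chains n) (π : Equiv.Perm (Fin n)) (s : Box) : Set (Sym2 (Fin n)) :=
  {e | ∃ s' q w u l, d.Reach π s s' ∧ d.Step π s' q w u l ∧ e = s(q, w)}

theorem Step.inner {d : Chains n} {π : Equiv.Perm (Fin n)} {s u l : Box} {q w : Fin n}
    (h : d.Step π s q w u l) : d.Inner s q ∧ ∀ x, d.Inner s x → π q ≤ π x := by
  cases h with
  | left h₁ h₂ hm => exact ⟨Or.inl ⟨_, h₁, h₂, rfl⟩, hm⟩
  | right h₁ h₂ hm => exact ⟨Or.inr ⟨_, h₁, h₂, rfl⟩, hm⟩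

theorem Step.unique {d : Chains n} {L R : ℕ} (hd : d.Inj L R) {π : Equiv.Perm (Fin n)}
    {s u l u' l' : Box} {q w q' w' : Fin n} (hs : Within s L R)
    (h : d.Step π s q w u l) (h' : d.Step π s q' w' u' l') :
    q = q' ∧ w = w' ∧ u = u' ∧ l = l' := by
  have hq : q = q' := π.injective (le_antisymm (h.inner.2 _ h'.inner.1) (h'.inner.2 _ h.inner.1))
  subst hq
  have := hs.hl
  have := hs.hr
  cases h with
  | @left i h₁ h₂ hm =>
    generalize hx : d.a i = x at h'
    cases h' with
    | @left i' h₁' h₂' hm' =>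
      obtain rfl := hd.a_inj _ (by omega) _ (by omega) hx
      simp
    | @right j h₁' h₂' hm' => exact (hd.a_ne_c _ (by omega) _ (by omega) hx).elim
  | @right j h₁ h₂ hm =>
    generalize hx : d.c j = x at h'
    cases h' with
    | @left i' h₁' h₂' hm' => exact (hd.a_ne_c _ (by omega) _ (by omega) hx.symm).elim
    | @right j' h₁' h₂' hm' =>
      obtain rfl := hd.c_inj _ (by omega) _ (by omega) hx
      simp

theorem Inner.exists_step {d : Chains n} (π : Equiv.Perm (Fin n)) {s : Box} {x : Fin n}
    (h : d.Inner s x) : ∃ q w u l, d.Step π s q w u l := by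
  obtain ⟨q, hq, hm⟩ := Set.exists_min_image {x | d.Inner s x} π (Set.toFinite _) ⟨x, h⟩
  rcases hq with ⟨i, h₁, h₂, rfl⟩ | ⟨j, h₁, h₂, rfl⟩
  · exact ⟨_, _, _, _, Step.left h₁ h₂ hm⟩
  · exact ⟨_, _, _, _, Step.right h₁ h₂ hm⟩

theorem edges_of_step {d : Chains n} {L R : ℕ} (hd : d.Inj L R) {π : Equiv.Perm (Fin n)}
    {s u l : Box} {q w : Fin n} (hs : Within s L R) (h : d.Step π s q w u l) :
    d.edges π s = insert s(q, w) (d.edges π u ∪ d.edges π l) := by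
  ext e
  simp only [Set.mem_insert_iff, Set.mem_union]
  constructor
  · rintro ⟨s', q', w', u', l', hr, hst, rfl⟩
    rcases hr.cases_head with rfl | ⟨t, ⟨q₁, w₁, u₁, l₁, h₁, ht⟩, hr'⟩
    · obtain ⟨rfl, rfl, -, -⟩ := Step.unique hd hs h hst
      exact Or.inl rfl
    · obtain ⟨-, -, rfl, rfl⟩ := Step.unique hd hs h h₁
      rcases ht with rfl | rfl
      · exact Or.inr (Or.inl ⟨s', q', w', u', l', hr', hst, rfl⟩)
      · exact Or.inr (Or.inr ⟨s', q', w', u', l', hr', hst, rfl⟩)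
  · rintro (rfl | ⟨s', q', w', u', l', hr, hst, rfl⟩ | ⟨s', q', w', u', l', hr, hst, rfl⟩)
    · exact ⟨s, q, w, u, l, Relation.ReflTransGen.refl, h, rfl⟩
    · exact ⟨s', q', w', u', l', hr.head ⟨q, w, u, l, h, Or.inl rfl⟩, hst, rfl⟩
    · exact ⟨s', q', w', u', l', hr.head ⟨q, w, u, l, h, Or.inr rfl⟩, hst, rfl⟩

theorem edges_of_not_inner {d : Chains n} {π : Equiv.Perm (Fin n)} {s : Box}
    (h : ∀ x, ¬ d.Inner s x) : d.edges π s = ∅ := by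
  ext e
  simp only [Set.mem_empty_iff_false, iff_false]
  rintro ⟨s', q', w', u', l', hr, hst, rfl⟩
  rcases hr.cases_head with rfl | ⟨t, ⟨q₁, w₁, u₁, l₁, h₁, ht⟩, hr'⟩
  · exact h _ hst.inner.1
  · exact h _ h₁.inner.1

theorem Step.size {d : Chains n} {L R : ℕ} {π : Equiv.Perm (Fin n)}
    {s u l : Box} {q w : Fin n} (hs : Within s L R) (h : d.Step π s q w u l) :
    u.size + l.size + 1 = s.size := by
  obtain ⟨h1, h2, h3, h4⟩ := hs
  cases h with
  | left h₁ h₂ hm => simp only [Box.size, clamp]; omega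
  | right h₁ h₂ hm => simp only [Box.size, clamp]; omega

/-- Every split uses up one non-corner vertex: the sizes of the two parts add up to one less than
the size of the whole (`Step.size`). -/
theorem ncard_edges_le {d : Chains n} {L R : ℕ} (hd : d.Inj L R) (π : Equiv.Perm (Fin n)) :
    ∀ {s : Box}, Within s L R → (d.edges π s).ncard ≤ s.size := by
  suffices H : ∀ m, ∀ s : Box, s.size ≤ m → Within s L R → (d.edges π s).ncard ≤ s.size from
    fun {s} hs => H _ s le_rfl hs
  intro m
  induction m with
  | zero =>
    intro s hm hs
    rw [edges_of_not_inner]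
    · simp
    rintro x (⟨i, h₁, h₂, -⟩ | ⟨j, h₁, h₂, -⟩) <;> simp only [Box.size] at hm <;> omega
  | succ m ih =>
    intro s hm hs
    by_cases hx : ∃ x, d.Inner s x
    · obtain ⟨x, hx⟩ := hx
      obtain ⟨q, w, u, l, hst⟩ := hx.exists_step π
      have hsz := hst.size hs
      obtain ⟨hu, hl⟩ := hst.within hs
      rw [edges_of_step hd hs hst]
      have := ih u (by omega) hu
      have := ih l (by omega) hl
      have := Set.ncard_insert_le s(q, w) (d.edges π u ∪ d.edges π l)
      have := Set.ncard_union_le (d.edges π u) (d.edges π l)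
      omega
    · rw [edges_of_not_inner (not_exists.1 hx)]
      simp

/-- A point is a non-corner vertex of at most one of the two parts, so the recursion tree has a
single branch along which a given vertex remains to be processed. -/
theorem Step.inner_children {d : Chains n} {L R : ℕ} (hd : d.Inj L R) {π : Equiv.Perm (Fin n)}
    {s u l : Box} {q w : Fin n} (hs : Within s L R) (h : d.Step π s q w u l) :
    (∀ x, d.Inner u x → d.Inner s x) ∧ (∀ x, d.Inner l x → d.Inner s x) ∧
      ∀ x, d.Inner u x → ¬ d.Inner l x := by
  obtain ⟨w1, w2, w3, w4⟩ := hs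
  cases h with
  | @left k h₁ h₂ hm =>
    simp only [Inner, clamp]
    refine ⟨?_, ?_, ?_⟩
    · rintro x (⟨i, hi, hi', rfl⟩ | ⟨j, hj, hj', rfl⟩)
      exacts [Or.inl ⟨i, by omega, by omega, rfl⟩, Or.inr ⟨j, by omega, by omega, rfl⟩]
    · rintro x (⟨i, hi, hi', rfl⟩ | ⟨j, hj, hj', rfl⟩)
      exacts [Or.inl ⟨i, by omega, by omega, rfl⟩, Or.inr ⟨j, by omega, by omega, rfl⟩]
    · rintro x (⟨i, hi, hi', rfl⟩ | ⟨j, hj, hj', rfl⟩) (⟨i', hi₁, hi₂, e⟩ | ⟨j', hj₁, hj₂, e⟩)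
      · have := hd.a_inj _ (by omega) _ (by omega) e
        omega
      · exact hd.a_ne_c _ (by omega) _ (by omega) e
      · exact hd.a_ne_c _ (by omega) _ (by omega) e.symm
      · have := hd.c_inj _ (by omega) _ (by omega) e
        omega
  | @right k h₁ h₂ hm =>
    simp only [Inner, clamp]
    refine ⟨?_, ?_, ?_⟩
    · rintro x (⟨i, hi, hi', rfl⟩ | ⟨j, hj, hj', rfl⟩)
      exacts [Or.inl ⟨i, by omega, by omega, rfl⟩, Or.inr ⟨j, by omega, by omega, rfl⟩]
    · rintro x (⟨i, hi, hi', rfl⟩ | ⟨j, hj, hj', rfl⟩)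
      exacts [Or.inl ⟨i, by omega, by omega, rfl⟩, Or.inr ⟨j, by omega, by omega, rfl⟩]
    · rintro x (⟨i, hi, hi', rfl⟩ | ⟨j, hj, hj', rfl⟩) (⟨i', hi₁, hi₂, e⟩ | ⟨j', hj₁, hj₂, e⟩)
      · have := hd.a_inj _ (by omega) _ (by omega) e
        omega
      · exact hd.a_ne_c _ (by omega) _ (by omega) e
      · exact hd.a_ne_c _ (by omega) _ (by omega) e.symm
      · have := hd.c_inj _ (by omega) _ (by omega) e
        omega

theorem symmDiff_insert_union_subset {α : Type*} (e : α) (A B C : Set α) :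
    symmDiff (insert e (A ∪ C)) (insert e (B ∪ C)) ⊆ symmDiff A B := by
  intro x
  simp only [Set.mem_symmDiff, Set.mem_insert_iff, Set.mem_union]
  grind

/-- A relation between parts of two funnels that is preserved by splitting as long as the splitting
vertex is not `x`. -/
structure Simulation (d d' : Chains n) (L R L' R' : ℕ) (x : Fin n) (π : Equiv.Perm (Fin n))
    (rel : Box → Box → Prop) : Prop where
  inj : d.Inj L R
  inj' : d'.Inj L' R'
  within : ∀ {s s'}, rel s s' → Within s L R
  within' : ∀ {s s'}, rel s s' → Within s' L' R'
  size : ∀ {s s'}, rel s s' → s'.size ≤ s.size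
  inner : ∀ {s s'}, rel s s' → ∀ y, d'.Inner s' y → d.Inner s y
  step : ∀ {s s' q w u l}, rel s s' → d.Step π s q w u l → q ≠ x →
    ∃ u' l', d'.Step π s' q w u' l' ∧ rel u u' ∧ rel l l'

/-- Lockstep induction on the size. As long as the splitting vertex is not `x`, both recursions draw
the same chord and the parts remain related. Of the two parts, only the one that contains `x` can
produce a difference. When `x` itself is chosen in `G`, all chords inside `G` and `G'` are given up.
-/
theorem Simulation.symmDiff_edges {d d' : Chains n} {L R L' R' : ℕ} {x : Fin n}
    {π : Equiv.Perm (Fin n)} {rel : Box → Box → Prop}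
    (H : Simulation d d' L R L' R' x π rel) {s s' : Box} (h : rel s s') :
    (¬ d.Inner s x → d.edges π s = d'.edges π s') ∧
    (d.edges π s = d'.edges π s' ∨ ∃ G G' w u l, d.Reach π s G ∧ rel G G' ∧ d.Step π G x w u l ∧
      symmDiff (d.edges π s) (d'.edges π s') ⊆ d.edges π G ∪ d'.edges π G') := by
  suffices K : ∀ m, ∀ s s', s.size ≤ m → rel s s' →
      (¬ d.Inner s x → d.edges π s = d'.edges π s') ∧
      (d.edges π s = d'.edges π s' ∨ ∃ G G' w u l, d.Reach π s G ∧ rel G G' ∧ d.Step π G x w u l ∧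
      symmDiff (d.edges π s) (d'.edges π s') ⊆ d.edges π G ∪ d'.edges π G') from
    K _ s s' le_rfl h
  intro m
  induction m with
  | zero =>
    intro s s' hm h
    have h1 : ∀ x, ¬ d.Inner s x := by
      rintro x (⟨i, h₁, h₂, -⟩ | ⟨j, h₁, h₂, -⟩) <;> simp only [Box.size] at hm <;> omega
    have h2 : ∀ x, ¬ d'.Inner s' x := fun x hx => h1 x (H.inner h x hx)
    rw [edges_of_not_inner h1, edges_of_not_inner h2]
    simp
  | succ m ih =>
    intro s s' hm h
    by_cases hx : ∃ y, d.Inner s y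
    swap
    · have h1 := not_exists.1 hx
      have h2 : ∀ x, ¬ d'.Inner s' x := fun x hx => h1 x (H.inner h x hx)
      rw [edges_of_not_inner h1, edges_of_not_inner h2]
      simp
    obtain ⟨y, hy⟩ := hx
    obtain ⟨q, w, u, l, hst⟩ := hy.exists_step π
    by_cases hq : q = x
    · subst hq
      refine ⟨fun hn => (hn hst.inner.1).elim, Or.inr ⟨s, s', w, u, l,
        Relation.ReflTransGen.refl, h, hst, ?_⟩⟩
      exact symmDiff_le_sup
    obtain ⟨u', l', hst', hu, hl⟩ := H.step h hst hq
    have hsz := hst.size (H.within h)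
    obtain ⟨ihu, ihu'⟩ := ih u u' (by omega) hu
    obtain ⟨ihl, ihl'⟩ := ih l l' (by omega) hl
    obtain ⟨hin1, hin2, hin3⟩ := hst.inner_children H.inj (H.within h)
    rw [edges_of_step H.inj (H.within h) hst, edges_of_step H.inj' (H.within' h) hst']
    refine ⟨fun hn => ?_, ?_⟩
    · rw [ihu fun hx => hn (hin1 _ hx), ihl fun hx => hn (hin2 _ hx)]
    by_cases hux : d.Inner u x
    · rw [ihl (hin3 x hux)]
      rcases ihu' with e | ⟨G, G', w', u₁, l₁, hr, hG, hs, hsub⟩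
      · left; rw [e]
      · right
        refine ⟨G, G', w', u₁, l₁, hr.head ⟨q, w, u, l, hst, Or.inl rfl⟩, hG, hs,
          Set.Subset.trans ?_ hsub⟩
        exact symmDiff_insert_union_subset _ _ _ _
    · rw [ihu hux]
      rcases ihl' with e | ⟨G, G', w', u₁, l₁, hr, hG, hs, hsub⟩
      · left; rw [e]
      · right
        refine ⟨G, G', w', u₁, l₁, hr.head ⟨q, w, u, l, hst, Or.inr rfl⟩, hG, hs,
          Set.Subset.trans ?_ hsub⟩
        rw [Set.union_comm _ (d.edges π l), Set.union_comm _ (d'.edges π l')]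
        exact symmDiff_insert_union_subset _ _ _ _

/-- `m` bounds a quantity by the size of the part in which `x` generates its chord. -/
def BoundedBy (d : Chains n) (l r : ℕ) (π : Equiv.Perm (Fin n)) (x : Fin n) (m : ℕ) : Prop :=
  m = 0 ∨ ∃ s w u v, d.Reach π ⟨0, l, 0, r⟩ s ∧ d.Step π s x w u v ∧ m = s.size

theorem Simulation.ncard_symmDiff_le {d d' : Chains n} {L R L' R' : ℕ} {x : Fin n}
    {π : Equiv.Perm (Fin n)} {rel : Box → Box → Prop}
    (H : Simulation d d' L R L' R' x π rel) {s' : Box} (h : rel ⟨0, L, 0, R⟩ s') :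
    ∃ m, d.BoundedBy L R π x m ∧
      (symmDiff (d.edges π ⟨0, L, 0, R⟩) (d'.edges π s')).ncard ≤ 2 * m := by
  rcases (H.symmDiff_edges h).2 with e | ⟨G, G', w, u, l, hr, hG, hst, hsub⟩
  · exact ⟨0, Or.inl rfl, by simp [e]⟩
  · refine ⟨G.size, Or.inr ⟨G, w, u, l, hr, hst, rfl⟩, ?_⟩
    have h1 := Set.ncard_le_ncard hsub (Set.toFinite _)
    have h2 := Set.ncard_union_le (d.edges π G) (d'.edges π G')
    have h3 := ncard_edges_le H.inj π (H.within hG)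
    have h4 := ncard_edges_le H.inj' π (H.within' hG)
    have h5 := H.size hG
    omega

/-- Only the tangent of `c j₀` changes. -/
theorem simulation_tangent {d d' : Chains n} {l r j₀ : ℕ} (π : Equiv.Perm (Fin n))
    (hd : d.Inj l r) (ha : d'.a = d.a) (hc : d'.c = d.c)
    (hf : ∀ i < l, d'.f i = d.f i) (hg : ∀ j < r, j ≠ j₀ → d'.g j = d.g j) :
    Simulation d d' l r l r (d.c j₀) π (fun s s' => s' = s ∧ Within s l r) where
  inj := hd
  inj' := ⟨ha ▸ hd.a_inj, hc ▸ hd.c_inj, by rw [ha, hc]; exact hd.a_ne_c⟩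
  within := fun h => h.2
  within' := fun h => h.1 ▸ h.2
  size := fun h => h.1 ▸ le_rfl
  inner := by
    rintro s s' ⟨rfl, -⟩ y hy
    rwa [Inner, ha, hc] at hy
  step := by
    rintro s s' q w u l ⟨rfl, hw⟩ hst hq
    have hin : ∀ y, d'.Inner s' y → d.Inner s' y := by
      intro y hy; rwa [Inner, ha, hc] at hy
    have hws := hst.within hw
    obtain ⟨w1, w2, w3, w4⟩ := hw
    refine ⟨u, l, ?_, ⟨rfl, hws.1⟩, ⟨rfl, hws.2⟩⟩
    cases hst with
    | @left i h₁ h₂ hm =>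
      have := Step.left (d := d') (π := π) h₁ h₂ (fun x hx => by rw [ha]; exact hm x (hin x hx))
      rwa [hf i (by omega), ha, hc] at this
    | @right j h₁ h₂ hm =>
      have := Step.right (d := d') (π := π) h₁ h₂ (fun x hx => by rw [hc]; exact hm x (hin x hx))
      rwa [hg j (by omega) (fun e => hq (by rw [e])), ha, hc] at this

/-- The outermost vertex `a (l + 1)` is cut off. -/
theorem simulation_cut {d d' : Chains n} {l r : ℕ} (π : Equiv.Perm (Fin n))
    (hd : d.Inj (l + 1) r) (ha : d'.a = d.a) (hc : d'.c = d.c)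
    (hf : ∀ i < l, d'.f i = d.f i) (hg : ∀ j < r, d'.g j = d.g j) (hgl : ∀ j < r, d.g j ≤ l) :
    Simulation d d' (l + 1) r l r (d.a l) π
      (fun s s' => Within s (l + 1) r ∧ s.i₁ ≤ l ∧ s' = ⟨s.i₁, min s.i₂ l, s.j₁, s.j₂⟩) where
  inj := hd
  inj' := ⟨fun i hi i' hi' e => hd.a_inj i (by omega) i' (by omega) (by rwa [ha] at e),
    hc ▸ hd.c_inj, fun i hi j hj => by rw [ha, hc]; exact hd.a_ne_c i (by omega) j hj⟩
  within := fun h => h.1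
  within' := by
    rintro s s' ⟨⟨w1, w2, w3, w4⟩, h, rfl⟩
    constructor <;> simp only <;> omega
  size := by
    rintro s s' ⟨⟨w1, w2, w3, w4⟩, h, rfl⟩
    simp only [Box.size]; omega
  inner := by
    rintro s s' ⟨-, -, rfl⟩ y hy
    rw [Inner, ha, hc] at hy
    rcases hy with ⟨i, h, h', rfl⟩ | ⟨j, h, h', rfl⟩
    · simp only at h h'
      exact Or.inl ⟨i, h, by omega, rfl⟩
    · exact Or.inr ⟨j, h, h', rfl⟩
  step := by
    rintro s s' q w u v ⟨hw, h0, rfl⟩ hst hq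
    have hin : ∀ y, d'.Inner ⟨s.i₁, min s.i₂ l, s.j₁, s.j₂⟩ y → d.Inner s y := by
      intro y hy
      rw [Inner, ha, hc] at hy
      rcases hy with ⟨i, h, h', rfl⟩ | ⟨j, h, h', rfl⟩
      · simp only at h h'
        exact Or.inl ⟨i, h, by omega, rfl⟩
      · exact Or.inr ⟨j, h, h', rfl⟩
    have hws := hst.within hw
    obtain ⟨w1, w2, w3, w4⟩ := hw
    cases hst with
    | @left i h₁ h₂ hm =>
      -- Since `a l` is not the splitting vertex, `i + 1 ≤ l`, so the upper part still starts at an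
      -- index at most `l`.
      have hil : i ≠ l := fun e => hq (by rw [e])
      have := Step.left (d := d') (π := π) (s := ⟨s.i₁, min s.i₂ l, s.j₁, s.j₂⟩) (i := i) h₁
        (by simp only; omega) (fun x hx => by rw [ha]; exact hm x (hin x hx))
      rw [hf i (by omega), ha, hc] at this
      refine ⟨_, _, this, ⟨hws.1, by simp only; omega, rfl⟩, ⟨hws.2, h0, ?_⟩⟩
      simp only [Box.mk.injEq, and_true, true_and]; omega
    | @right j h₁ h₂ hm =>
      have := Step.right (d := d') (π := π) (s := ⟨s.i₁, min s.i₂ l, s.j₁, s.j₂⟩) (j := j) h₁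
        h₂ (fun x hx => by rw [hc]; exact hm x (hin x hx))
      have hgj := hgl j (by omega)
      -- No tangent from the right chain reaches `a (l + 1)`, so truncating the interval at `l` does
      -- not affect the clamped index.
      have e : clamp s.i₁ (min s.i₂ l) (d.g j) = clamp s.i₁ s.i₂ (d.g j) := by
        simp only [clamp]; omega
      rw [hg j (by omega), ha, hc] at this
      simp only [e] at this
      refine ⟨_, _, this, ⟨hws.1, by simp only [clamp]; omega, rfl⟩, ⟨hws.2, h0, ?_⟩⟩
      simp only [Box.mk.injEq, and_true, true_and, clamp]; omega

/-- All tangents from the non-corner vertices of `s` lead to `s` or beyond it. -/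
def Outward (d : Chains n) (s : Box) : Prop :=
  (∀ i, s.i₁ ≤ i → i < s.i₂ → s.j₁ ≤ d.f i) ∧ (∀ j, s.j₁ ≤ j → j < s.j₂ → s.i₁ ≤ d.g j)

/-- The lower part keeps both lower indices. In the upper part above a chord from `a k`, the
tangents from the left chain do not end before the chord because `f` is monotone. A remaining `c j`
has `f k ≤ j`, so `cross` forces its tangent beyond `a k`. A chord from the right chain is treated
symmetrically. -/
theorem Step.outward {d : Chains n} {l r : ℕ} (hd : d.Wf l r) {π : Equiv.Perm (Fin n)}
    {s u v : Box} {q w : Fin n} (hs : Within s l r) (ho : d.Outward s) (h : d.Step π s q w u v) :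
    d.Outward u ∧ d.Outward v := by
  obtain ⟨w1, w2, w3, w4⟩ := hs
  obtain ⟨o1, o2⟩ := ho
  cases h with
  | @left k h₁ h₂ hm =>
    simp only [Outward, clamp]
    refine ⟨⟨fun i hi hi' => ?_, fun j hj hj' => ?_⟩, ⟨fun i hi hi' => ?_, fun j hj hj' => ?_⟩⟩
    · have := hd.f_mono k i (by omega) (by omega)
      have := o1 i (by omega) (by omega)
      omega
    · have := hd.cross k (by omega) j (by omega)
      omega
    · exact o1 i (by omega) (by omega)
    · exact o2 j (by omega) (by omega)
  | @right k h₁ h₂ hm =>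
    simp only [Outward, clamp]
    refine ⟨⟨fun i hi hi' => ?_, fun j hj hj' => ?_⟩, ⟨fun i hi hi' => ?_, fun j hj hj' => ?_⟩⟩
    · have := hd.cross i (by omega) k (by omega)
      omega
    · have := hd.g_mono k j (by omega) (by omega)
      have := o2 j (by omega) (by omega)
      omega
    · exact o1 i (by omega) (by omega)
    · exact o2 j (by omega) (by omega)

/-- Correspondence of parts when the vertex `a p` is deleted. -/
def DeleteRel (d : Chains n) (l r p : ℕ) (s s' : Box) : Prop :=
  Within s (l + 1) r ∧ d.Outward s ∧ s'.j₁ = s.j₁ ∧ s'.j₂ = s.j₂ ∧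
    ((s.i₂ < p ∧ s'.i₁ = s.i₁ ∧ s'.i₂ = s.i₂) ∨
     (s.i₁ ≤ p ∧ p < s.i₂ ∧ s'.i₁ = s.i₁ ∧ s'.i₂ = s.i₂ - 1) ∨
     (p < s.i₁ ∧ s'.i₁ = s.i₁ - 1 ∧ s'.i₂ = s.i₂ - 1))

set_option maxHeartbeats 1000000 in
/-- The vertex `a p` is deleted from its chain. -/
theorem simulation_delete {d d' : Chains n} {l r p : ℕ} (π : Equiv.Perm (Fin n))
    (hd : d.Wf (l + 1) r) (hp : p ≤ l)
    (ha : ∀ i, d'.a i = d.a (if i < p then i else i + 1)) (hc : d'.c = d.c)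
    (hf : ∀ i < l, d'.f i = d.f (if i < p then i else i + 1))
    (hg : ∀ j < r, d.g j ≠ p ∧ d'.g j = if d.g j < p then d.g j else d.g j - 1) :
    Simulation d d' (l + 1) r l r (d.a p) π (d.DeleteRel l r p) where
  inj := hd.toInj
  inj' := by
    refine ⟨fun i hi i' hi' e => ?_, hc ▸ hd.c_inj, fun i hi j hj => ?_⟩
    · rw [ha, ha] at e
      have := hd.a_inj _ (by split_ifs <;> omega) _ (by split_ifs <;> omega) e
      split_ifs at this <;> omega
    · rw [ha, hc]
      exact hd.a_ne_c _ (by split_ifs <;> omega) _ hj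
  within := fun h => h.1
  within' := by
    rintro s s' ⟨⟨w1, w2, w3, w4⟩, -, h1, h2, h⟩
    constructor <;> omega
  size := by
    rintro s s' ⟨⟨w1, w2, w3, w4⟩, -, h1, h2, h⟩
    simp only [Box.size]; omega
  inner := by
    rintro s s' ⟨⟨w1, w2, w3, w4⟩, -, h1, h2, h⟩ y hy
    rcases hy with ⟨i, hi, hi', rfl⟩ | ⟨j, hj, hj', rfl⟩
    · rw [ha]
      exact Or.inl ⟨_, by split_ifs <;> omega, by split_ifs <;> omega, rfl⟩
    · rw [hc]
      exact Or.inr ⟨j, by omega, by omega, rfl⟩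
  step := by
    rintro s s' q w u v ⟨hw, ho, e1, e2, h⟩ hst hq
    have hws := hst.within hw
    have hos := hst.outward hd hw ho
    obtain ⟨w1, w2, w3, w4⟩ := hw
    have hin : ∀ y, d'.Inner s' y → d.Inner s y := by
      intro y hy
      rcases hy with ⟨i, hi, hi', rfl⟩ | ⟨j, hj, hj', rfl⟩
      · rw [ha]
        exact Or.inl ⟨_, by split_ifs <;> omega, by split_ifs <;> omega, rfl⟩
      · rw [hc]
        exact Or.inr ⟨j, by omega, by omega, rfl⟩
    cases hst with
    | @left i h₁ h₂ hm =>
      have hip : i ≠ p := fun e => hq (by rw [e])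
      -- `k` is the index of `a i` in the shortened chain.
      obtain ⟨k, hk⟩ : ∃ k, k = if i < p then i else i - 1 := ⟨_, rfl⟩
      have hki : (if k < p then k else k + 1) = i := by split_ifs at hk ⊢ <;> omega
      have hak : d'.a k = d.a i := by rw [ha, hki]
      have hkp : k < i ↔ p < i := by split_ifs at hk <;> omega
      have hks : (i < p ∧ k = i) ∨ (p < i ∧ k = i - 1) := by split_ifs at hk <;> omega
      have := Step.left (d := d') (π := π) (s := s') (i := k) (by omega)
        (by omega) (fun x hx => by rw [hak]; exact hm x (hin x hx))
      rw [hf k (by omega), hki, hak, hc, e1, e2] at this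
      refine ⟨_, _, this, ⟨hws.1, hos.1, rfl, rfl, ?_⟩, ⟨hws.2, hos.2, rfl, rfl, ?_⟩⟩
      · simp only; omega
      · simp only; omega
    | @right j h₁ h₂ hm =>
      have := Step.right (d := d') (π := π) (s := s') (j := j) (by omega)
        (by omega) (fun x hx => by rw [hc]; exact hm x (hin x hx))
      obtain ⟨hgp, hgj⟩ := hg j (by omega)
      have hog := ho.2 j h₁ h₂
      obtain ⟨I, hI⟩ : ∃ I, I = clamp s.i₁ s.i₂ (d.g j) := ⟨_, rfl⟩
      obtain ⟨I', hI'⟩ : ∃ I', I' = clamp s'.i₁ s'.i₂ (d'.g j) := ⟨_, rfl⟩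
      have hgj' : (d.g j < p ∧ d'.g j = d.g j) ∨ (p < d.g j ∧ d'.g j = d.g j - 1) := by
        split_ifs at hgj <;> omega
      -- The chord does not end at `a p`: its tangent does not (`hgp`), `s.i₂ ≠ p` in `DeleteRel`,
      -- and by `Outward` nothing is clamped from below. Hence `a p` never becomes an endpoint of a
      -- base, and `I` is simply renumbered.
      have hII : (I < p ∧ I' = I) ∨ (p < I ∧ I' = I - 1) := by
        simp only [clamp] at hI hI'
        omega
      have hIs : s.i₁ ≤ I ∧ I ≤ s.i₂ := by
        simp only [clamp] at hI
        omega
      have hki : (if I' < p then I' else I' + 1) = I := by split_ifs <;> omega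
      rw [← hI', ha, hki, hc, e1, e2] at this
      rw [← hI] at hws hos ⊢
      refine ⟨_, _, this, ⟨hws.1, hos.1, rfl, rfl, ?_⟩, ⟨hws.2, hos.2, rfl, rfl, ?_⟩⟩
      · simp only; omega
      · simp only; omega

end Chains

/-! ### Orientations of triples and segments in the plane -/

section Plane

theorem det_rotate (a b c : ℝ × ℝ) : det a b c = det b c a := by unfold det; ring

theorem det_swap_right (a b c : ℝ × ℝ) : det a b c = -det a c b := by unfold det; ring

theorem det_swap_left (a b c : ℝ × ℝ) : det a b c = -det b a c := by unfold det; ring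

theorem det_swap_ends (a b c : ℝ × ℝ) : det a b c = -det c b a := by unfold det; ring

theorem det_self_left (a b : ℝ × ℝ) : det a b a = 0 := by unfold det; ring

theorem det_self_right (a b : ℝ × ℝ) : det a b b = 0 := by unfold det; ring

theorem det_self (a b : ℝ × ℝ) : det a a b = 0 := by unfold det; ring

/-- The linear relation between the directions of three points seen from a fourth one. -/
theorem det_relation (q a b c : ℝ × ℝ) :
    det q a b * (c.1 - q.1) + det q b c * (a.1 - q.1) = det q a c * (b.1 - q.1) := by
  unfold det; ring

/-- Points to the right of `a` are ordered by their slope as seen from `a`, and `det a b c < 0` says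
that `c` has smaller slope than `b`. -/
theorem det_neg_trans_left {a b c d : ℝ × ℝ} (hb : a.1 < b.1) (hc : a.1 < c.1) (hd : a.1 < d.1)
    (h₁ : det a b c < 0) (h₂ : det a c d < 0) : det a b d < 0 := by
  have := det_relation a b c d
  have h3 := mul_neg_of_neg_of_pos h₁ (sub_pos.2 hd)
  have h4 := mul_neg_of_neg_of_pos h₂ (sub_pos.2 hb)
  by_contra h
  have := mul_nonneg (not_lt.1 h) (sub_pos.2 hc).le
  linarith

theorem det_neg_trans_right {a b c v : ℝ × ℝ} (ha : a.1 < v.1) (hb : b.1 < v.1) (hc : c.1 < v.1)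
    (h₁ : det a b v < 0) (h₂ : det b c v < 0) : det a c v < 0 := by
  rw [← det_rotate] at h₁ h₂ ⊢
  have := det_relation v a b c
  have h3 := mul_pos_of_neg_of_neg h₁ (sub_neg.2 hc)
  have h4 := mul_pos_of_neg_of_neg h₂ (sub_neg.2 ha)
  by_contra h
  have := mul_nonpos_of_nonneg_of_nonpos (not_lt.1 h) (sub_neg.2 hb).le
  linarith

/-- Two consecutive right turns of an `x`-monotone path. -/
theorem concave_four {a b c d : ℝ × ℝ} (hab : a.1 < b.1) (hbc : b.1 < c.1) (hcd : c.1 < d.1)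
    (h₁ : det a b c < 0) (h₂ : det b c d < 0) : det a b d < 0 ∧ det a c d < 0 := by
  constructor
  · have := det_relation b a c d
    have e1 : det b a c = - det a b c := det_swap_left _ _ _
    have e2 : det b a d = - det a b d := det_swap_left _ _ _
    rw [e1, e2] at this
    have h3 := mul_neg_of_neg_of_pos h₁ (sub_pos.2 (hbc.trans hcd))
    have h4 := mul_pos_of_neg_of_neg h₂ (sub_neg.2 hab)
    by_contra h
    have := mul_nonneg (not_lt.1 h) (sub_pos.2 hbc).le
    linarith
  · have := det_relation c a b d
    have e1 : det c a b = det a b c := det_rotate _ _ _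
    have e2 : det c b d = - det b c d := det_swap_left _ _ _
    have e3 : det c a d = - det a c d := det_swap_left _ _ _
    rw [e1, e2, e3] at this
    have h3 := mul_neg_of_neg_of_pos h₁ (sub_pos.2 hcd)
    have h4 := mul_pos_of_neg_of_neg h₂ (sub_neg.2 (hab.trans hbc))
    by_contra h
    have := mul_nonpos_of_nonneg_of_nonpos (not_lt.1 h) (sub_neg.2 hbc).le
    linarith

/-- If `q` is below `uv` and `z` is below the prolongation of `uq`, then `z` is below `qv`. -/
theorem det_neg_of_below {u q z v : ℝ × ℝ} (huq : u.1 < q.1) (hqz : q.1 < z.1) (hqv : q.1 < v.1)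
    (h₁ : det u v q < 0) (h₂ : det u q z < 0) : det q v z < 0 := by
  have := det_relation q v u z
  have e1 : det q v u = - det u v q := det_swap_ends _ _ _
  have e2 : det q u z = - det u q z := det_swap_left _ _ _
  rw [e1, e2] at this
  have h3 := mul_neg_of_neg_of_pos h₁ (sub_pos.2 hqz)
  have h4 := mul_neg_of_neg_of_pos h₂ (sub_pos.2 hqv)
  by_contra h
  have := mul_nonpos_of_nonneg_of_nonpos (not_lt.1 h) (sub_neg.2 huq).le
  linarith

/-- A point above a segment is above every line that passes below both endpoints. -/
theorem det_pos_of_concave {c c' u m a : ℝ × ℝ} (hc : c.1 < c'.1) (hum : u.1 < m.1)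
    (hma : m.1 < a.1) (h : det u m a < 0) (hu : 0 < det c c' u) (ha : 0 < det c c' a) :
    0 < det c c' m := by
  have key : (a.1 - u.1) * det c c' m = (a.1 - m.1) * det c c' u + (m.1 - u.1) * det c c' a
      - (c'.1 - c.1) * det u m a := by unfold det; ring
  have h1 := mul_pos (sub_pos.2 hma) hu
  have h2 := mul_pos (sub_pos.2 hum) ha
  have h3 := mul_neg_of_pos_of_neg (sub_pos.2 hc) h
  by_contra hn
  have := mul_nonpos_of_nonneg_of_nonpos (sub_pos.2 (hum.trans hma)).le (not_lt.1 hn)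
  linarith

theorem det_combo (q w a b : ℝ × ℝ) {s r : ℝ} (h : s + r = 1) :
    det q w (s • a + r • b) = s * det q w a + r * det q w b := by
  obtain rfl : s = 1 - r := by linarith
  simp only [det, Prod.fst_add, Prod.snd_add, Prod.smul_fst, Prod.smul_snd, smul_eq_mul]
  ring

theorem det_eq_zero_of_mem_openSegment {q w z : ℝ × ℝ} (h : z ∈ openSegment ℝ q w) :
    det q w z = 0 := by
  obtain ⟨s, r, _, _, hsr, rfl⟩ := h
  rw [det_combo _ _ _ _ hsr, det_self_left, det_self_right]
  ring

theorem fst_of_mem_openSegment {q w z : ℝ × ℝ} (hqw : q.1 < w.1) (h : z ∈ openSegment ℝ q w) :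
    q.1 < z.1 ∧ z.1 < w.1 := by
  obtain ⟨s, r, hs, hr, hsr, rfl⟩ := h
  obtain rfl : s = 1 - r := by linarith
  simp only [Prod.fst_add, Prod.smul_fst, smul_eq_mul]
  constructor <;> nlinarith

theorem fst_of_mem_segment {q w z : ℝ × ℝ} (hqw : q.1 ≤ w.1) (h : z ∈ segment ℝ q w) :
    q.1 ≤ z.1 ∧ z.1 ≤ w.1 := by
  obtain ⟨s, r, hs, hr, hsr, rfl⟩ := h
  obtain rfl : s = 1 - r := by linarith
  simp only [Prod.fst_add, Prod.smul_fst, smul_eq_mul]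
  constructor <;> nlinarith

theorem mem_openSegment_of_det {q z m : ℝ × ℝ} (h₁ : q.1 < m.1) (h₂ : m.1 < z.1)
    (h : det q z m = 0) : m ∈ openSegment ℝ q z := by
  have hd : 0 < z.1 - q.1 := by linarith
  refine ⟨(z.1 - m.1) / (z.1 - q.1), (m.1 - q.1) / (z.1 - q.1), div_pos (by linarith) hd,
    div_pos (by linarith) hd, by field_simp; ring, ?_⟩
  unfold det at h
  ext
  · simp only [Prod.fst_add, Prod.smul_fst, smul_eq_mul]
    field_simp; ring
  · simp only [Prod.snd_add, Prod.smul_snd, smul_eq_mul]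
    field_simp
    linarith

/-- A segment whose endpoints are on different sides of a line meets the line. -/
theorem exists_mem_segment_det_eq_zero {q z a b : ℝ × ℝ} (ha : det q z a ≤ 0) (hb : 0 < det q z b) :
    ∃ m ∈ segment ℝ a b, det q z m = 0 := by
  have hd : 0 < det q z b - det q z a := by linarith
  refine ⟨(det q z b / (det q z b - det q z a)) • a + (-det q z a / (det q z b - det q z a)) • b,
    ⟨_, _, div_nonneg hb.le hd.le, div_nonneg (by linarith) hd.le, ?_, rfl⟩, ?_⟩
  · field_simp; ring
  · rw [det_combo]
    · field_simp; ring
    · field_simp; ring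

/-- A segment below a line meets it at most in its endpoints on that line. -/
theorem eq_of_mem_segment_of_det_eq_zero {q w a b z : ℝ × ℝ} (ha : det q w a ≤ 0)
    (hb : det q w b < 0) (hz : z ∈ segment ℝ a b) (h : det q w z = 0) :
    z = a ∧ det q w a = 0 := by
  obtain ⟨s, r, hs, hr, hsr, rfl⟩ := hz
  rw [det_combo _ _ _ _ hsr] at h
  have h1 := mul_nonpos_of_nonneg_of_nonpos hs ha
  have h2 := mul_nonpos_of_nonneg_of_nonpos hr hb.le
  have h3 : r * det q w b = 0 := by linarith
  have hr0 : r = 0 := by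
    rcases mul_eq_zero.1 h3 with h | h
    · exact h
    · exact absurd h hb.ne
  obtain rfl : s = 1 := by linarith
  subst hr0
  simp_all

end Plane

/-! ### Consecutive elements of sorted lists -/

section List

/-- A discrete intermediate value theorem; `w ∈ y :: r` records that the switch of `Q` takes place
no later than at `w`. It locates the edge at which a chain crosses a line. -/
theorem exists_infix_of_head_of_not {α : Type*} {Q : α → Prop} {L : List α} {o w : α}
    (ho : L.head? = some o) (hQ : Q o) (hw : w ∈ L) (hQw : ¬ Q w) :
    ∃ s x y r, L = s ++ x :: y :: r ∧ Q x ∧ ¬ Q y ∧ w ∈ y :: r := by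
  induction L generalizing o with
  | nil => simp at hw
  | cons a L ih =>
    simp only [List.head?_cons, Option.some.injEq] at ho
    subst ho
    have hwL : w ∈ L := by
      rcases List.mem_cons.1 hw with rfl | h
      · exact (hQw hQ).elim
      · exact h
    cases L with
    | nil => simp at hwL
    | cons b L =>
      by_cases hb : Q b
      · obtain ⟨s, x, y, r, e, h⟩ := ih (o := b) rfl hb hwL
        exact ⟨a :: s, x, y, r, by rw [e]; rfl, h⟩
      · exact ⟨[], a, b, L, rfl, hQ, hb, hwL⟩

theorem lt_of_head?_of_pairwise {α : Type*} {R : α → α → Prop} {L : List α} {u z : α}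
    (hL : L.Pairwise R) (hu : L.head? = some u) (hz : z ∈ L) : z = u ∨ R u z := by
  cases L with
  | nil => simp at hz
  | cons a L =>
    simp only [List.head?_cons, Option.some.injEq] at hu
    subst hu
    rcases List.mem_cons.1 hz with h | h
    · exact Or.inl h
    · exact Or.inr ((List.pairwise_cons.1 hL).1 z h)

theorem lt_of_getLast?_of_pairwise {α : Type*} {R : α → α → Prop} {L : List α} {u z : α}
    (hL : L.Pairwise R) (hu : L.getLast? = some u) (hz : z ∈ L) : z = u ∨ R z u := by
  rw [← List.head?_reverse] at hu
  exact lt_of_head?_of_pairwise (List.pairwise_reverse.2 hL) hu (List.mem_reverse.2 hz)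

theorem le_or_le_of_infix {α : Type*} {x : α → ℝ} {L : List α} {a b q : α}
    (hL : L.Pairwise (fun i j => x i < x j)) (h : [a, b] <:+: L) (hq : q ∈ L) :
    x a < x b ∧ (x q ≤ x a ∨ x b ≤ x q) := by
  obtain ⟨s, r, rfl⟩ := h
  simp only [List.append_assoc, List.cons_append, List.nil_append, List.pairwise_append,
    List.pairwise_cons, List.mem_cons, List.mem_append] at hL hq
  refine ⟨hL.2.1.1 b (Or.inl rfl), ?_⟩
  rcases hq with h | rfl | rfl | h
  · exact Or.inl (hL.2.2 q h a (Or.inl rfl)).le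
  · exact Or.inl le_rfl
  · exact Or.inr le_rfl
  · exact Or.inr (hL.2.1.2.1 q h).le

theorem eq_of_pairwise_lt {α : Type*} {x : α → ℝ} {L : List α} {a b : α}
    (hL : L.Pairwise (fun i j => x i < x j)) (ha : a ∈ L) (hb : b ∈ L) (h : x a = x b) :
    a = b := by
  induction L with
  | nil => simp at ha
  | cons c L ih =>
    rw [List.pairwise_cons] at hL
    rcases List.mem_cons.1 ha with rfl | ha' <;> rcases List.mem_cons.1 hb with rfl | hb'
    · rfl
    · exact absurd h (hL.1 b hb').ne
    · exact absurd h (hL.1 a ha').ne'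
    · exact ih hL.2 ha' hb'

end List

/-! ### Points of tangency and visibility in a funnel -/

section Funnels

variable {n : ℕ} (p : Fin n → ℝ → ℝ × ℝ) (t : ℝ)

/-- No pair of points has a common `x`-coordinate and no triple is collinear. -/
structure NonDegenerate : Prop where
  fst_ne : ∀ {i j}, i ≠ j → (p i t).1 ≠ (p j t).1
  det_ne : ∀ {i j k}, i ≠ j → j ≠ k → i ≠ k → det (p i t) (p j t) (p k t) ≠ 0

/-- `F` is a funnel with base `uv` and apex `o`: both chains are concave and below the base. -/
structure Good (F : Funnel n) (u o v : Fin n) : Prop where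
  head_left : F.left.head? = some u
  last_left : F.left.getLast? = some o
  head_right : F.right.head? = some o
  last_right : F.right.getLast? = some v
  ne_left : u ≠ o
  ne_right : o ≠ v
  sorted_left : F.left.Pairwise (fun i j => (p i t).1 < (p j t).1)
  sorted_right : F.right.Pairwise (fun i j => (p i t).1 < (p j t).1)
  concave_left : ∀ x ∈ F.left, ∀ y ∈ F.left, ∀ z ∈ F.left, (p x t).1 < (p y t).1 →
    (p y t).1 < (p z t).1 → det (p x t) (p y t) (p z t) < 0
  concave_right : ∀ x ∈ F.right, ∀ y ∈ F.right, ∀ z ∈ F.right, (p x t).1 < (p y t).1 →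
    (p y t).1 < (p z t).1 → det (p x t) (p y t) (p z t) < 0
  base : ∀ z, z ∈ F.left ∨ z ∈ F.right → z ≠ u → z ≠ v → det (p u t) (p v t) (p z t) < 0

variable {p t}

namespace Good

variable {F : Funnel n} {u o v : Fin n} (h : Good p t F u o v)
include h

theorem u_mem : u ∈ F.left := List.mem_of_mem_head? h.head_left

theorem o_mem_left : o ∈ F.left := List.mem_of_mem_getLast? h.last_left

theorem o_mem_right : o ∈ F.right := List.mem_of_mem_head? h.head_right

theorem v_mem : v ∈ F.right := List.mem_of_mem_getLast? h.last_right

theorem left_of_o {z : Fin n} (hz : z ∈ F.left) : z = o ∨ (p z t).1 < (p o t).1 :=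
  lt_of_getLast?_of_pairwise h.sorted_left h.last_left hz

theorem right_of_u {z : Fin n} (hz : z ∈ F.left) : z = u ∨ (p u t).1 < (p z t).1 :=
  lt_of_head?_of_pairwise h.sorted_left h.head_left hz

theorem right_of_o {z : Fin n} (hz : z ∈ F.right) : z = o ∨ (p o t).1 < (p z t).1 :=
  lt_of_head?_of_pairwise h.sorted_right h.head_right hz

theorem left_of_v {z : Fin n} (hz : z ∈ F.right) : z = v ∨ (p z t).1 < (p v t).1 :=
  lt_of_getLast?_of_pairwise h.sorted_right h.last_right hz

theorem u_lt_o : (p u t).1 < (p o t).1 := (h.left_of_o h.u_mem).resolve_left h.ne_left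

theorem o_lt_v : (p o t).1 < (p v t).1 := (h.left_of_v h.o_mem_right).resolve_left h.ne_right

theorem left_le_o {z : Fin n} (hz : z ∈ F.left) : (p z t).1 ≤ (p o t).1 := by
  rcases h.left_of_o hz with rfl | h'
  exacts [le_rfl, h'.le]

theorem o_le_right {z : Fin n} (hz : z ∈ F.right) : (p o t).1 ≤ (p z t).1 := by
  rcases h.right_of_o hz with rfl | h'
  exacts [le_rfl, h'.le]

/-- The base endpoint `v` is above the prolongation of the left chain. -/
theorem det_v_neg {q z : Fin n} (hq : q ∈ F.left) (hqu : q ≠ u) (hz : z ∈ F.left)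
    (hqz : (p q t).1 < (p z t).1) : det (p q t) (p v t) (p z t) < 0 := by
  have huq := (h.right_of_u hq).resolve_left hqu
  have hqv : (p q t).1 < (p v t).1 := (h.left_le_o hq).trans_lt h.o_lt_v
  refine det_neg_of_below huq hqz hqv (h.base q (Or.inl hq) hqu ?_)
    (h.concave_left u h.u_mem q hq z hz huq hqz)
  rintro rfl
  exact lt_irrefl _ hqv

/-- `w` is the point of tangency from the vertex `q` of the left chain to the right chain. -/
def _root_.KineticTriangulation.IsTangent (p : Fin n → ℝ → ℝ × ℝ) (t : ℝ) (F : Funnel n)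
    (o q w : Fin n) : Prop :=
  w ∈ F.right ∧ w ≠ o ∧ ∀ z ∈ F.right, z ≠ o → z ≠ w → det (p q t) (p w t) (p z t) < 0

/-- Seen from `q`, the later part of the left chain is below `v` (`det_v_neg`), and `v` is not above
the point of tangency `w`. -/
theorem det_tangent_neg {q w z : Fin n} (hq : q ∈ F.left) (hqu : q ≠ u)
    (hw : IsTangent p t F o q w) (hz : z ∈ F.left) (hqz : (p q t).1 < (p z t).1) :
    det (p q t) (p w t) (p z t) < 0 := by
  have hv := h.det_v_neg hq hqu hz hqz
  by_cases hwv : w = v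
  · rwa [hwv]
  have hqo := h.left_le_o hq
  exact det_neg_trans_left (hqo.trans_lt ((h.right_of_o hw.1).resolve_left hw.2.1))
    (hqo.trans_lt h.o_lt_v) hqz
    (hw.2.2 v h.v_mem h.ne_right.symm (Ne.symm hwv)) hv

theorem det_tangent_right_neg {q w z : Fin n} (hq : q ∈ F.left) (hqu : q ≠ u) (hqo : q ≠ o)
    (hw : IsTangent p t F o q w) (hz : z ∈ F.right) (hzw : z ≠ w) :
    det (p q t) (p w t) (p z t) < 0 := by
  by_cases hzo : z = o
  · rw [hzo]
    exact h.det_tangent_neg hq hqu hw h.o_mem_left ((h.left_of_o hq).resolve_left hqo)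
  · exact hw.2.2 z hz hzo hzw

/-- All vertices to the right of `q` other than `w` are strictly below the line `qw`, so an edge
there can meet this line only in one of its own endpoints, `q` or `w`. Edges to the left of `q` are
excluded by their `x`-coordinates. The base is met at most in `w`, because `q` is strictly below it.
-/
theorem visible_of_isTangent {q w : Fin n} (hq : q ∈ F.left) (hqu : q ≠ u) (hqo : q ≠ o)
    (hw : IsTangent p t F o q w) : Visible p t F q w := by
  have hqo' := (h.left_of_o hq).resolve_left hqo
  have how := (h.right_of_o hw.1).resolve_left hw.2.1
  have hqw := hqo'.trans how
  refine Set.disjoint_left.2 fun z hz hb => ?_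
  have hz0 := det_eq_zero_of_mem_openSegment hz
  obtain ⟨hz1, hz2⟩ := fst_of_mem_openSegment hqw hz
  obtain ⟨i, j, he | he | ⟨he₁, he₂⟩, hzs⟩ := hb
  · obtain ⟨hij, hc⟩ := le_or_le_of_infix (x := fun i => (p i t).1) h.sorted_left he hq
    have hi : i ∈ F.left := he.subset (by simp)
    have hj : j ∈ F.left := he.subset (by simp)
    rcases hc with hc | hc
    · have hj' := h.det_tangent_neg hq hqu hw hj (hc.trans_lt hij)
      have hi' : det (p q t) (p w t) (p i t) ≤ 0 := by
        rcases hc.eq_or_lt with e | hlt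
        · rw [← eq_of_pairwise_lt h.sorted_left hq hi e, det_self_left]
        · exact (h.det_tangent_neg hq hqu hw hi hlt).le
      obtain ⟨rfl, h0⟩ := eq_of_mem_segment_of_det_eq_zero hi' hj' hzs hz0
      exact (h.det_tangent_neg hq hqu hw hi hz1).ne h0
    · have := (fst_of_mem_segment hij.le hzs).2
      exact absurd (lt_of_lt_of_le hz1 (this.trans hc)) (lt_irrefl _)
  · have hi : i ∈ F.right := he.subset (by simp)
    have hj : j ∈ F.right := he.subset (by simp)
    have hij := (le_or_le_of_infix (x := fun i => (p i t).1) h.sorted_right he hi).1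
    by_cases hjw : j = w
    · subst hjw
      have hi' := h.det_tangent_right_neg hq hqu hqo hw hi (fun e => by subst e; exact lt_irrefl _ hij)
      obtain ⟨rfl, -⟩ := eq_of_mem_segment_of_det_eq_zero (det_self_right _ _).le hi'
        (segment_symm ℝ (p i t) (p j t) ▸ hzs) hz0
      exact lt_irrefl _ hz2
    · have hj' := h.det_tangent_right_neg hq hqu hqo hw hj hjw
      have hi' : det (p q t) (p w t) (p i t) ≤ 0 := by
        by_cases hiw : i = w
        · rw [hiw, det_self_right]
        · exact (h.det_tangent_right_neg hq hqu hqo hw hi hiw).le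
      obtain ⟨rfl, h0⟩ := eq_of_mem_segment_of_det_eq_zero hi' hj' hzs hz0
      by_cases hiw : i = w
      · subst hiw; exact lt_irrefl _ hz2
      · exact (h.det_tangent_right_neg hq hqu hqo hw hi hiw).ne h0
  · rw [h.head_left, Option.some.injEq] at he₁
    rw [h.last_right, Option.some.injEq] at he₂
    subst he₁ he₂
    have hz0' : det (p u t) (p v t) z = 0 := by
      obtain ⟨s, r, _, _, hsr, rfl⟩ := hzs
      rw [det_combo _ _ _ _ hsr, det_self_left, det_self_right]
      ring
    have hq' : det (p u t) (p v t) (p q t) < 0 := by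
      refine h.base q (Or.inl hq) hqu ?_
      rintro rfl
      exact lt_irrefl _ (hqo'.trans h.o_lt_v)
    have hw' : det (p u t) (p v t) (p w t) ≤ 0 := by
      by_cases hwv : w = v
      · rw [hwv, det_self_right]
      · refine (h.base w (Or.inr hw.1) ?_ hwv).le
        rintro rfl
        exact lt_irrefl _ (h.u_lt_o.trans how)
    have hzs' : z ∈ segment ℝ (p w t) (p q t) :=
      segment_symm ℝ (p q t) (p w t) ▸ openSegment_subset_segment _ _ _ hz
    obtain ⟨rfl, -⟩ := eq_of_mem_segment_of_det_eq_zero hw' hq' hzs' hz0'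
    exact lt_irrefl _ hz2

/-- The line `qz` passes above the apex and below `w`. So the right chain crosses it between the
apex and `w`, hence strictly between `q` and `z`. -/
theorem not_visible_of_isTangent {q w z : Fin n} (hq : q ∈ F.left) (hqu : q ≠ u) (hqo : q ≠ o)
    (hw : IsTangent p t F o q w) (hz : z ∈ F.right) (hwz : (p w t).1 < (p z t).1) :
    ¬ Visible p t F q z := by
  have hqo' := (h.left_of_o hq).resolve_left hqo
  have how := (h.right_of_o hw.1).resolve_left hw.2.1
  have hzo : z ≠ o := by rintro rfl; exact lt_irrefl _ (how.trans hwz)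
  have hzw : z ≠ w := by rintro rfl; exact lt_irrefl _ hwz
  have hqz : (p q t).1 < (p z t).1 := hqo'.trans (how.trans hwz)
  have hv := h.det_v_neg hq hqu h.o_mem_left hqo'
  -- Seen from `q`, the apex is below `v`, and `v` is below `z` by concavity of the right chain
  -- beyond `w`.
  have ho : det (p q t) (p z t) (p o t) < 0 := by
    by_cases hzv : z = v
    · rwa [hzv]
    have hzv' := (h.left_of_v hz).resolve_left hzv
    refine det_neg_trans_left hqz (hqz.trans hzv') hqo' ?_ hv
    have hwv : v ≠ w := by rintro rfl; exact lt_irrefl _ (hwz.trans hzv')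
    refine det_neg_trans_right (hqz.trans hzv') (hwz.trans hzv') hzv'
      (hw.2.2 v h.v_mem h.ne_right.symm hwv) ?_
    exact h.concave_right w hw.1 z hz v h.v_mem hwz hzv'
  have hwpos : 0 < det (p q t) (p z t) (p w t) := by
    rw [det_swap_right]
    have := hw.2.2 z hz hzo hzw
    linarith
  obtain ⟨s, x, y, r, e, hx, hy, hwy⟩ := exists_infix_of_head_of_not
    (Q := fun x => det (p q t) (p z t) (p x t) ≤ 0) h.head_right ho.le hw.1 (not_le.2 hwpos)
  have hinf : [x, y] <:+: F.right := ⟨s, r, by rw [e]; simp⟩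
  have hxm : x ∈ F.right := hinf.subset (by simp)
  have hxy := (le_or_le_of_infix (x := fun i => (p i t).1) h.sorted_right hinf hxm).1
  have hyw : (p y t).1 ≤ (p w t).1 := by
    rcases List.mem_cons.1 hwy with rfl | hwr
    · exact le_rfl
    · have := h.sorted_right
      rw [e, List.pairwise_append, List.pairwise_cons, List.pairwise_cons] at this
      exact (this.2.1.2.1 w hwr).le
  obtain ⟨m, hm, hm0⟩ := exists_mem_segment_det_eq_zero hx (not_le.1 hy)
  obtain ⟨hm1, hm2⟩ := fst_of_mem_segment hxy.le hm
  intro hvis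
  refine Set.disjoint_left.1 hvis (mem_openSegment_of_det ?_ ?_ hm0) ⟨x, y, Or.inr (Or.inl hinf), hm⟩
  · exact (hqo'.trans_le (h.o_le_right hxm)).trans_le hm1
  · exact (hm2.trans hyw).trans_lt hwz

end Good

end Funnels

/-! ### Reflection at the vertical axis -/

section Mirror

variable {n : ℕ}

/-- Reflection of the motion at the vertical axis. -/
def mirror (p : Fin n → ℝ → ℝ × ℝ) : Fin n → ℝ → ℝ × ℝ := fun i t => (-(p i t).1, (p i t).2)

@[simp] theorem mirror_mirror (p : Fin n → ℝ → ℝ × ℝ) : mirror (mirror p) = p := by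
  funext i t; simp [mirror]

theorem mirror_fst (p : Fin n → ℝ → ℝ × ℝ) (i : Fin n) (t : ℝ) :
    (mirror p i t).1 = -(p i t).1 := rfl

theorem det_mirror (p : Fin n → ℝ → ℝ × ℝ) (i j k : Fin n) (t : ℝ) :
    det (mirror p i t) (mirror p j t) (mirror p k t) = det (p k t) (p j t) (p i t) := by
  simp only [det, mirror]; ring

/-- Reflection of a funnel. -/
def Funnel.mirror (F : Funnel n) : Funnel n := ⟨F.right.reverse, F.left.reverse⟩

@[simp] theorem Funnel.mirror_mirror (F : Funnel n) : F.mirror.mirror = F := by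
  simp [Funnel.mirror]

theorem Funnel.isEdge_mirror {F : Funnel n} {i j : Fin n} : F.mirror.IsEdge i j ↔ F.IsEdge j i := by
  have key : ∀ L : List (Fin n), [i, j] <:+: L.reverse ↔ [j, i] <:+: L := fun L => by
    rw [← List.reverse_infix, List.reverse_reverse]; rfl
  simp only [Funnel.IsEdge, Funnel.mirror, key, List.head?_reverse, List.getLast?_reverse]
  tauto

theorem Funnel.isNonCorner_mirror {F : Funnel n} {i : Fin n} :
    F.mirror.IsNonCorner i ↔ F.IsNonCorner i := by
  simp only [Funnel.IsNonCorner, Funnel.mirror, List.tail_reverse, List.dropLast_reverse,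
    List.mem_reverse, List.tail_dropLast]
  tauto

/-- The reflection of the plane at the vertical axis. -/
def reflect : (ℝ × ℝ) ≃ₗ[ℝ] (ℝ × ℝ) := (LinearEquiv.neg ℝ).prodCongr (LinearEquiv.refl ℝ ℝ)

theorem reflect_apply (p : Fin n → ℝ → ℝ × ℝ) (i : Fin n) (t : ℝ) :
    reflect (p i t) = mirror p i t := rfl

theorem boundary_mirror (p : Fin n → ℝ → ℝ × ℝ) (t : ℝ) (F : Funnel n) :
    boundary (mirror p) t F.mirror = reflect '' boundary p t F := by
  ext z
  simp only [boundary, Set.mem_image, Set.mem_ofPred_eq, Funnel.isEdge_mirror]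
  constructor
  · rintro ⟨i, j, he, hz⟩
    rw [← reflect_apply, ← reflect_apply, segment_symm] at hz
    obtain ⟨y, hy, rfl⟩ := (image_segment ℝ reflect.toLinearMap.toAffineMap _ _).symm ▸ hz
    exact ⟨y, ⟨j, i, he, hy⟩, rfl⟩
  · rintro ⟨y, ⟨i, j, he, hy⟩, rfl⟩
    refine ⟨j, i, he, ?_⟩
    rw [← reflect_apply, ← reflect_apply, segment_symm]
    have := image_segment ℝ reflect.toLinearMap.toAffineMap (p i t) (p j t)
    exact this ▸ Set.mem_image_of_mem _ hy

theorem visible_mirror {p : Fin n → ℝ → ℝ × ℝ} {t : ℝ} {F : Funnel n} {i j : Fin n} :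
    Visible (mirror p) t F.mirror i j ↔ Visible p t F i j := by
  rw [Visible, Visible, boundary_mirror, ← reflect_apply, ← reflect_apply]
  have := image_openSegment ℝ reflect.toLinearMap.toAffineMap (p i t) (p j t)
  have e : openSegment ℝ (reflect (p i t)) (reflect (p j t)) =
    reflect '' openSegment ℝ (p i t) (p j t) := this.symm
  rw [e, Set.disjoint_image_iff reflect.injective]

theorem NonDegenerate.mirror {p : Fin n → ℝ → ℝ × ℝ} {t : ℝ} (h : NonDegenerate p t) :
    NonDegenerate (mirror p) t where
  fst_ne := fun hij => by
    simpa only [mirror_fst, ne_eq, neg_inj] using h.fst_ne hij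
  det_ne := fun h₁ h₂ h₃ => by
    rw [det_mirror]
    exact h.det_ne h₂.symm h₁.symm h₃.symm

theorem Good.mirror {p : Fin n → ℝ → ℝ × ℝ} {t : ℝ} {F : Funnel n} {u o v : Fin n}
    (h : Good p t F u o v) : Good (mirror p) t F.mirror v o u where
  head_left := by simp [Funnel.mirror, h.last_right]
  last_left := by simp [Funnel.mirror, h.head_right]
  head_right := by simp [Funnel.mirror, h.last_left]
  last_right := by simp [Funnel.mirror, h.head_left]
  ne_left := h.ne_right.symm
  ne_right := h.ne_left.symm
  sorted_left := by
    simp only [Funnel.mirror, List.pairwise_reverse, mirror_fst, neg_lt_neg_iff]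
    exact h.sorted_right
  sorted_right := by
    simp only [Funnel.mirror, List.pairwise_reverse, mirror_fst, neg_lt_neg_iff]
    exact h.sorted_left
  concave_left := by
    simp only [Funnel.mirror, List.mem_reverse, mirror_fst, neg_lt_neg_iff, det_mirror]
    exact fun x hx y hy z hz hxy hyz => h.concave_right z hz y hy x hx hyz hxy
  concave_right := by
    simp only [Funnel.mirror, List.mem_reverse, mirror_fst, neg_lt_neg_iff, det_mirror]
    exact fun x hx y hy z hz hxy hyz => h.concave_left z hz y hy x hx hyz hxy
  base := by
    simp only [Funnel.mirror, List.mem_reverse, det_mirror]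
    intro z hz hzv hzu
    rw [det_rotate]
    exact h.base z hz.symm hzu hzv

/-- The chord `qw` starts on the left chain and ends at the last visible vertex of the right
chain. -/
def LeftSplit (p : Fin n → ℝ → ℝ × ℝ) (t : ℝ) (F : Funnel n) (q w : Fin n) (Fu Fl : Funnel n) :
    Prop :=
  Visible p t F q w ∧ ∃ l₁ l₂ r₁ r₂ : List (Fin n),
    l₁ ≠ [] ∧ l₂ ≠ [] ∧ F.left = l₁ ++ q :: l₂ ∧ F.right = r₁ ++ w :: r₂ ∧
      (∀ z ∈ r₂, ¬ Visible p t F q z) ∧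
      Fu = ⟨l₁ ++ [q], q :: w :: r₂⟩ ∧ Fl = ⟨q :: l₂, r₁ ++ [w]⟩

/-- A chord that starts on the right chain is one that starts on the left chain of the mirror image,
so the geometry of chords has to be worked out for one side only. -/
theorem split_iff {p : Fin n → ℝ → ℝ × ℝ} {π : Equiv.Perm (Fin n)} {t : ℝ} {F : Funnel n}
    {q w : Fin n} {Fu Fl : Funnel n} :
    Split p π t F q w Fu Fl ↔ F.IsNonCorner q ∧ (∀ i, F.IsNonCorner i → π q ≤ π i) ∧
      (LeftSplit p t F q w Fu Fl ∨ LeftSplit (mirror p) t F.mirror q w Fu.mirror Fl.mirror) := by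
  simp only [Split, LeftSplit, visible_mirror]
  refine and_congr_right fun _ => and_congr_right fun _ => ?_
  rw [← and_or_left]
  refine and_congr_right fun _ => ?_
  constructor
  · rintro ⟨l₁, l₂, r₁, r₂, h | ⟨h₁, h₂, h₃, h₄, h₅, rfl, rfl⟩⟩
    · exact Or.inl ⟨l₁, l₂, r₁, r₂, h⟩
    · refine Or.inr ⟨r₂.reverse, r₁.reverse, l₂.reverse, l₁.reverse, by simpa using h₂,
        by simpa using h₁, ?_, ?_, by simpa using h₅, ?_, ?_⟩
      · simp [Funnel.mirror, h₄]
      · simp [Funnel.mirror, h₃]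
      · simp [Funnel.mirror]
      · simp [Funnel.mirror]
  · rintro (⟨l₁, l₂, r₁, r₂, h⟩ | ⟨l₁, l₂, r₁, r₂, h₁, h₂, h₃, h₄, h₅, h₆, h₇⟩)
    · exact ⟨l₁, l₂, r₁, r₂, Or.inl h⟩
    · refine ⟨r₂.reverse, r₁.reverse, l₂.reverse, l₁.reverse, Or.inr ⟨by simpa using h₂,
        by simpa using h₁, ?_, ?_, by simpa using h₅, ?_, ?_⟩⟩
      · have := congrArg List.reverse h₄
        simpa [Funnel.mirror] using this
      · have := congrArg List.reverse h₃
        simpa [Funnel.mirror] using this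
      · have := congrArg Funnel.mirror h₆
        rw [Funnel.mirror_mirror] at this
        rw [this]; simp [Funnel.mirror]
      · have := congrArg Funnel.mirror h₇
        rw [Funnel.mirror_mirror] at this
        rw [this]; simp [Funnel.mirror]

end Mirror

/-! ### The two parts of a split are again funnels -/

section Parts

variable {n : ℕ} {p : Fin n → ℝ → ℝ × ℝ} {t : ℝ} {F : Funnel n} {u o v q w : Fin n}
  {l₁ l₂ r₁ r₂ : List (Fin n)}

theorem Good.mem_upper_right (h : Good p t F u o v) (hl₂ : l₂ ≠ []) (hL : F.left = l₁ ++ q :: l₂)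
    (hR : F.right = r₁ ++ w :: r₂) {x : Fin n} (hx : x ∈ q :: w :: r₂) :
    x = q ∨ (x ∈ F.right ∧ (p q t).1 < (p x t).1) := by
  rcases List.mem_cons.1 hx with rfl | hx
  · exact Or.inl rfl
  · have hx' : x ∈ F.right := by rw [hR]; simp_all
    refine Or.inr ⟨hx', lt_of_lt_of_le ?_ (h.o_le_right hx')⟩
    have hs := h.sorted_left
    rw [hL, List.pairwise_append, List.pairwise_cons] at hs
    refine hs.2.1.1 o ?_
    have := h.last_left
    rw [hL, List.getLast?_append_of_ne_nil _ (by simp)] at this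
    cases l₂ with
    | nil => exact (hl₂ rfl).elim
    | cons b l₂ =>
      rw [List.getLast?_cons_cons] at this
      exact List.mem_of_mem_getLast? this

theorem Good.corner_ne (h : Good p t F u o v) (hl₁ : l₁ ≠ []) (hl₂ : l₂ ≠ [])
    (hL : F.left = l₁ ++ q :: l₂) : q ≠ u ∧ q ≠ o ∧ u ∈ l₁ ∧ o ∈ l₂ := by
  have hs := h.sorted_left
  rw [hL, List.pairwise_append, List.pairwise_cons] at hs
  have hu : u ∈ l₁ := by
    have := h.head_left
    rw [hL, List.head?_append_of_ne_nil _ hl₁] at this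
    exact List.mem_of_mem_head? this
  have ho : o ∈ l₂ := by
    have := h.last_left
    rw [hL, List.getLast?_append_of_ne_nil _ (by simp)] at this
    cases l₂ with
    | nil => exact (hl₂ rfl).elim
    | cons b l₂ =>
      rw [List.getLast?_cons_cons] at this
      exact List.mem_of_mem_getLast? this
  refine ⟨?_, ?_, hu, ho⟩
  · rintro rfl
    exact lt_irrefl _ (hs.2.2 q hu q (by simp))
  · rintro rfl
    exact lt_irrefl _ (hs.2.1.1 q ho)

/-- Only the concavity of the right chain after `q` is put in front of it is new. It holds at `w`
because `w` is the point of tangency from `q`, and further out by composing consecutive right turns.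
-/
theorem Good.upper (h : Good p t F u o v) (hl₁ : l₁ ≠ []) (hl₂ : l₂ ≠ [])
    (hL : F.left = l₁ ++ q :: l₂) (hR : F.right = r₁ ++ w :: r₂) (hw : IsTangent p t F o q w) :
    Good p t ⟨l₁ ++ [q], q :: w :: r₂⟩ u q v := by
  obtain ⟨hqu, hqo, hul, hol⟩ := h.corner_ne hl₁ hl₂ hL
  have hq : q ∈ F.left := by rw [hL]; simp
  have hsub : (l₁ ++ [q]).Sublist F.left := by rw [hL]; simp
  have hsubR : (w :: r₂).Sublist F.right := by rw [hR]; simp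
  have hqv : (p q t).1 < (p v t).1 := (h.left_le_o hq).trans_lt h.o_lt_v
  constructor
  · have := h.head_left
    rw [hL, List.head?_append_of_ne_nil _ hl₁] at this
    simp only
    rwa [List.head?_append_of_ne_nil _ hl₁]
  · simp
  · simp
  · have := h.last_right
    rw [hR, List.getLast?_append_of_ne_nil _ (by simp)] at this
    rwa [List.getLast?_cons_cons]
  · exact hqu.symm
  · rintro rfl; exact lt_irrefl _ hqv
  · exact h.sorted_left.sublist hsub
  · refine List.pairwise_cons.2 ⟨fun x hx => ?_, h.sorted_right.sublist hsubR⟩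
    rcases h.mem_upper_right hl₂ hL hR (List.mem_cons_of_mem q hx) with rfl | h'
    · have := hsubR.subset hx
      exact absurd ((h.left_of_o hq).resolve_left hqo) (not_lt.2 (h.o_le_right this))
    · exact h'.2
  · exact fun x hx y hy z hz => h.concave_left x (hsub.subset hx) y (hsub.subset hy) z
      (hsub.subset hz)
  · intro x hx y hy z hz hxy hyz
    have hmem : ∀ x ∈ q :: w :: r₂, (p q t).1 < (p x t).1 → x ∈ w :: r₂ := by
      intro x hx hlt
      rcases List.mem_cons.1 hx with rfl | hx
      · exact (lt_irrefl _ hlt).elim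
      · exact hx
    have hge : (p q t).1 ≤ (p x t).1 := by
      rcases h.mem_upper_right hl₂ hL hR hx with rfl | h'
      exacts [le_rfl, h'.2.le]
    have hy' := hmem y hy (hge.trans_lt hxy)
    have hz' := hmem z hz (hge.trans_lt (hxy.trans hyz))
    rcases List.mem_cons.1 hx with rfl | hx'
    · by_cases hyw : y = w
      · subst hyw
        refine h.det_tangent_right_neg hq hqu hqo hw (hsubR.subset hz') ?_
        rintro rfl; exact lt_irrefl _ hyz
      · have hwy : (p w t).1 < (p y t).1 := by
          have := h.sorted_right.sublist hsubR
          rw [List.pairwise_cons] at this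
          exact this.1 y ((List.mem_cons.1 hy').resolve_left hyw)
        have hqw : (p x t).1 < (p w t).1 :=
          ((h.left_of_o hq).resolve_left hqo).trans_le (h.o_le_right hw.1)
        exact (concave_four hqw hwy hyz
          (h.det_tangent_right_neg hq hqu hqo hw (hsubR.subset hy') hyw)
          (h.concave_right w hw.1 y (hsubR.subset hy') z (hsubR.subset hz') hwy hyz)).2
    · exact h.concave_right x (hsubR.subset hx') y (hsubR.subset hy') z (hsubR.subset hz') hxy hyz
  · rintro z (hz | hz) h₁ h₂
    · exact h.base z (Or.inl (hsub.subset hz)) h₁ h₂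
    · rcases List.mem_cons.1 hz with rfl | hz
      · exact h.base z (Or.inl hq) h₁ h₂
      · exact h.base z (Or.inr (hsubR.subset hz)) h₁ h₂

/-- The chord is a proper base because all other vertices of this part are strictly below the
tangent. -/
theorem Good.lower (h : Good p t F u o v) (hl₁ : l₁ ≠ []) (hl₂ : l₂ ≠ [])
    (hL : F.left = l₁ ++ q :: l₂) (hR : F.right = r₁ ++ w :: r₂) (hw : IsTangent p t F o q w) :
    Good p t ⟨q :: l₂, r₁ ++ [w]⟩ q o w := by
  obtain ⟨hqu, hqo, hul, hol⟩ := h.corner_ne hl₁ hl₂ hL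
  have hq : q ∈ F.left := by rw [hL]; simp
  have hsub : (q :: l₂).Sublist F.left := by rw [hL]; simp
  have hsubR : (r₁ ++ [w]).Sublist F.right := by rw [hR]; simp
  have hr₁ : r₁ ≠ [] := by
    rintro rfl
    have := h.head_right
    rw [hR] at this
    simp only [List.nil_append, List.head?_cons, Option.some.injEq] at this
    exact hw.2.1 this
  constructor
  · simp
  · have := h.last_left
    rwa [hL, List.getLast?_append_of_ne_nil _ (by simp)] at this
  · have := h.head_right
    rw [hR, List.head?_append_of_ne_nil _ hr₁] at this
    simp only
    rwa [List.head?_append_of_ne_nil _ hr₁]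
  · simp
  · exact hqo
  · exact hw.2.1.symm
  · exact h.sorted_left.sublist hsub
  · exact h.sorted_right.sublist hsubR
  · exact fun x hx y hy z hz => h.concave_left x (hsub.subset hx) y (hsub.subset hy) z
      (hsub.subset hz)
  · exact fun x hx y hy z hz => h.concave_right x (hsubR.subset hx) y (hsubR.subset hy) z
      (hsubR.subset hz)
  · rintro z (hz | hz) h₁ h₂
    · have hs := h.sorted_left.sublist hsub
      rw [List.pairwise_cons] at hs
      have hz' := (List.mem_cons.1 hz).resolve_left h₁
      exact h.det_tangent_neg hq hqu hw (hsub.subset hz) (hs.1 z hz')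
    · exact h.det_tangent_right_neg hq hqu hqo hw (hsubR.subset hz) h₂

end Parts

/-! ### Lists of consecutive values of a sequence -/

section Enumeration

variable {α : Type*}

/-- The list `a i, …, a (i + m - 1)`. -/
def seg (a : ℕ → α) (i m : ℕ) : List α := (List.range' i m).map a

theorem mem_seg {a : ℕ → α} {i m : ℕ} {x : α} : x ∈ seg a i m ↔ ∃ k, i ≤ k ∧ k < i + m ∧ x = a k := by
  simp only [seg, List.mem_map, List.mem_range'_1]
  constructor
  · rintro ⟨k, ⟨h₁, h₂⟩, rfl⟩; exact ⟨k, h₁, h₂, rfl⟩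
  · rintro ⟨k, h₁, h₂, rfl⟩; exact ⟨k, ⟨h₁, h₂⟩, rfl⟩

theorem seg_append (a : ℕ → α) (i m k : ℕ) : seg a i m ++ seg a (i + m) k = seg a i (m + k) := by
  simp only [seg, ← List.map_append, List.range'_append_1]

theorem seg_succ (a : ℕ → α) (i m : ℕ) : seg a i (m + 1) = a i :: seg a (i + 1) m := by
  simp [seg, List.range'_succ]

theorem seg_split (a : ℕ → α) {i k j : ℕ} (h₁ : i ≤ k) (h₂ : k ≤ j) :
    seg a i (j + 1 - i) = seg a i (k - i) ++ a k :: seg a (k + 1) (j - k) := by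
  rw [← seg_succ, show seg a k (j - k + 1) = seg a (i + (k - i)) (j - k + 1) by
    rw [Nat.add_sub_cancel' h₁], seg_append]
  congr 1; omega

theorem seg_concat (a : ℕ → α) {i k : ℕ} (h₁ : i ≤ k) :
    seg a i (k + 1 - i) = seg a i (k - i) ++ [a k] := by
  rw [seg_split a h₁ le_rfl]; simp [seg]

theorem pairwise_seg {a : ℕ → α} {i m : ℕ} {R : α → α → Prop} :
    (seg a i m).Pairwise R ↔ ∀ k k', i ≤ k → k < k' → k' < i + m → R (a k) (a k') := by
  rw [seg, List.pairwise_map, List.pairwise_iff_getElem]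
  simp only [List.length_range', List.getElem_range', one_mul]
  constructor
  · intro h k k' h₁ h₂ h₃
    have := h (k - i) (k' - i) (by omega) (by omega) (by omega)
    rwa [Nat.add_sub_cancel' h₁, Nat.add_sub_cancel' (by omega)] at this
  · intro h k k' h₁ h₂ h₃
    exact h _ _ (by omega) (by omega) (by omega)

theorem eq_of_append_cons_eq {x : α} {l₁ l₂ l₁' l₂' : List α} (hn : (l₁ ++ x :: l₂).Nodup)
    (h : l₁ ++ x :: l₂ = l₁' ++ x :: l₂') : l₁ = l₁' ∧ l₂ = l₂' := by
  induction l₁ generalizing l₁' with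
  | nil =>
    cases l₁' with
    | nil => simpa using h
    | cons b l₁' =>
      simp only [List.nil_append, List.cons_append, List.cons.injEq] at h
      obtain ⟨rfl, rfl⟩ := h
      simp at hn
  | cons a l₁ ih =>
    cases l₁' with
    | nil =>
      simp only [List.nil_append, List.cons_append, List.cons.injEq] at h
      obtain ⟨rfl, rfl⟩ := h
      simp at hn
    | cons b l₁' =>
      simp only [List.cons_append, List.cons.injEq] at h
      obtain ⟨rfl, h⟩ := h
      obtain ⟨rfl, rfl⟩ := ih (List.nodup_cons.1 hn).2 h
      exact ⟨rfl, rfl⟩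

end Enumeration

/-! ### Dictionary between funnels and index intervals -/

namespace Chains

variable {n : ℕ}

/-- The sub-funnel with apex `o` formed by the part `s` of the chains. -/
def funnel (d : Chains n) (o : Fin n) (s : Box) : Funnel n :=
  ⟨(seg d.a s.i₁ (s.i₂ + 1 - s.i₁)).reverse ++ [o], o :: seg d.c s.j₁ (s.j₂ + 1 - s.j₁)⟩

theorem funnel_swap (d : Chains n) (o : Fin n) (s : Box) :
    d.swap.funnel o s.swap = (d.funnel o s).mirror := by
  simp [funnel, Funnel.mirror, swap, Box.swap]

theorem mem_funnel_left {d : Chains n} {o : Fin n} {s : Box} {x : Fin n} :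
    x ∈ (d.funnel o s).left ↔ x = o ∨ ∃ i, s.i₁ ≤ i ∧ i ≤ s.i₂ ∧ x = d.a i := by
  simp only [funnel, List.mem_append, List.mem_reverse, mem_seg, List.mem_singleton]
  rw [or_comm]
  refine or_congr_right (exists_congr fun i => ⟨?_, ?_⟩)
  · rintro ⟨h₁, h₂, h₃⟩; exact ⟨h₁, by omega, h₃⟩
  · rintro ⟨h₁, h₂, h₃⟩; exact ⟨h₁, by omega, h₃⟩

theorem mem_funnel_right {d : Chains n} {o : Fin n} {s : Box} {x : Fin n} :
    x ∈ (d.funnel o s).right ↔ x = o ∨ ∃ j, s.j₁ ≤ j ∧ j ≤ s.j₂ ∧ x = d.c j := by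
  simp only [funnel, List.mem_cons, mem_seg]
  refine or_congr_right (exists_congr fun i => ⟨?_, ?_⟩)
  · rintro ⟨h₁, h₂, h₃⟩; exact ⟨h₁, by omega, h₃⟩
  · rintro ⟨h₁, h₂, h₃⟩; exact ⟨h₁, by omega, h₃⟩

theorem isNonCorner_funnel {d : Chains n} {o : Fin n} {s : Box} (hi : s.i₁ ≤ s.i₂)
    (hj : s.j₁ ≤ s.j₂) {x : Fin n} : (d.funnel o s).IsNonCorner x ↔ d.Inner s x := by
  simp only [Funnel.IsNonCorner, funnel, Inner]
  refine or_congr ?_ ?_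
  · rw [seg_concat _ hi]
    simp only [List.reverse_append, List.reverse_cons, List.reverse_nil, List.nil_append,
      List.cons_append, List.tail_cons, List.dropLast_concat, List.mem_reverse, mem_seg]
    refine exists_congr fun i => ⟨?_, ?_⟩
    · rintro ⟨h₁, h₂, h₃⟩; exact ⟨h₁, by omega, h₃⟩
    · rintro ⟨h₁, h₂, h₃⟩; exact ⟨h₁, by omega, h₃⟩
  · rw [seg_concat _ hj]
    simp only [List.tail_cons, List.dropLast_concat, mem_seg]
    refine exists_congr fun i => ⟨?_, ?_⟩
    · rintro ⟨h₁, h₂, h₃⟩; exact ⟨h₁, by omega, h₃⟩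
    · rintro ⟨h₁, h₂, h₃⟩; exact ⟨h₁, by omega, h₃⟩

/-- The summand 4 accounts for the two endpoints of the base and for the apex, which is counted on
both chains. -/
theorem numVertices_funnel_le {d : Chains n} {o : Fin n} {s : Box} (hi : s.i₁ ≤ s.i₂)
    (hj : s.j₁ ≤ s.j₂) : (d.funnel o s).numVertices ≤ s.size + 4 := by
  refine (List.toFinset_card_le _).trans ?_
  simp only [funnel, seg, List.length_append, List.length_reverse, List.length_map,
    List.length_range', List.length_cons, List.length_nil, Box.size]
  omega

theorem funnel_left_split (d : Chains n) (o : Fin n) {s : Box} {i : ℕ} (h₁ : s.i₁ ≤ i)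
    (h₂ : i ≤ s.i₂) : (d.funnel o s).left =
      (seg d.a (i + 1) (s.i₂ - i)).reverse ++ d.a i :: ((seg d.a s.i₁ (i - s.i₁)).reverse ++ [o]) := by
  simp [funnel, seg_split d.a h₁ h₂]

theorem funnel_right_split (d : Chains n) (o : Fin n) {s : Box} {j : ℕ} (h₁ : s.j₁ ≤ j)
    (h₂ : j ≤ s.j₂) : (d.funnel o s).right =
      (o :: seg d.c s.j₁ (j - s.j₁)) ++ d.c j :: seg d.c (j + 1) (s.j₂ - j) := by
  simp [funnel, seg_split d.c h₁ h₂]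

theorem funnel_upper (d : Chains n) {s : Box} {i J : ℕ} (hJ : J ≤ s.j₂) :
    d.funnel (d.a i) ⟨i + 1, s.i₂, J, s.j₂⟩ =
      ⟨(seg d.a (i + 1) (s.i₂ - i)).reverse ++ [d.a i], d.a i :: d.c J ::
        seg d.c (J + 1) (s.j₂ - J)⟩ := by
  simp only [funnel, Nat.add_sub_add_right, Funnel.mk.injEq, true_and]
  rw [show s.j₂ + 1 - J = s.j₂ - J + 1 by omega, seg_succ]

theorem funnel_lower (d : Chains n) (o : Fin n) {s : Box} {i J : ℕ} (hi : s.i₁ ≤ i)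
    (hJ : s.j₁ ≤ J) :
    d.funnel o ⟨s.i₁, i, s.j₁, J⟩ =
      ⟨d.a i :: ((seg d.a s.i₁ (i - s.i₁)).reverse ++ [o]),
        (o :: seg d.c s.j₁ (J - s.j₁)) ++ [d.c J]⟩ := by
  simp [funnel, seg_concat _ hi, seg_concat _ hJ]

variable {p : Fin n → ℝ → ℝ × ℝ} {t : ℝ}

theorem nodup_of_sorted {L : List (Fin n)} (h : L.Pairwise fun i j => (p i t).1 < (p j t).1) :
    L.Nodup := h.imp fun h e => by subst e; exact lt_irrefl _ h

/-- Characterization of the splits that start on the left chain. -/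
theorem leftSplit_funnel_iff {d : Chains n} {o u v : Fin n} {s : Box}
    (h : Good p t (d.funnel o s) u o v) {i J : ℕ} (h₁ : s.i₁ ≤ i) (h₂ : i < s.i₂)
    (hJ₁ : s.j₁ ≤ J) (hJ₂ : J ≤ s.j₂) (hT : IsTangent p t (d.funnel o s) o (d.a i) (d.c J))
    {w : Fin n} {Fu Fl : Funnel n} :
    LeftSplit p t (d.funnel o s) (d.a i) w Fu Fl ↔ w = d.c J ∧
      Fu = d.funnel (d.a i) ⟨i + 1, s.i₂, J, s.j₂⟩ ∧ Fl = d.funnel o ⟨s.i₁, i, s.j₁, J⟩ := by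
  have hL := d.funnel_left_split o h₁ h₂.le
  have hR := d.funnel_right_split o hJ₁ hJ₂
  have hne : (seg d.a (i + 1) (s.i₂ - i)).reverse ≠ [] := by
    rw [ne_eq, List.reverse_eq_nil_iff, seg, List.map_eq_nil_iff, List.range'_eq_nil_iff]
    omega
  obtain ⟨hqu, hqo, -, -⟩ := h.corner_ne hne (by simp) hL
  have hq : d.a i ∈ (d.funnel o s).left := by rw [hL]; simp
  rw [d.funnel_upper hJ₂, d.funnel_lower o h₁ hJ₁]
  constructor
  · rintro ⟨hvis, l₁, l₂, r₁, r₂, -, -, e₁, e₂, hnv, rfl, rfl⟩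
    have hw : w ∈ (d.funnel o s).right := by rw [e₂]; simp
    have hsr := h.sorted_right
    -- If `w` came before the point of tangency, this visible point would be among the vertices that
    -- are required to be invisible; vertices after it are not visible.
    have hwJ : w = d.c J := by
      rcases lt_trichotomy (p w t).1 (p (d.c J) t).1 with hlt | heq | hgt
      · exfalso
        have hm : d.c J ∈ r₁ ++ w :: r₂ := e₂ ▸ hT.1
        rw [e₂, List.pairwise_append, List.pairwise_cons] at hsr
        rcases List.mem_append.1 hm with hm | hm
        · exact lt_asymm hlt (hsr.2.2 _ hm w (by simp))
        · rcases List.mem_cons.1 hm with hm | hm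
          · rw [hm] at hlt; exact lt_irrefl _ hlt
          · exact hnv _ hm (h.visible_of_isTangent hq hqu hqo hT)
      · exact eq_of_pairwise_lt hsr hw hT.1 heq
      · exact (h.not_visible_of_isTangent hq hqu hqo hT hw hgt hvis).elim
    subst hwJ
    obtain ⟨rfl, rfl⟩ := eq_of_append_cons_eq (hL ▸ nodup_of_sorted h.sorted_left) (hL ▸ e₁)
    obtain ⟨rfl, rfl⟩ := eq_of_append_cons_eq (hR ▸ nodup_of_sorted h.sorted_right) (hR ▸ e₂)
    exact ⟨rfl, rfl, rfl⟩
  · rintro ⟨rfl, rfl, rfl⟩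
    refine ⟨h.visible_of_isTangent hq hqu hqo hT, _, _, _, _, hne, by simp, hL, hR, ?_, rfl, rfl⟩
    intro z hz
    have hsr := h.sorted_right
    rw [hR, List.pairwise_append] at hsr
    exact h.not_visible_of_isTangent hq hqu hqo hT (by rw [hR]; simp [hz])
      ((List.pairwise_cons.1 hsr.2.1).1 z hz)

theorem good_children_left {d : Chains n} {o u v : Fin n} {s : Box}
    (h : Good p t (d.funnel o s) u o v) {i J : ℕ} (h₁ : s.i₁ ≤ i) (h₂ : i < s.i₂)
    (hJ₁ : s.j₁ ≤ J) (hJ₂ : J ≤ s.j₂) (hT : IsTangent p t (d.funnel o s) o (d.a i) (d.c J)) :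
    Good p t (d.funnel (d.a i) ⟨i + 1, s.i₂, J, s.j₂⟩) u (d.a i) v ∧
      Good p t (d.funnel o ⟨s.i₁, i, s.j₁, J⟩) (d.a i) o (d.c J) := by
  have hL := d.funnel_left_split o h₁ h₂.le
  have hR := d.funnel_right_split o hJ₁ hJ₂
  have hne : (seg d.a (i + 1) (s.i₂ - i)).reverse ≠ [] := by
    rw [ne_eq, List.reverse_eq_nil_iff, seg, List.map_eq_nil_iff, List.range'_eq_nil_iff]
    omega
  rw [d.funnel_upper hJ₂, d.funnel_lower o h₁ hJ₁]
  exact ⟨h.upper hne (by simp) hL hR hT, h.lower hne (by simp) hL hR hT⟩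

/-- The functions `f` and `g` give the points of tangency. -/
structure TangentSpec (p : Fin n → ℝ → ℝ × ℝ) (t : ℝ) (d : Chains n) (l r : ℕ) : Prop where
  f_le : ∀ i < l, d.f i ≤ r
  f_iff : ∀ i < l, ∀ j < r,
    (j < d.f i ↔ 0 < det (p (d.a i) t) (p (d.c j) t) (p (d.c (j + 1)) t))
  g_le : ∀ j < r, d.g j ≤ l
  g_iff : ∀ j < r, ∀ i < l,
    (i < d.g j ↔ 0 < det (p (d.a (i + 1)) t) (p (d.a i) t) (p (d.c j) t))

theorem TangentSpec.swap {d : Chains n} {l r : ℕ} (h : TangentSpec p t d l r) :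
    TangentSpec (mirror p) t d.swap r l where
  f_le := h.g_le
  f_iff := fun i hi j hj => by
    rw [det_mirror]
    exact h.g_iff i hi j hj
  g_le := h.f_le
  g_iff := fun i hi j hj => by
    rw [det_mirror]
    exact h.f_iff i hi j hj

/-- The whole funnel with chains `a 0, …, a l` and `c 0, …, c r`. -/
structure Root (p : Fin n → ℝ → ℝ × ℝ) (t : ℝ) (d : Chains n) (o : Fin n) (l r : ℕ) : Prop where
  nonDegenerate : NonDegenerate p t
  good : Good p t (d.funnel o ⟨0, l, 0, r⟩) (d.a l) o (d.c r)

theorem Root.swap {d : Chains n} {o : Fin n} {l r : ℕ} (h : Root p t d o l r) :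
    Root (mirror p) t d.swap o r l where
  nonDegenerate := h.nonDegenerate.mirror
  good := by
    have := h.good.mirror
    rwa [← funnel_swap] at this

namespace Root

variable {d : Chains n} {o : Fin n} {l r : ℕ}

theorem a_mem (_h : Root p t d o l r) {i : ℕ} (hi : i ≤ l) :
    d.a i ∈ (d.funnel o ⟨0, l, 0, r⟩).left :=
  mem_funnel_left.2 (Or.inr ⟨i, Nat.zero_le _, hi, rfl⟩)

theorem c_mem (_h : Root p t d o l r) {j : ℕ} (hj : j ≤ r) :
    d.c j ∈ (d.funnel o ⟨0, l, 0, r⟩).right :=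
  mem_funnel_right.2 (Or.inr ⟨j, Nat.zero_le _, hj, rfl⟩)

variable (h : Root p t d o l r)
include h

theorem c_lt {j j' : ℕ} (hj : j < j') (hj' : j' ≤ r) : (p (d.c j) t).1 < (p (d.c j') t).1 := by
  have := h.good.sorted_right
  simp only [funnel, List.pairwise_cons, pairwise_seg] at this
  exact this.2 j j' (Nat.zero_le _) hj (by omega)

theorem o_lt_c {j : ℕ} (hj : j ≤ r) : (p o t).1 < (p (d.c j) t).1 := by
  have := h.good.sorted_right
  simp only [funnel, List.pairwise_cons, mem_seg] at this
  exact this.1 _ ⟨j, Nat.zero_le _, by omega, rfl⟩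

theorem a_lt {i i' : ℕ} (hi : i < i') (hi' : i' ≤ l) : (p (d.a i') t).1 < (p (d.a i) t).1 :=
  neg_lt_neg_iff.1 (h.swap.c_lt hi hi')

theorem a_lt_o {i : ℕ} (hi : i ≤ l) : (p (d.a i) t).1 < (p o t).1 :=
  neg_lt_neg_iff.1 (h.swap.o_lt_c hi)

theorem a_lt_c {i j : ℕ} (hi : i ≤ l) (hj : j ≤ r) : (p (d.a i) t).1 < (p (d.c j) t).1 :=
  (h.a_lt_o hi).trans (h.o_lt_c hj)

theorem inj : d.Inj l r where
  a_inj := fun i hi i' hi' e => by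
    rcases lt_trichotomy i i' with hlt | heq | hlt
    · exact absurd (h.a_lt hlt hi') (by rw [e]; exact lt_irrefl _)
    · exact heq
    · exact absurd (h.a_lt hlt hi) (by rw [e]; exact lt_irrefl _)
  c_inj := fun i hi i' hi' e => by
    rcases lt_trichotomy i i' with hlt | heq | hlt
    · exact absurd (h.c_lt hlt hi') (by rw [e]; exact lt_irrefl _)
    · exact heq
    · exact absurd (h.c_lt hlt hi) (by rw [e]; exact lt_irrefl _)
  a_ne_c := fun i hi j hj e => absurd (h.a_lt_c hi hj) (by rw [e]; exact lt_irrefl _)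

theorem det_ne {i j : ℕ} (hi : i ≤ l) (hj : j < r) :
    det (p (d.a i) t) (p (d.c j) t) (p (d.c (j + 1)) t) ≠ 0 := by
  refine h.nonDegenerate.det_ne (h.inj.a_ne_c i hi j hj.le) (fun e => ?_)
    (h.inj.a_ne_c i hi _ hj)
  have := h.inj.c_inj j hj.le _ hj e
  omega

theorem c_concave {i j k : ℕ} (hij : i < j) (hjk : j < k) (hk : k ≤ r) :
    det (p (d.c i) t) (p (d.c j) t) (p (d.c k) t) < 0 :=
  h.good.concave_right _ (h.c_mem (by omega)) _ (h.c_mem (by omega)) _ (h.c_mem hk)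
    (h.c_lt hij (by omega)) (h.c_lt hjk hk)

theorem a_concave {i j k : ℕ} (hij : i < j) (hjk : j < k) (hk : k ≤ l) :
    det (p (d.a k) t) (p (d.a j) t) (p (d.a i) t) < 0 :=
  h.good.concave_left _ (h.a_mem hk) _ (h.a_mem (by omega)) _ (h.a_mem (by omega))
    (h.a_lt hjk hk) (h.a_lt hij (by omega))

/-- Seen from `a i`, the slopes along the concave right chain are unimodal: once an edge descends,
so does the next one. -/
theorem det_pos_of_succ {i j : ℕ} (hi : i ≤ l) (hj : j + 1 < r)
    (hpos : 0 < det (p (d.a i) t) (p (d.c (j + 1)) t) (p (d.c (j + 2)) t)) :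
    0 < det (p (d.a i) t) (p (d.c j) t) (p (d.c (j + 1)) t) := by
  by_contra hn
  have hneg : det (p (d.a i) t) (p (d.c j) t) (p (d.c (j + 1)) t) < 0 :=
    lt_of_le_of_ne (not_lt.1 hn) (h.det_ne hi (by omega))
  have := (concave_four (h.a_lt_c hi (by omega)) (h.c_lt (Nat.lt_succ_self j) (by omega))
    (h.c_lt (Nat.lt_succ_self (j + 1)) (by omega)) hneg
    (h.c_concave (Nat.lt_succ_self j) (Nat.lt_succ_self (j + 1)) (by omega))).2
  exact lt_asymm this hpos

/-- `f i` is the index of the first edge of the right chain that descends as seen from `a i`, or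
`r`; by unimodality all later edges descend as well. -/
theorem exists_f : ∃ f : ℕ → ℕ, ∀ i < l, f i ≤ r ∧ ∀ j < r,
    (j < f i ↔ 0 < det (p (d.a i) t) (p (d.c j) t) (p (d.c (j + 1)) t)) := by
  suffices H : ∀ i, ∃ m, i < l → m ≤ r ∧ ∀ j < r,
      (j < m ↔ 0 < det (p (d.a i) t) (p (d.c j) t) (p (d.c (j + 1)) t)) by
    choose f hf using H
    exact ⟨f, hf⟩
  classical
  intro i
  have hex : ∃ j, r ≤ j ∨ ¬ 0 < det (p (d.a i) t) (p (d.c j) t) (p (d.c (j + 1)) t) :=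
    ⟨r, Or.inl le_rfl⟩
  refine ⟨Nat.find hex, fun hi => ⟨Nat.find_min' hex (Or.inl le_rfl), fun j hj => ⟨fun hlt => ?_,
    fun hpos => ?_⟩⟩⟩
  · have := Nat.find_min hex hlt
    tauto
  · by_contra hn
    have hspec := (Nat.find_spec hex).resolve_left (by omega)
    have hle : Nat.find hex ≤ j := not_lt.1 hn
    have : ∀ k, Nat.find hex ≤ k → k < r →
        ¬ 0 < det (p (d.a i) t) (p (d.c k) t) (p (d.c (k + 1)) t) := by
      intro k hk
      induction k, hk using Nat.le_induction with
      | base => exact fun _ => hspec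
      | succ k hk ih => exact fun hkr hp => ih (by omega) (h.det_pos_of_succ hi.le hkr hp)
    exact this j hle hj hpos

omit h in
-- `Root` depends only on the two chains, which is why it can be assumed for all `f` and `g` before
-- these are constructed. The function `g` comes from the mirror image.
theorem exists_tangentSpec {a c : ℕ → Fin n} (h : ∀ f g, Root p t ⟨a, c, f, g⟩ o l r) :
    ∃ f g, TangentSpec p t ⟨a, c, f, g⟩ l r := by
  obtain ⟨f, hf⟩ := (h id id).exists_f
  obtain ⟨g, hg⟩ := (h id id).swap.exists_f
  refine ⟨f, g, fun i hi => (hf i hi).1, fun i hi => (hf i hi).2, fun j hj => (hg j hj).1,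
    fun j hj i hi => ?_⟩
  rw [(hg j hj).2 i hi, det_mirror]
  rfl

/-- Otherwise `a l`, `c j`, `c (j + 1)` would be a right turn, and concavity up to `c r` would put
`c j` above the base. -/
theorem u_above {j : ℕ} (hj : j < r) :
    0 < det (p (d.a l) t) (p (d.c j) t) (p (d.c (j + 1)) t) := by
  have hb : ∀ j < r, det (p (d.a l) t) (p (d.c r) t) (p (d.c j) t) < 0 := fun j hj =>
    h.good.base _ (Or.inr (h.c_mem hj.le)) (h.inj.a_ne_c l le_rfl j hj.le).symm fun e => by
      have := h.inj.c_inj j hj.le r le_rfl e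
      omega
  by_contra hn
  have hneg : det (p (d.a l) t) (p (d.c j) t) (p (d.c (j + 1)) t) < 0 :=
    lt_of_le_of_ne (not_lt.1 hn) (h.det_ne le_rfl hj)
  have hjr := hb j hj
  rw [det_swap_right] at hjr
  by_cases e : j + 1 = r
  · rw [e] at hneg; linarith
  · have := (concave_four (h.a_lt_c le_rfl (by omega)) (h.c_lt (Nat.lt_succ_self j) (by omega))
      (h.c_lt (by omega : j + 1 < r) le_rfl) hneg
      (h.c_concave (Nat.lt_succ_self j) (by omega) le_rfl)).1
    linarith

/-- On the concave left chain, `a i'` is above the segment from `a l` to `a i`, and both of these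
are above the line through `c j` and `c (j + 1)`. This yields the monotonicity of `f`. -/
theorem det_pos_mono {i i' j : ℕ} (hi : i ≤ i') (hi' : i' < l) (hj : j < r)
    (hpos : 0 < det (p (d.a i) t) (p (d.c j) t) (p (d.c (j + 1)) t)) :
    0 < det (p (d.a i') t) (p (d.c j) t) (p (d.c (j + 1)) t) := by
  rcases hi.eq_or_lt with rfl | hlt
  · exact hpos
  have hu := h.u_above hj
  rw [det_rotate] at hpos hu ⊢
  exact det_pos_of_concave (h.c_lt (Nat.lt_succ_self j) hj) (h.a_lt hi' le_rfl) (h.a_lt hlt hi'.le)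
    (h.a_concave hlt hi' le_rfl) hu hpos

/-- If both failed, then `a l`, `a i`, `c j`, `c r` would be a concave path, and `a i` would lie
above the base. -/
theorem det_cross {i j : ℕ} (hi : i < l) (hj : j < r) :
    0 < det (p (d.a i) t) (p (d.c j) t) (p (d.c (j + 1)) t) ∨
      0 < det (p (d.a (i + 1)) t) (p (d.a i) t) (p (d.c j) t) := by
  by_contra! hn
  obtain ⟨h₁, h₂⟩ := hn
  have h₁ := lt_of_le_of_ne h₁ (h.det_ne hi.le hj)
  have h₂ : det (p (d.a (i + 1)) t) (p (d.a i) t) (p (d.c j) t) < 0 := by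
    refine lt_of_le_of_ne h₂ (h.nonDegenerate.det_ne (fun e => ?_) (h.inj.a_ne_c i hi.le j hj.le)
      (h.inj.a_ne_c _ hi j hj.le))
    have := h.inj.a_inj _ hi _ hi.le e
    omega
  have h₃ : det (p (d.a l) t) (p (d.a i) t) (p (d.c j) t) < 0 := by
    by_cases e : i + 1 = l
    · rwa [e] at h₂
    · exact (concave_four (h.a_lt (by omega : i + 1 < l) le_rfl) (h.a_lt (Nat.lt_succ_self i) hi)
        (h.a_lt_c hi.le hj.le) (h.a_concave (Nat.lt_succ_self i) (by omega) le_rfl) h₂).2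
  have h₄ : det (p (d.a i) t) (p (d.c j) t) (p (d.c r) t) < 0 := by
    by_cases e : j + 1 = r
    · rwa [e] at h₁
    · exact (concave_four (h.a_lt_c hi.le hj.le) (h.c_lt (Nat.lt_succ_self j) hj)
        (h.c_lt (by omega : j + 1 < r) le_rfl) h₁
        (h.c_concave (Nat.lt_succ_self j) (by omega) le_rfl)).1
  have h₅ := (concave_four (h.a_lt hi le_rfl) (h.a_lt_c hi.le hj.le) (h.c_lt hj le_rfl) h₃ h₄).1
  have h₆ : det (p (d.a l) t) (p (d.c r) t) (p (d.a i) t) < 0 :=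
    h.good.base _ (Or.inl (h.a_mem hi.le)) (fun e => by
      have := h.inj.a_inj _ hi.le _ le_rfl e
      omega) (h.inj.a_ne_c i hi.le r le_rfl)
  rw [det_swap_right] at h₆
  linarith

theorem wf (hs : TangentSpec p t d l r) : d.Wf l r where
  toInj := h.inj
  f_le := hs.f_le
  g_le := hs.g_le
  f_mono := fun i i' hi hi' => by
    by_contra! hlt
    have h1 := hs.f_le i (by omega)
    have := (hs.f_iff i (by omega) (d.f i') (by omega)).1 hlt
    have := (hs.f_iff i' hi' (d.f i') (by omega)).2 (h.det_pos_mono hi hi' (by omega) this)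
    omega
  g_mono := fun i i' hi hi' => by
    have hs' := hs.swap
    have h' := h.swap
    change d.swap.f i ≤ d.swap.f i'
    by_contra! hlt
    have h1 := hs'.f_le i (by omega)
    have := (hs'.f_iff i (by omega) (d.swap.f i') (by omega)).1 hlt
    have := (hs'.f_iff i' hi' (d.swap.f i') (by omega)).2 (h'.det_pos_mono hi hi' (by omega) this)
    omega
  cross := fun i hi j hj => by
    rw [hs.f_iff i hi j hj, hs.g_iff j hj i hi]
    exact h.det_cross hi hj

/-- By unimodality, the slopes seen from `a i` rise up to `f i` and fall from there on. On a
subinterval the maximum is therefore attained at the clamped index. -/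
theorem det_neg_of_clamp (hs : TangentSpec p t d l r) {i j₁ j₂ j : ℕ} (hi : i < l) (hj₂ : j₂ ≤ r)
    (h₁ : j₁ ≤ j) (h₂ : j ≤ j₂) (hne : j ≠ clamp j₁ j₂ (d.f i)) :
    det (p (d.a i) t) (p (d.c (clamp j₁ j₂ (d.f i))) t) (p (d.c j) t) < 0 := by
  obtain ⟨J, hJ⟩ : ∃ J, J = clamp j₁ j₂ (d.f i) := ⟨_, rfl⟩
  rw [← hJ] at hne ⊢
  simp only [clamp] at hJ
  rcases Nat.lt_or_gt_of_ne hne with hlt | hgt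
  · have : ∀ m, j + 1 ≤ m → m ≤ J → det (p (d.a i) t) (p (d.c m) t) (p (d.c j) t) < 0 := by
      intro m hm
      induction m, hm using Nat.le_induction with
      | base =>
        intro _
        have := (hs.f_iff i hi j (by omega)).1 (by omega)
        rw [det_swap_right] at this
        linarith
      | succ m hm ih =>
        intro hmJ
        have := (hs.f_iff i hi m (by omega)).1 (by omega)
        rw [det_swap_right] at this
        exact det_neg_trans_left (h.a_lt_c hi.le (by omega)) (h.a_lt_c hi.le (by omega))
          (h.a_lt_c hi.le (by omega)) (by linarith) (ih (by omega))
    exact this J hlt le_rfl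
  · have hstep : ∀ m, J ≤ m → m < j →
        det (p (d.a i) t) (p (d.c m) t) (p (d.c (m + 1)) t) < 0 := by
      intro m hm hmj
      refine lt_of_le_of_ne (not_lt.1 fun hp => ?_) (h.det_ne hi.le (by omega))
      have := (hs.f_iff i hi m (by omega)).2 hp
      omega
    have : ∀ m, J + 1 ≤ m → m ≤ j → det (p (d.a i) t) (p (d.c J) t) (p (d.c m) t) < 0 := by
      intro m hm
      induction m, hm using Nat.le_induction with
      | base => intro hj'; exact hstep J le_rfl hj'
      | succ m hm ih =>
        intro hmJ
        exact det_neg_trans_left (h.a_lt_c hi.le (by omega)) (h.a_lt_c hi.le (by omega))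
          (h.a_lt_c hi.le (by omega)) (ih (by omega)) (hstep m (by omega) hmJ)
    exact this j hgt le_rfl

/-- Tangency in a sub-funnel is read off from the tangents of the whole funnel and does not involve
the apex `o'`, except that it must not be among the `c j`. -/
theorem isTangent (hs : TangentSpec p t d l r) {s : Box} (hw : Within s l r) {o' : Fin n} {i : ℕ}
    (h₂ : i < s.i₂) (ho : ∀ j, s.j₁ ≤ j → j ≤ s.j₂ → d.c j ≠ o') :
    IsTangent p t (d.funnel o' s) o' (d.a i) (d.c (clamp s.j₁ s.j₂ (d.f i))) := by
  obtain ⟨w1, w2, w3, w4⟩ := hw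
  have hc1 : s.j₁ ≤ clamp s.j₁ s.j₂ (d.f i) := by simp only [clamp]; omega
  have hc2 : clamp s.j₁ s.j₂ (d.f i) ≤ s.j₂ := by simp only [clamp]; omega
  refine ⟨mem_funnel_right.2 (Or.inr ⟨_, hc1, hc2, rfl⟩), ho _ hc1 hc2, fun z hz hzo hzw => ?_⟩
  obtain ⟨j, hj₁, hj₂, rfl⟩ := (mem_funnel_right.1 hz).resolve_left hzo
  exact h.det_neg_of_clamp hs (by omega) w4 hj₁ hj₂ fun e => hzw (by rw [← e])

end Root

/-- The funnel of a part is a proper funnel. -/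
def GoodPart (p : Fin n → ℝ → ℝ × ℝ) (t : ℝ) (d : Chains n) (l r : ℕ) (o : Fin n) (s : Box) :
    Prop :=
  Within s l r ∧ Good p t (d.funnel o s) (d.a s.i₂) o (d.c s.j₂)

theorem GoodPart.swap {d : Chains n} {l r : ℕ} {o : Fin n} {s : Box}
    (h : GoodPart p t d l r o s) : GoodPart (mirror p) t d.swap r l o s.swap := by
  obtain ⟨⟨w1, w2, w3, w4⟩, hg⟩ := h
  refine ⟨⟨w2, w1, w4, w3⟩, ?_⟩
  have := hg.mirror
  rwa [← funnel_swap] at this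

theorem GoodPart.c_ne {d : Chains n} {l r : ℕ} {o : Fin n} {s : Box}
    (h : GoodPart p t d l r o s) {j : ℕ} (h₁ : s.j₁ ≤ j) (h₂ : j ≤ s.j₂) : d.c j ≠ o := by
  intro e
  have := h.2.sorted_right
  simp only [funnel, List.pairwise_cons, mem_seg] at this
  have := this.1 (d.c j) ⟨j, h₁, by omega, rfl⟩
  rw [e] at this
  exact lt_irrefl _ this

theorem GoodPart.isTangent {d : Chains n} {l r : ℕ} {o o' : Fin n} {s : Box}
    (hr : Root p t d o l r) (hs : TangentSpec p t d l r) (h : GoodPart p t d l r o' s) {i : ℕ}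
    (h₂ : i < s.i₂) :
    IsTangent p t (d.funnel o' s) o' (d.a i) (d.c (clamp s.j₁ s.j₂ (d.f i))) :=
  hr.isTangent hs h.1 h₂ fun _ hj₁ hj₂ => h.c_ne hj₁ hj₂

theorem GoodPart.step {d : Chains n} {l r : ℕ} {o o' : Fin n} {s u v : Box} {q w : Fin n}
    {π : Equiv.Perm (Fin n)} (hr : Root p t d o l r) (hs : TangentSpec p t d l r)
    (h : GoodPart p t d l r o' s) (hst : d.Step π s q w u v) :
    GoodPart p t d l r q u ∧ GoodPart p t d l r o' v := by
  have hw := hst.within h.1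
  cases hst with
  | @left i h₁ h₂ hm =>
    obtain ⟨g₁, g₂⟩ := good_children_left h.2 h₁ h₂ (by simp only [clamp]; omega)
      (by simp only [clamp]; have := h.1.hj; omega) (h.isTangent hr hs h₂)
    exact ⟨⟨hw.1, g₁⟩, ⟨hw.2, g₂⟩⟩
  | @right j h₁ h₂ hm =>
    have h' := h.swap
    obtain ⟨g₁, g₂⟩ := good_children_left h'.2 (i := j) h₁ h₂
      (J := clamp s.i₁ s.i₂ (d.g j))
      (by simp only [clamp, Box.swap]; omega)
      (by simp only [clamp, Box.swap]; have := h.1.hi; omega)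
      (h'.isTangent hr.swap hs.swap h₂)
    have g₁' := g₁.mirror
    have g₂' := g₂.mirror
    rw [← funnel_swap, mirror_mirror] at g₁' g₂'
    exact ⟨⟨hw.1, g₁'⟩, ⟨hw.2, g₂'⟩⟩

/-- Splitting a funnel and splitting the corresponding part of the chains are the same. -/
theorem GoodPart.split_iff {d : Chains n} {l r : ℕ} {o o' : Fin n} {s : Box} {q w : Fin n}
    {π : Equiv.Perm (Fin n)} (hr : Root p t d o l r) (hs : TangentSpec p t d l r)
    (h : GoodPart p t d l r o' s) {Fu Fl : Funnel n} :
    Split p π t (d.funnel o' s) q w Fu Fl ↔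
      ∃ u v, d.Step π s q w u v ∧ Fu = d.funnel q u ∧ Fl = d.funnel o' v := by
  obtain ⟨⟨w1, w2, w3, w4⟩, hg⟩ := h
  have h : GoodPart p t d l r o' s := ⟨⟨w1, w2, w3, w4⟩, hg⟩
  have hJ : ∀ i, s.j₁ ≤ clamp s.j₁ s.j₂ (d.f i) ∧ clamp s.j₁ s.j₂ (d.f i) ≤ s.j₂ := fun i => by
    simp only [clamp]; omega
  have hI : ∀ j, s.i₁ ≤ clamp s.i₁ s.i₂ (d.g j) ∧ clamp s.i₁ s.i₂ (d.g j) ≤ s.i₂ := fun i => by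
    simp only [clamp]; omega
  have key : ∀ i, s.i₁ ≤ i → i < s.i₂ → (LeftSplit p t (d.funnel o' s) (d.a i) w Fu Fl ↔ _) :=
    fun i h₁ h₂ => leftSplit_funnel_iff hg h₁ h₂ (hJ i).1 (hJ i).2 (h.isTangent hr hs h₂)
  have key' : ∀ j, s.j₁ ≤ j → j < s.j₂ →
      (LeftSplit (mirror p) t (d.swap.funnel o' s.swap) (d.c j) w Fu.mirror Fl.mirror ↔ _) :=
    fun j h₁ h₂ => leftSplit_funnel_iff h.swap.2 (i := j) h₁ h₂ (J := clamp s.i₁ s.i₂ (d.g j))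
      (hI j).1 (hI j).2 (h.swap.isTangent hr.swap hs.swap h₂)
  rw [KineticTriangulation.split_iff]
  simp only [isNonCorner_funnel w1 w2, ← funnel_swap]
  have mir : ∀ (F : Funnel n) (o : Fin n) (s : Box),
      F.mirror = d.swap.funnel o s.swap ↔ F = d.funnel o s := by
    intro F o s
    rw [funnel_swap]
    constructor
    · intro e
      rw [← F.mirror_mirror, e, Funnel.mirror_mirror]
    · rintro rfl; rfl
  have ha_left : ∀ i, s.i₁ ≤ i → i ≤ s.i₂ → (p (d.a i) t).1 < (p o' t).1 := by
    intro i h₁ h₂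
    refine (hg.left_of_o (mem_funnel_left.2 (Or.inr ⟨i, h₁, h₂, rfl⟩))).resolve_left ?_
    exact h.swap.c_ne (j := i) h₁ h₂
  have hc_right : ∀ j, s.j₁ ≤ j → j ≤ s.j₂ → (p o' t).1 < (p (d.c j) t).1 := by
    intro j h₁ h₂
    exact (hg.right_of_o (mem_funnel_right.2 (Or.inr ⟨j, h₁, h₂, rfl⟩))).resolve_left
      (h.c_ne h₁ h₂)
  constructor
  · rintro ⟨hq, hm, hsp⟩
    rcases hq with ⟨i, h₁, h₂, rfl⟩ | ⟨j, h₁, h₂, rfl⟩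
    · rcases hsp with hsp | ⟨-, l₁, l₂, r₁, r₂, -, -, hL, -⟩
      · obtain ⟨rfl, rfl, rfl⟩ := (key i h₁ h₂).1 hsp
        exact ⟨_, _, Step.left h₁ h₂ hm, rfl, rfl⟩
      · exfalso
        have : d.a i ∈ (d.swap.funnel o' s.swap).left := by rw [hL]; simp
        rw [funnel_swap] at this
        have := hg.o_le_right (List.mem_reverse.1 this)
        exact absurd (ha_left i h₁ h₂.le) (not_lt.2 this)
    · rcases hsp with ⟨-, l₁, l₂, r₁, r₂, -, -, hL, -⟩ | hsp
      · exfalso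
        have : d.c j ∈ (d.funnel o' s).left := by rw [hL]; simp
        exact absurd (hc_right j h₁ h₂.le) (not_lt.2 (hg.left_le_o this))
      · obtain ⟨rfl, e₁, e₂⟩ := (key' j h₁ h₂).1 hsp
        exact ⟨_, _, Step.right h₁ h₂ hm, (mir Fu _ ⟨_, _, _, _⟩).1 e₁,
          (mir Fl _ ⟨_, _, _, _⟩).1 e₂⟩
  · rintro ⟨u, v, hst, hu, hv⟩
    refine ⟨hst.inner.1, hst.inner.2, ?_⟩
    cases hst with
    | @left i h₁ h₂ hm => exact Or.inl ((key i h₁ h₂).2 ⟨rfl, hu, hv⟩)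
    | @right j h₁ h₂ hm =>
      exact Or.inr ((key' j h₁ h₂).2 ⟨rfl, (mir Fu _ ⟨_, _, _, _⟩).2 hu,
        (mir Fl _ ⟨_, _, _, _⟩).2 hv⟩)

theorem Root.goodPart {d : Chains n} {l r : ℕ} {o : Fin n} (h : Root p t d o l r) :
    GoodPart p t d l r o ⟨0, l, 0, r⟩ := ⟨within_root l r, h.good⟩

theorem Root.subFunnel {d : Chains n} {l r : ℕ} {o : Fin n} {π : Equiv.Perm (Fin n)}
    (hr : Root p t d o l r) (hs : TangentSpec p t d l r) {F : Funnel n}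
    (h : SubFunnel p π t (d.funnel o ⟨0, l, 0, r⟩) F) :
    ∃ o' s, F = d.funnel o' s ∧ GoodPart p t d l r o' s ∧ d.Reach π ⟨0, l, 0, r⟩ s := by
  induction h with
  | refl => exact ⟨o, _, rfl, hr.goodPart, Relation.ReflTransGen.refl⟩
  | upper _ hsp ih =>
    obtain ⟨o', s, rfl, hg, hreach⟩ := ih
    obtain ⟨u, v, hst, rfl, rfl⟩ := (hg.split_iff hr hs).1 hsp
    exact ⟨_, u, rfl, (hg.step hr hs hst).1, hreach.tail ⟨_, _, _, _, hst, Or.inl rfl⟩⟩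
  | lower _ hsp ih =>
    obtain ⟨o', s, rfl, hg, hreach⟩ := ih
    obtain ⟨u, v, hst, rfl, rfl⟩ := (hg.split_iff hr hs).1 hsp
    exact ⟨_, v, rfl, (hg.step hr hs hst).2, hreach.tail ⟨_, _, _, _, hst, Or.inr rfl⟩⟩

theorem Root.subFunnel_of_reach {d : Chains n} {l r : ℕ} {o : Fin n} {π : Equiv.Perm (Fin n)}
    (hr : Root p t d o l r) (hs : TangentSpec p t d l r) {s : Box}
    (h : d.Reach π ⟨0, l, 0, r⟩ s) :
    ∃ o', SubFunnel p π t (d.funnel o ⟨0, l, 0, r⟩) (d.funnel o' s) ∧ GoodPart p t d l r o' s := by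
  induction h with
  | refl => exact ⟨o, SubFunnel.refl, hr.goodPart⟩
  | tail _ hc ih =>
    obtain ⟨o', hsub, hg⟩ := ih
    obtain ⟨q, w, u, v, hst, rfl | rfl⟩ := hc
    · exact ⟨q, SubFunnel.upper hsub ((hg.split_iff hr hs).2 ⟨_, v, hst, rfl, rfl⟩),
        (hg.step hr hs hst).1⟩
    · exact ⟨o', SubFunnel.lower hsub ((hg.split_iff hr hs).2 ⟨u, _, hst, rfl, rfl⟩),
        (hg.step hr hs hst).2⟩

/-- The chords of the recursive splitting of a funnel. -/
theorem Root.chords_eq {d : Chains n} {l r : ℕ} {o : Fin n} {π : Equiv.Perm (Fin n)}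
    (hr : Root p t d o l r) (hs : TangentSpec p t d l r) :
    {e | ∃ F q w Fu Fl, SubFunnel p π t (d.funnel o ⟨0, l, 0, r⟩) F ∧ Split p π t F q w Fu Fl ∧
      e = s(q, w)} = d.edges π ⟨0, l, 0, r⟩ := by
  ext e
  constructor
  · rintro ⟨F, q, w, Fu, Fl, hsub, hsp, rfl⟩
    obtain ⟨o', s, rfl, hg, hreach⟩ := hr.subFunnel hs hsub
    obtain ⟨u, v, hst, rfl, rfl⟩ := (hg.split_iff hr hs).1 hsp
    exact ⟨s, q, w, u, v, hreach, hst, rfl⟩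
  · rintro ⟨s, q, w, u, v, hreach, hst, rfl⟩
    obtain ⟨o', hsub, hg⟩ := hr.subFunnel_of_reach hs hreach
    exact ⟨_, q, w, _, _, hsub, (hg.split_iff hr hs).2 ⟨u, v, hst, rfl, rfl⟩, rfl⟩

end Chains

/-! ### Enumeration of finite sets by a key -/

section Sorting

variable {α : Type*}

theorem eq_of_sorted_of_mem_iff {x : α → ℝ} {L L' : List α}
    (hL : L.Pairwise fun i j => x i < x j) (hL' : L'.Pairwise fun i j => x i < x j)
    (h : ∀ z, z ∈ L ↔ z ∈ L') : L = L' := by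
  have nd : ∀ {L : List α}, (L.Pairwise fun i j => x i < x j) → L.Nodup := fun h =>
    h.imp fun h e => by subst e; exact lt_irrefl _ h
  refine List.Perm.eq_of_pairwise (le := fun i j => x i < x j) ?_ hL hL'
    ((List.perm_ext_iff_of_nodup (nd hL) (nd hL')).2 h)
  intro a b _ _ h₁ h₂
  exact (lt_asymm h₁ h₂).elim

/-- A finite set is enumerated in the order of an injective key. -/
theorem exists_enumeration [DecidableEq α] {x : α → ℝ} (hx : Function.Injective x) :
    ∀ (m : ℕ) (S : Finset α), S.card = m + 1 → ∃ a : ℕ → α,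
      (∀ i i', i < i' → i' ≤ m → x (a i) < x (a i')) ∧ ∀ z, z ∈ S ↔ ∃ i ≤ m, z = a i := by
  intro m
  induction m with
  | zero =>
    intro S hS
    obtain ⟨y, rfl⟩ := Finset.card_eq_one.1 hS
    refine ⟨fun _ => y, fun i i' h h' => by omega, fun z => ?_⟩
    rw [Finset.mem_singleton]
    exact ⟨fun h => ⟨0, le_rfl, h⟩, fun ⟨_, _, h⟩ => h⟩
  | succ m ih =>
    intro S hS
    obtain ⟨y, hy, hmax⟩ := S.exists_max_image x (Finset.card_pos.1 (by omega))
    obtain ⟨a, ha, hS'⟩ := ih (S.erase y) (by rw [Finset.card_erase_of_mem hy, hS]; omega)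
    have hlt : ∀ i ≤ m, x (a i) < x y := fun i hi => by
      have := (hS' (a i)).2 ⟨i, hi, rfl⟩
      rw [Finset.mem_erase] at this
      exact lt_of_le_of_ne (hmax _ this.2) fun e => this.1 (hx e)
    refine ⟨fun i => if i ≤ m then a i else y, fun i i' h h' => ?_, fun z => ?_⟩
    · by_cases hi' : i' ≤ m
      · simp only [hi', (h.le.trans hi'), if_true]
        exact ha i i' h hi'
      · simp only [hi', (by omega : i ≤ m), if_true, if_false]
        exact hlt i (by omega)
    · constructor
      · intro hz
        by_cases hzy : z = y
        · exact ⟨m + 1, le_rfl, by simp [hzy]⟩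
        · obtain ⟨i, hi, rfl⟩ := (hS' z).1 (Finset.mem_erase.2 ⟨hzy, hz⟩)
          exact ⟨i, by omega, by simp [hi]⟩
      · rintro ⟨i, hi, rfl⟩
        by_cases hi' : i ≤ m
        · simp only [hi', if_true]
          exact Finset.mem_of_mem_erase ((hS' _).2 ⟨i, hi', rfl⟩)
        · simp only [hi', if_false]
          exact hy

theorem getLast?_cons_seg (c : ℕ → α) (b : α) (r : ℕ) :
    (b :: seg c 0 (r + 1)).getLast? = some (c r) := by
  have e := seg_concat c (Nat.zero_le r)
  rw [Nat.sub_zero, Nat.sub_zero] at e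
  rw [e, ← List.cons_append, List.getLast?_concat]

theorem head?_reverse_seg (a : ℕ → α) (b : α) (l : ℕ) :
    ((seg a 0 (l + 1)).reverse ++ [b]).head? = some (a l) := by
  rw [← getLast?_cons_seg a b l, ← List.head?_reverse, List.reverse_cons]

end Sorting

/-! ### The funnel and its triangulation in terms of the two enumerated chains -/

section Configuration

variable {n : ℕ} (p : Fin n → ℝ → ℝ × ℝ) (t : ℝ) (SL SR : Set (Fin n)) (b : Fin n)

/-- The segment `uv` is the upper common tangent of the two parts of the range. -/
def BridgeOf (u v : Fin n) : Prop :=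
  u ∈ SL ∧ v ∈ SR ∧ (p u t).1 < (p b t).1 ∧ (p b t).1 < (p v t).1 ∧
    ∀ i, i ∈ SL ∨ i ∈ SR → det (p u t) (p v t) (p i t) ≤ 0

/-- `F` is the funnel determined by the two parts of the range. -/
def IsFunnelOf (F : Funnel n) : Prop :=
  ∃ u v, BridgeOf p t SL SR b u v ∧
    F.left.Pairwise (fun i j => (p i t).1 < (p j t).1) ∧
    (∀ i, i ∈ F.left ↔ OnUpperHull p t SL i ∧ (p u t).1 ≤ (p i t).1) ∧
    F.right.Pairwise (fun i j => (p i t).1 < (p j t).1) ∧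
    (∀ i, i ∈ F.right ↔ OnUpperHull p t SR i ∧ (p i t).1 ≤ (p v t).1)

/-- The triangulation of the funnel determined by the two parts of the range. -/
def triOf (π : Equiv.Perm (Fin n)) : Set (Sym2 (Fin n)) :=
  {e | ∃ F₀, IsFunnelOf p t SL SR b F₀ ∧
    ((∃ i j, F₀.IsEdge i j ∧ e = s(i, j)) ∨
      ∃ F q w Fu Fl, SubFunnel p π t F₀ F ∧ Split p π t F q w Fu Fl ∧ e = s(q, w))}

/-- The parts of the range are on the two sides of the apex. -/
structure Sides : Prop where
  apex_left : b ∈ SL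
  apex_right : b ∈ SR
  left : ∀ i ∈ SL, i = b ∨ (p i t).1 < (p b t).1
  right : ∀ i ∈ SR, i = b ∨ (p b t).1 < (p i t).1
  fst_inj : Function.Injective fun i => (p i t).1

/-- The chains of the funnel are enumerated by `a` and `c`, from the apex outwards. -/
structure Cfg (a c : ℕ → Fin n) (l r : ℕ) : Prop where
  bridge : BridgeOf p t SL SR b (a l) (c r)
  a_lt : ∀ i i', i < i' → i' ≤ l → (p (a i') t).1 < (p (a i) t).1
  a_lt_apex : ∀ i ≤ l, (p (a i) t).1 < (p b t).1
  c_lt : ∀ j j', j < j' → j' ≤ r → (p (c j) t).1 < (p (c j') t).1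
  apex_lt_c : ∀ j ≤ r, (p b t).1 < (p (c j) t).1
  left_iff : ∀ z, (OnUpperHull p t SL z ∧ (p (a l) t).1 ≤ (p z t).1) ↔ z = b ∨ ∃ i ≤ l, z = a i
  right_iff : ∀ z, (OnUpperHull p t SR z ∧ (p z t).1 ≤ (p (c r) t).1) ↔ z = b ∨ ∃ j ≤ r, z = c j

variable {p t SL SR b}

theorem onUpperHull_mirror {S : Set (Fin n)} {i : Fin n} :
    OnUpperHull (mirror p) t S i ↔ OnUpperHull p t S i := by
  simp only [OnUpperHull, mirror_fst, neg_lt_neg_iff, neg_le_neg_iff, det_mirror]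
  refine and_congr_right fun _ => ⟨fun h j hj k hk h₁ h₂ h₃ => ?_, fun h j hj k hk h₁ h₂ h₃ => ?_⟩
  · have := h k hk j hj h₁ h₃ h₂
    rwa [det_rotate] at this
  · have := h k hk j hj h₁ h₃ h₂
    rwa [det_rotate, det_rotate] at this

theorem bridgeOf_mirror {u v : Fin n} :
    BridgeOf (mirror p) t SR SL b v u ↔ BridgeOf p t SL SR b u v := by
  simp only [BridgeOf, mirror_fst, neg_lt_neg_iff, det_mirror]
  constructor
  · rintro ⟨h₁, h₂, h₃, h₄, h₅⟩
    refine ⟨h₂, h₁, h₄, h₃, fun i hi => ?_⟩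
    have := h₅ i hi.symm
    rwa [det_rotate] at this
  · rintro ⟨h₁, h₂, h₃, h₄, h₅⟩
    refine ⟨h₂, h₁, h₄, h₃, fun i hi => ?_⟩
    rw [det_rotate]
    exact h₅ i hi.symm

theorem Sides.mirror (h : Sides p t SL SR b) : Sides (mirror p) t SR SL b where
  apex_left := h.apex_right
  apex_right := h.apex_left
  left := fun i hi => by simpa only [mirror_fst, neg_lt_neg_iff] using h.right i hi
  right := fun i hi => by simpa only [mirror_fst, neg_lt_neg_iff] using h.left i hi
  fst_inj := fun i j e => h.fst_inj (neg_injective e)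

theorem isFunnelOf_mirror {F : Funnel n} (h : IsFunnelOf p t SL SR b F) :
    IsFunnelOf (mirror p) t SR SL b F.mirror := by
  obtain ⟨u, v, hb, h₁, h₂, h₃, h₄⟩ := h
  refine ⟨v, u, bridgeOf_mirror.2 hb, ?_, ?_, ?_, ?_⟩
  · simpa only [Funnel.mirror, List.pairwise_reverse, mirror_fst, neg_lt_neg_iff] using h₃
  · simpa only [Funnel.mirror, List.mem_reverse, onUpperHull_mirror, mirror_fst, neg_le_neg_iff]
      using h₄
  · simpa only [Funnel.mirror, List.pairwise_reverse, mirror_fst, neg_lt_neg_iff] using h₁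
  · simpa only [Funnel.mirror, List.mem_reverse, onUpperHull_mirror, mirror_fst, neg_le_neg_iff]
      using h₂

theorem Split.mirror {π : Equiv.Perm (Fin n)} {F Fu Fl : Funnel n} {q w : Fin n}
    (h : Split p π t F q w Fu Fl) :
    Split (KineticTriangulation.mirror p) π t F.mirror q w Fu.mirror Fl.mirror := by
  rw [split_iff] at h ⊢
  obtain ⟨h₁, h₂, h₃⟩ := h
  refine ⟨Funnel.isNonCorner_mirror.2 h₁, fun i hi => h₂ i (Funnel.isNonCorner_mirror.1 hi), ?_⟩
  simpa only [mirror_mirror, Funnel.mirror_mirror] using h₃.symm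

theorem SubFunnel.mirror {π : Equiv.Perm (Fin n)} {F₀ F : Funnel n}
    (h : SubFunnel p π t F₀ F) :
    SubFunnel (KineticTriangulation.mirror p) π t F₀.mirror F.mirror := by
  induction h with
  | refl => exact SubFunnel.refl
  | upper _ hs ih => exact SubFunnel.upper ih hs.mirror
  | lower _ hs ih => exact SubFunnel.lower ih hs.mirror

theorem triOf_mirror_subset (p : Fin n → ℝ → ℝ × ℝ) (SL SR : Set (Fin n))
    (π : Equiv.Perm (Fin n)) : triOf p t SL SR b π ⊆ triOf (mirror p) t SR SL b π := by
  rintro e ⟨F₀, hF, ⟨i, j, he, rfl⟩ | ⟨F, q, w, Fu, Fl, hsub, hsp, rfl⟩⟩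
  · exact ⟨F₀.mirror, isFunnelOf_mirror hF, Or.inl ⟨j, i, Funnel.isEdge_mirror.2 he, Sym2.eq_swap⟩⟩
  · exact ⟨F₀.mirror, isFunnelOf_mirror hF,
      Or.inr ⟨F.mirror, q, w, Fu.mirror, Fl.mirror, hsub.mirror, hsp.mirror, rfl⟩⟩

theorem triOf_mirror (π : Equiv.Perm (Fin n)) :
    triOf (mirror p) t SR SL b π = triOf p t SL SR b π := by
  refine Set.Subset.antisymm ?_ (triOf_mirror_subset p SL SR π)
  have := triOf_mirror_subset (t := t) (b := b) (mirror p) SR SL π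
  rwa [mirror_mirror] at this

/-- Affine interpolation of the height above a line. -/
theorem det_interpolation (c c' u m a : ℝ × ℝ) :
    (a.1 - u.1) * det c c' m = (a.1 - m.1) * det c c' u + (m.1 - u.1) * det c c' a
      + (c'.1 - c.1) * det u a m := by unfold det; ring

theorem BridgeOf.onUpperHull {u v : Fin n} (h : BridgeOf p t SL SR b u v) :
    OnUpperHull p t SL u := by
  obtain ⟨h₁, h₂, h₃, h₄, h₅⟩ := h
  refine ⟨h₁, fun j hj k hk hjk hju huk => ?_⟩
  have key := det_interpolation (p u t) (p v t) (p j t) (p u t) (p k t)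
  rw [det_self_left] at key
  have hj' := mul_nonpos_of_nonneg_of_nonpos (sub_nonneg.2 huk) (h₅ j (Or.inl hj))
  have hk' := mul_nonpos_of_nonneg_of_nonpos (sub_nonneg.2 hju) (h₅ k (Or.inl hk))
  by_contra hn
  have := mul_neg_of_pos_of_neg (sub_pos.2 (h₃.trans h₄)) (not_le.1 hn)
  linarith

theorem Sides.onUpperHull_apex (h : Sides p t SL SR b) : OnUpperHull p t SL b := by
  refine ⟨h.apex_left, fun j hj k hk hjk hjb hbk => ?_⟩
  obtain rfl := (h.left k hk).resolve_right (not_lt.2 hbk)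
  rw [det_self_right]

theorem exists_chain_right (hs : Sides p t SL SR b) {u v : Fin n} (h : BridgeOf p t SL SR b u v) :
    ∃ (c : ℕ → Fin n) (r : ℕ), c r = v ∧
      (∀ j j', j < j' → j' ≤ r → (p (c j) t).1 < (p (c j') t).1) ∧
      (∀ j ≤ r, (p b t).1 < (p (c j) t).1) ∧
      ∀ z, (OnUpperHull p t SR z ∧ (p z t).1 ≤ (p v t).1) ↔ z = b ∨ ∃ j ≤ r, z = c j := by
  classical
  have hv : OnUpperHull p t SR v := onUpperHull_mirror.1 (bridgeOf_mirror.2 h).onUpperHull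
  have hb : OnUpperHull p t SR b := onUpperHull_mirror.1 hs.mirror.onUpperHull_apex
  set S : Finset (Fin n) := Finset.univ.filter fun z =>
    OnUpperHull p t SR z ∧ (p z t).1 ≤ (p v t).1 ∧ z ≠ b with hS
  have hmem : ∀ z, z ∈ S ↔ OnUpperHull p t SR z ∧ (p z t).1 ≤ (p v t).1 ∧ z ≠ b := fun z => by
    simp [hS]
  have hvS : v ∈ S := (hmem v).2 ⟨hv, le_rfl, by rintro rfl; exact lt_irrefl _ h.2.2.2.1⟩
  obtain ⟨m, hm⟩ : ∃ m, S.card = m + 1 :=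
    ⟨S.card - 1, by have := Finset.card_pos.2 ⟨v, hvS⟩; omega⟩
  obtain ⟨c, hc, hcS⟩ := exists_enumeration hs.fst_inj m S hm
  have hcm : ∀ j ≤ m, c j ∈ S := fun j hj => (hcS _).2 ⟨j, hj, rfl⟩
  refine ⟨c, m, ?_, hc, fun j hj => ?_, fun z => ?_⟩
  · obtain ⟨i, hi, e⟩ := (hcS v).1 hvS
    rcases hi.eq_or_lt with rfl | hlt
    · exact e.symm
    · have h1 := hc i m hlt le_rfl
      rw [← e] at h1
      exact absurd ((hmem _).1 (hcm m le_rfl)).2.1 (not_le.2 h1)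
  · obtain ⟨h₁, -, h₃⟩ := (hmem _).1 (hcm j hj)
    exact (hs.right _ h₁.1).resolve_left h₃
  · rw [← hcS, hmem]
    constructor
    · rintro ⟨h₁, h₂⟩
      by_cases hz : z = b
      · exact Or.inl hz
      · exact Or.inr ⟨h₁, h₂, hz⟩
    · rintro (rfl | ⟨h₁, h₂, -⟩)
      · exact ⟨hb, h.2.2.2.1.le⟩
      · exact ⟨h₁, h₂⟩

theorem exists_cfg (hs : Sides p t SL SR b) {u v : Fin n} (h : BridgeOf p t SL SR b u v) :
    ∃ a c l r, Cfg p t SL SR b a c l r ∧ a l = u ∧ c r = v := by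
  obtain ⟨c, r, hv, h₁, h₂, h₃⟩ := exists_chain_right hs h
  obtain ⟨a, l, hu, h₄, h₅, h₆⟩ := exists_chain_right hs.mirror (bridgeOf_mirror.2 h)
  simp only [mirror_fst, neg_lt_neg_iff, neg_le_neg_iff, onUpperHull_mirror] at h₄ h₅ h₆
  subst hu hv
  exact ⟨a, c, l, r, ⟨h, h₄, h₅, h₁, h₂, h₆, h₃⟩, rfl, rfl⟩

/-- Over the apex, neither of two bridges can be above the other. So all inequalities of the
interpolation are equalities, `u'` and `v'` lie on the line `uv`, and nondegeneracy identifies the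
endpoints. -/
theorem BridgeOf.unique (hnd : NonDegenerate p t) {u v u' v' : Fin n}
    (h : BridgeOf p t SL SR b u v) (h' : BridgeOf p t SL SR b u' v') : u = u' ∧ v = v' := by
  obtain ⟨h₁, h₂, h₃, h₄, h₅⟩ := h
  obtain ⟨h₁', h₂', h₃', h₄', h₅'⟩ := h'
  have a1 := h₅ u' (Or.inl h₁')
  have a2 := h₅ v' (Or.inr h₂')
  have a3 := h₅' u (Or.inl h₁)
  have a4 := h₅' v (Or.inr h₂)
  have hz : det (p u t) (p v t) (p u' t) = 0 ∧ det (p u t) (p v t) (p v' t) = 0 := by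
    have k1 := det_interpolation (p u t) (p v t) (p u' t) (p b t) (p v' t)
    have k2 := det_interpolation (p u' t) (p v' t) (p u t) (p b t) (p v t)
    have e1 := sub_pos.2 h₃
    have e2 := sub_pos.2 h₄
    have e3 := sub_pos.2 h₃'
    have e4 := sub_pos.2 h₄'
    have m1 := mul_nonpos_of_nonneg_of_nonpos e4.le a1
    have m2 := mul_nonpos_of_nonneg_of_nonpos e3.le a2
    have m3 := mul_nonpos_of_nonneg_of_nonpos e2.le a3
    have m4 := mul_nonpos_of_nonneg_of_nonpos e1.le a4
    have z1 : (p v' t).1 - (p b t).1 ≠ 0 := e4.ne'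
    have z2 : (p b t).1 - (p u' t).1 ≠ 0 := e3.ne'
    constructor
    · rcases mul_eq_zero.1 (by linarith :
        ((p v' t).1 - (p b t).1) * det (p u t) (p v t) (p u' t) = 0) with h | h
      · exact absurd h z1
      · exact h
    · rcases mul_eq_zero.1 (by linarith :
        ((p b t).1 - (p u' t).1) * det (p u t) (p v t) (p v' t) = 0) with h | h
      · exact absurd h z2
      · exact h
  have huv : u ≠ v := by rintro rfl; exact lt_irrefl _ (h₃.trans h₄)
  constructor
  · by_contra hne
    refine hnd.det_ne huv ?_ hne hz.1
    rintro rfl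
    exact lt_irrefl _ (h₄.trans h₃')
  · by_contra hne
    refine hnd.det_ne huv hne ?_ hz.2
    rintro rfl
    exact lt_irrefl _ (h₃.trans h₄')

namespace Cfg

variable {a c : ℕ → Fin n} {l r : ℕ} (h : Cfg p t SL SR b a c l r)
include h

theorem a_hull {i : ℕ} (hi : i ≤ l) : OnUpperHull p t SL (a i) :=
  ((h.left_iff _).2 (Or.inr ⟨i, hi, rfl⟩)).1

theorem a_mem {i : ℕ} (hi : i ≤ l) : a i ∈ SL := (h.a_hull hi).1

theorem c_hull {j : ℕ} (hj : j ≤ r) : OnUpperHull p t SR (c j) :=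
  ((h.right_iff _).2 (Or.inr ⟨j, hj, rfl⟩)).1

theorem c_mem {j : ℕ} (hj : j ≤ r) : c j ∈ SR := (h.c_hull hj).1

theorem apex_mem_left : b ∈ SL := ((h.left_iff _).2 (Or.inl rfl)).1.1

theorem a_lt_c {i j : ℕ} (hi : i ≤ l) (hj : j ≤ r) : (p (a i) t).1 < (p (c j) t).1 :=
  (h.a_lt_apex i hi).trans (h.apex_lt_c j hj)

theorem root (hnd : NonDegenerate p t) (f g : ℕ → ℕ) : Chains.Root p t ⟨a, c, f, g⟩ b l r where
  nonDegenerate := hnd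
  good := by
    have hneq : ∀ {x y : Fin n}, (p x t).1 < (p y t).1 → x ≠ y := by
      rintro x y hlt rfl; exact lt_irrefl _ hlt
    have hconc : ∀ {S : Set (Fin n)} {x y z : Fin n}, OnUpperHull p t S x → OnUpperHull p t S y →
        OnUpperHull p t S z → (p x t).1 < (p y t).1 → (p y t).1 < (p z t).1 →
        det (p x t) (p y t) (p z t) < 0 := by
      intro S x y z hx hy hz hxy hyz
      have := hy.2 x hx.1 z hz.1 (hxy.trans hyz) hxy.le hyz.le
      rw [det_swap_right] at this
      exact lt_of_le_of_ne (by linarith)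
        (hnd.det_ne (hneq hxy) (hneq hyz) (hneq (hxy.trans hyz)))
    have hleft : ∀ z ∈ (Chains.funnel ⟨a, c, f, g⟩ b ⟨0, l, 0, r⟩).left,
        OnUpperHull p t SL z := by
      intro z hz
      rw [Chains.mem_funnel_left] at hz
      exact ((h.left_iff z).2 (hz.imp_right fun ⟨i, _, hi, e⟩ => ⟨i, hi, e⟩)).1
    have hright : ∀ z ∈ (Chains.funnel ⟨a, c, f, g⟩ b ⟨0, l, 0, r⟩).right,
        OnUpperHull p t SR z := by
      intro z hz
      rw [Chains.mem_funnel_right] at hz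
      exact ((h.right_iff z).2 (hz.imp_right fun ⟨i, _, hi, e⟩ => ⟨i, hi, e⟩)).1
    constructor
    · exact head?_reverse_seg a b l
    · simp [Chains.funnel]
    · simp [Chains.funnel]
    · exact getLast?_cons_seg c b r
    · exact hneq (h.a_lt_apex l le_rfl)
    · exact hneq (h.apex_lt_c r le_rfl)
    · simp only [Chains.funnel, List.pairwise_append, List.pairwise_reverse, pairwise_seg,
        List.mem_reverse, mem_seg, List.mem_singleton, List.pairwise_singleton, true_and]
      refine ⟨fun i i' _ h₁ h₂ => h.a_lt i i' h₁ (by omega), ?_⟩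
      rintro x ⟨i, _, hi, rfl⟩ y rfl
      exact h.a_lt_apex i (by omega)
    · simp only [Chains.funnel, List.pairwise_cons, pairwise_seg, mem_seg]
      refine ⟨?_, fun i i' _ h₁ h₂ => h.c_lt i i' h₁ (by omega)⟩
      rintro x ⟨i, _, hi, rfl⟩
      exact h.apex_lt_c i (by omega)
    · exact fun x hx y hy z hz => hconc (hleft x hx) (hleft y hy) (hleft z hz)
    · exact fun x hx y hy z hz => hconc (hright x hx) (hright y hy) (hright z hz)
    · intro z hz hzu hzv
      have := h.bridge.2.2.2.2 z (hz.imp (fun hz => (hleft z hz).1) (fun hz => (hright z hz).1))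
      exact lt_of_le_of_ne this (hnd.det_ne (hneq (h.a_lt_c le_rfl le_rfl)) (Ne.symm hzv)
        (Ne.symm hzu))

theorem isFunnelOf_iff (hnd : NonDegenerate p t) (f g : ℕ → ℕ) {F : Funnel n} :
    IsFunnelOf p t SL SR b F ↔ F = Chains.funnel ⟨a, c, f, g⟩ b ⟨0, l, 0, r⟩ := by
  have hr := h.root hnd f g
  have hL : ∀ z, z ∈ (Chains.funnel ⟨a, c, f, g⟩ b ⟨0, l, 0, r⟩).left ↔
      OnUpperHull p t SL z ∧ (p (a l) t).1 ≤ (p z t).1 := fun z => by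
    rw [Chains.mem_funnel_left, h.left_iff]
    simp
  have hR : ∀ z, z ∈ (Chains.funnel ⟨a, c, f, g⟩ b ⟨0, l, 0, r⟩).right ↔
      OnUpperHull p t SR z ∧ (p z t).1 ≤ (p (c r) t).1 := fun z => by
    rw [Chains.mem_funnel_right, h.right_iff]
    simp
  constructor
  · rintro ⟨u, v, hb, h₁, h₂, h₃, h₄⟩
    obtain ⟨rfl, rfl⟩ := hb.unique hnd h.bridge
    have e₁ := eq_of_sorted_of_mem_iff h₁ hr.good.sorted_left fun z => (h₂ z).trans (hL z).symm
    have e₂ := eq_of_sorted_of_mem_iff h₃ hr.good.sorted_right fun z => (h₄ z).trans (hR z).symm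
    cases F
    simp only at e₁ e₂
    rw [e₁, e₂]
  · rintro rfl
    exact ⟨_, _, h.bridge, hr.good.sorted_left, hL, hr.good.sorted_right, hR⟩

end Cfg

/-- The boundary edges of the funnel with chains `a 0, …, a l` and `c 0, …, c r`. -/
def bd (a c : ℕ → Fin n) (b : Fin n) (l r : ℕ) : Set (Sym2 (Fin n)) :=
  {e | (∃ i < l, e = s(a (i + 1), a i)) ∨ e = s(a 0, b) ∨ e = s(b, c 0) ∨
    (∃ j < r, e = s(c j, c (j + 1))) ∨ e = s(a l, c r)}

theorem infix_cons_seg_iff {α : Type*} (c : ℕ → α) (b : α) (r : ℕ) (x y : α) :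
    [x, y] <:+: b :: seg c 0 (r + 1) ↔
      (x = b ∧ y = c 0) ∨ ∃ j < r, x = c j ∧ y = c (j + 1) := by
  have key : ∀ m i, [x, y] <:+: seg c i m ↔ ∃ j, i ≤ j ∧ j + 1 < i + m ∧ x = c j ∧ y = c (j + 1) := by
    intro m
    induction m with
    | zero =>
      intro i
      simp only [seg, List.range'_zero, List.map_nil, List.infix_nil, reduceCtorEq, false_iff]
      rintro ⟨j, h₁, h₂, -⟩
      omega
    | succ m ih =>
      intro i
      rw [seg_succ, List.infix_cons_iff, ih]
      constructor
      · rintro (h | ⟨j, h₁, h₂, h₃⟩)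
        · rw [List.cons_prefix_cons] at h
          obtain ⟨rfl, h⟩ := h
          cases m with
          | zero => simp [seg] at h
          | succ m =>
            rw [seg_succ, List.cons_prefix_cons] at h
            exact ⟨i, le_rfl, by omega, rfl, h.1⟩
        · exact ⟨j, by omega, by omega, h₃⟩
      · rintro ⟨j, h₁, h₂, rfl, rfl⟩
        rcases h₁.eq_or_lt with rfl | hlt
        · left
          obtain ⟨m', rfl⟩ : ∃ m', m = m' + 1 := ⟨m - 1, by omega⟩
          rw [seg_succ]
          simp
        · exact Or.inr ⟨j, hlt, by omega, rfl, rfl⟩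
  rw [List.infix_cons_iff, key, seg_succ]
  refine or_congr ?_ ?_
  · simp
  · constructor
    · rintro ⟨j, _, h₂, h₃⟩; exact ⟨j, by omega, h₃⟩
    · rintro ⟨j, h₂, h₃⟩; exact ⟨j, Nat.zero_le _, by omega, h₃⟩

theorem isEdge_funnel_iff (d : Chains n) (l r : ℕ) (x y : Fin n) :
    (d.funnel b ⟨0, l, 0, r⟩).IsEdge x y ↔
      ((x = d.a 0 ∧ y = b) ∨ ∃ i < l, x = d.a (i + 1) ∧ y = d.a i) ∨
      ((x = b ∧ y = d.c 0) ∨ ∃ j < r, x = d.c j ∧ y = d.c (j + 1)) ∨ (x = d.a l ∧ y = d.c r) := by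
  simp only [Funnel.IsEdge, Chains.funnel, Nat.sub_zero]
  refine or_congr ?_ (or_congr ?_ ?_)
  · rw [show (seg d.a 0 (l + 1)).reverse ++ [b] = (b :: seg d.a 0 (l + 1)).reverse by simp,
      ← List.reverse_infix, List.reverse_reverse]
    refine (infix_cons_seg_iff d.a b l y x).trans (or_congr and_comm ?_)
    exact exists_congr fun i => and_congr_right fun _ => and_comm
  · exact infix_cons_seg_iff d.c b r x y
  · rw [head?_reverse_seg, getLast?_cons_seg]
    simp [eq_comm]

/-- The triangulation consists of the boundary edges and the chords. -/
theorem Cfg.triOf_eq {a c : ℕ → Fin n} {l r : ℕ} (h : Cfg p t SL SR b a c l r)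
    (hnd : NonDegenerate p t) {f g : ℕ → ℕ} (hs : Chains.TangentSpec p t ⟨a, c, f, g⟩ l r)
    (π : Equiv.Perm (Fin n)) :
    triOf p t SL SR b π = bd a c b l r ∪ Chains.edges ⟨a, c, f, g⟩ π ⟨0, l, 0, r⟩ := by
  rw [← (h.root hnd f g).chords_eq hs]
  ext e
  simp only [triOf, h.isFunnelOf_iff hnd f g, exists_eq_left, Set.mem_union, Set.mem_ofPred_eq, bd]
  refine or_congr_left ?_
  simp only [isEdge_funnel_iff]
  constructor
  · rintro ⟨x, y, ((⟨rfl, rfl⟩ | ⟨i, hi, rfl, rfl⟩) | (⟨rfl, rfl⟩ | ⟨j, hj, rfl, rfl⟩) |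
      ⟨rfl, rfl⟩), rfl⟩
    · exact Or.inr (Or.inl rfl)
    · exact Or.inl ⟨i, hi, rfl⟩
    · exact Or.inr (Or.inr (Or.inl rfl))
    · exact Or.inr (Or.inr (Or.inr (Or.inl ⟨j, hj, rfl⟩)))
    · exact Or.inr (Or.inr (Or.inr (Or.inr rfl)))
  · rintro (⟨i, hi, rfl⟩ | rfl | rfl | ⟨j, hj, rfl⟩ | rfl)
    · exact ⟨_, _, Or.inl (Or.inr ⟨i, hi, rfl, rfl⟩), rfl⟩
    · exact ⟨_, _, Or.inl (Or.inl ⟨rfl, rfl⟩), rfl⟩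
    · exact ⟨_, _, Or.inr (Or.inl (Or.inl ⟨rfl, rfl⟩)), rfl⟩
    · exact ⟨_, _, Or.inr (Or.inl (Or.inr ⟨j, hj, rfl, rfl⟩)), rfl⟩
    · exact ⟨_, _, Or.inr (Or.inr ⟨rfl, rfl⟩), rfl⟩

end Configuration

/-! ### Passing a critical time: tangents, bridge, disappearance of the funnel -/

section Critical

variable {n : ℕ} (p : Fin n → ℝ → ℝ × ℝ) (t₀ : ℝ) (T : Set (Fin n))

/-- At time `t₀` the points have distinct `x`-coordinates and every triple that misses a point of
`T` is not collinear. -/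
structure Critical : Prop where
  fst_inj : Function.Injective fun i => (p i t₀).1
  det_ne : ∀ {i j k w}, w ∈ T → w ≠ i → w ≠ j → w ≠ k → i ≠ j → j ≠ k → i ≠ k →
    det (p i t₀) (p j t₀) (p k t₀) ≠ 0

/-- Time `t` is not degenerate and agrees with `t₀` in the `x`-order and in the orientation of the
triples that miss a point of `T`. -/
structure Near (t : ℝ) : Prop where
  nd : NonDegenerate p t
  lt_iff : ∀ i j, (p i t).1 < (p j t).1 ↔ (p i t₀).1 < (p j t₀).1
  sign : ∀ {i j k w}, w ∈ T → w ≠ i → w ≠ j → w ≠ k →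
    SignType.sign (det (p i t) (p j t) (p k t)) = SignType.sign (det (p i t₀) (p j t₀) (p k t₀))

variable {p t₀ T}

theorem lt_iff_of_sign_eq {x y : ℝ} (h : SignType.sign x = SignType.sign y) :
    (x < 0 ↔ y < 0) ∧ (0 < x ↔ 0 < y) := by
  rw [← sign_eq_neg_one_iff, ← sign_eq_neg_one_iff, ← sign_eq_one_iff, ← sign_eq_one_iff, h]
  exact ⟨Iff.rfl, Iff.rfl⟩

theorem le_iff_of_sign_eq {x y : ℝ} (h : SignType.sign x = SignType.sign y) :
    (x ≤ 0 ↔ y ≤ 0) ∧ (0 ≤ x ↔ 0 ≤ y) := by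
  have := lt_iff_of_sign_eq h
  exact ⟨by rw [← not_lt, this.2, not_lt], by rw [← not_lt, this.1, not_lt]⟩

theorem Critical.mirror (h : Critical p t₀ T) : Critical (mirror p) t₀ T where
  fst_inj := fun _ _ e => h.fst_inj (neg_injective e)
  det_ne := fun hw h₁ h₂ h₃ h₄ h₅ h₆ => by
    rw [det_mirror]
    exact h.det_ne hw h₃ h₂ h₁ h₅.symm h₄.symm h₆.symm

theorem Near.mirror {t : ℝ} (h : Near p t₀ T t) : Near (mirror p) t₀ T t where
  nd := h.nd.mirror
  lt_iff := fun i j => by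
    simp only [mirror_fst, neg_lt_neg_iff]
    exact h.lt_iff j i
  sign := fun hw h₁ h₂ h₃ => by
    rw [det_mirror, det_mirror]
    exact h.sign hw h₃ h₂ h₁

theorem Near.le_iff {t : ℝ} (h : Near p t₀ T t) (i j : Fin n) :
    (p i t).1 ≤ (p j t).1 ↔ (p i t₀).1 ≤ (p j t₀).1 := by
  rw [← not_lt, h.lt_iff, not_lt]

/-- The upper hull of a set that misses a point of `T` does not change. -/
theorem Near.onUpperHull_iff {t : ℝ} (h : Near p t₀ T t) {S : Set (Fin n)} {w : Fin n} (hw : w ∈ T)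
    (hwS : w ∉ S) {z : Fin n} : OnUpperHull p t S z ↔ OnUpperHull p t₀ S z := by
  have hne : ∀ {j}, j ∈ S → w ≠ j := fun hj e => hwS (e ▸ hj)
  refine and_congr_right fun hz => forall₂_congr fun j hj => forall₂_congr fun k hk => ?_
  rw [h.lt_iff, h.le_iff, h.le_iff, (le_iff_of_sign_eq (h.sign hw (hne hj) (hne hk) (hne hz))).2]

/-- The number of changes from `T₁` to `T₂` is bounded by a constant, or by the size of the part of
a fixed funnel in which a fixed point generates its chord. -/
def Controlled (V : Set (Fin n)) (T₁ T₂ : Equiv.Perm (Fin n) → Set (Sym2 (Fin n))) : Prop :=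
  (∀ π, (symmDiff (T₁ π) (T₂ π)).ncard ≤ 3) ∨
    ∃ (d : Chains n) (l r : ℕ) (x : Fin n), d.Wf l r ∧ (∀ y, d.Inner ⟨0, l, 0, r⟩ y → y ∈ V) ∧
      ∀ π, ∃ m, d.BoundedBy l r π x m ∧ (symmDiff (T₁ π) (T₂ π)).ncard ≤ 3 + 2 * m

theorem Controlled.symm {V : Set (Fin n)} {T₁ T₂ : Equiv.Perm (Fin n) → Set (Sym2 (Fin n))}
    (h : Controlled V T₁ T₂) : Controlled V T₂ T₁ := by
  have e : ∀ π, symmDiff (T₂ π) (T₁ π) = symmDiff (T₁ π) (T₂ π) := fun π => symmDiff_comm _ _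
  simpa only [Controlled, e] using h

/-- `V` contains all points of the range other than the apex and the extreme points. -/
def Interior (p : Fin n → ℝ → ℝ × ℝ) (t : ℝ) (SL SR : Set (Fin n)) (b : Fin n) (V : Set (Fin n)) :
    Prop :=
  ∀ y z z', (y ∈ SL ∨ y ∈ SR) → (z ∈ SL ∨ z ∈ SR) → (z' ∈ SL ∨ z' ∈ SR) → y ≠ b →
    (p z t).1 < (p y t).1 → (p y t).1 < (p z' t).1 → y ∈ V

variable {SL SR V : Set (Fin n)} {b : Fin n} {a c : ℕ → Fin n} {l r : ℕ}

theorem Interior.mirror (h : Interior p t₀ SL SR b V) :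
    Interior (mirror p) t₀ SR SL b V := fun y z z' h₁ h₂ h₃ h₄ h₅ h₆ => by
  simp only [mirror_fst, neg_lt_neg_iff] at h₅ h₆
  exact h y z' z h₁.symm h₃.symm h₂.symm h₄ h₆ h₅

theorem Cfg.a_ne_apex (h : Cfg p t₀ SL SR b a c l r) {i : ℕ} (hi : i ≤ l) : a i ≠ b :=
  fun e => (h.a_lt_apex i hi).ne (by rw [e])

theorem Cfg.c_ne_apex (h : Cfg p t₀ SL SR b a c l r) {j : ℕ} (hj : j ≤ r) : c j ≠ b :=
  fun e => (h.apex_lt_c j hj).ne (by rw [e])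

theorem Cfg.inner_mem (h : Cfg p t₀ SL SR b a c l r) (hV : Interior p t₀ SL SR b V) {f g : ℕ → ℕ}
    {y : Fin n} (hy : Chains.Inner ⟨a, c, f, g⟩ ⟨0, l, 0, r⟩ y) : y ∈ V := by
  rcases hy with ⟨i, -, hi, rfl⟩ | ⟨j, -, hj, rfl⟩
  · simp only at hi
    refine hV _ (a l) b (Or.inl (h.a_mem hi.le)) (Or.inl (h.a_mem le_rfl)) (Or.inl h.apex_mem_left)
      ?_ (h.a_lt i l hi le_rfl) (h.a_lt_apex i hi.le)
    exact h.a_ne_apex hi.le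
  · simp only at hj
    refine hV _ b (c r) (Or.inr (h.c_mem hj.le)) (Or.inl h.apex_mem_left) (Or.inr (h.c_mem le_rfl))
      ?_ (h.apex_lt_c j hj.le) (h.c_lt j r hj le_rfl)
    exact h.c_ne_apex hj.le

theorem Sides.a_notMem (hs : Sides p t₀ SL SR b) (h : Cfg p t₀ SL SR b a c l r) {i : ℕ}
    (hi : i ≤ l) : a i ∉ SR := fun hm => by
  have := h.a_lt_apex i hi
  rcases hs.right _ hm with e | h'
  · rw [e] at this; exact lt_irrefl _ this
  · exact lt_asymm this h'

theorem Sides.c_notMem (hs : Sides p t₀ SL SR b) (h : Cfg p t₀ SL SR b a c l r) {j : ℕ}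
    (hj : j ≤ r) : c j ∉ SL := fun hm => by
  have := h.apex_lt_c j hj
  rcases hs.left _ hm with e | h'
  · rw [e] at this; exact lt_irrefl _ this
  · exact lt_asymm this h'

theorem Cfg.a_ne (h : Cfg p t₀ SL SR b a c l r) {i i' : ℕ} (hi : i ≤ l) (hi' : i' ≤ l)
    (hne : i ≠ i') : a i ≠ a i' := fun e => by
  rcases Nat.lt_or_gt_of_ne hne with hlt | hlt
  · exact (h.a_lt _ _ hlt hi').ne (by rw [e])
  · exact (h.a_lt _ _ hlt hi).ne (by rw [e])

theorem Cfg.c_ne (h : Cfg p t₀ SL SR b a c l r) {i i' : ℕ} (hi : i ≤ r) (hi' : i' ≤ r)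
    (hne : i ≠ i') : c i ≠ c i' := fun e => by
  rcases Nat.lt_or_gt_of_ne hne with hlt | hlt
  · exact (h.c_lt _ _ hlt hi').ne (by rw [e])
  · exact (h.c_lt _ _ hlt hi).ne (by rw [e])

theorem Cfg.a_ne_c (h : Cfg p t₀ SL SR b a c l r) {i j : ℕ} (hi : i ≤ l) (hj : j ≤ r) :
    a i ≠ c j := fun e => (h.a_lt_c hi hj).ne (by rw [e])

/-- A configuration persists if the upper hulls and the bridge do. -/
theorem Cfg.persists {t : ℝ} (h : Cfg p t₀ SL SR b a c l r)
    (hlt : ∀ i j, (p i t).1 < (p j t).1 ↔ (p i t₀).1 < (p j t₀).1)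
    (hL : ∀ z, OnUpperHull p t SL z ↔ OnUpperHull p t₀ SL z)
    (hR : ∀ z, OnUpperHull p t SR z ↔ OnUpperHull p t₀ SR z)
    (hb : ∀ i, i ∈ SL ∨ i ∈ SR → det (p (a l) t) (p (c r) t) (p i t) ≤ 0) :
    Cfg p t SL SR b a c l r where
  bridge := ⟨h.bridge.1, h.bridge.2.1, (hlt _ _).2 h.bridge.2.2.1, (hlt _ _).2 h.bridge.2.2.2.1, hb⟩
  a_lt := fun i i' h₁ h₂ => (hlt _ _).2 (h.a_lt i i' h₁ h₂)
  a_lt_apex := fun i hi => (hlt _ _).2 (h.a_lt_apex i hi)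
  c_lt := fun i i' h₁ h₂ => (hlt _ _).2 (h.c_lt i i' h₁ h₂)
  apex_lt_c := fun i hi => (hlt _ _).2 (h.apex_lt_c i hi)
  left_iff := fun z => by rw [hL, ← not_lt, hlt, not_lt]; exact h.left_iff z
  right_iff := fun z => by rw [hR, ← not_lt, hlt, not_lt]; exact h.right_iff z

theorem eq_of_lt_iff {x y r : ℕ} (hx : x ≤ r) (hy : y ≤ r) (h : ∀ j < r, (j < x ↔ j < y)) :
    x = y := by
  rcases lt_trichotomy x y with hlt | heq | hlt
  · have := (h x (by omega)).2 hlt; omega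
  · exact heq
  · have := (h y (by omega)).1 hlt; omega

/-- If all orientations agree, the triangulations agree. -/
theorem triOf_eq_of_sign_eq {t t' : ℝ} (hnd : NonDegenerate p t) (hnd' : NonDegenerate p t')
    (hs : Sides p t SL SR b)
    (hlt : ∀ i j, (p i t').1 < (p j t').1 ↔ (p i t).1 < (p j t).1)
    (hsign : ∀ i j k, SignType.sign (det (p i t') (p j t') (p k t')) =
      SignType.sign (det (p i t) (p j t) (p k t))) (π : Equiv.Perm (Fin n)) :
    triOf p t SL SR b π = triOf p t' SL SR b π := by
  have hle : ∀ i j, (p i t').1 ≤ (p j t').1 ↔ (p i t).1 ≤ (p j t).1 := fun i j => by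
    rw [← not_lt, hlt, not_lt]
  have hhull : ∀ (S : Set (Fin n)) z, OnUpperHull p t' S z ↔ OnUpperHull p t S z := by
    intro S z
    refine and_congr_right fun hz => forall₂_congr fun j hj => forall₂_congr fun k hk => ?_
    rw [hlt, hle, hle, (le_iff_of_sign_eq (hsign _ _ _)).2]
  have hbr : ∀ u v, BridgeOf p t' SL SR b u v ↔ BridgeOf p t SL SR b u v := by
    intro u v
    simp only [BridgeOf, hlt, (le_iff_of_sign_eq (hsign u v _)).1]
  by_cases hex : ∃ u v, BridgeOf p t SL SR b u v
  · obtain ⟨u, v, hb⟩ := hex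
    obtain ⟨a, c, l, r, hc, rfl, rfl⟩ := exists_cfg hs hb
    have hc' : Cfg p t' SL SR b a c l r := hc.persists hlt (hhull _) (hhull _)
      ((hbr _ _).2 hb).2.2.2.2
    obtain ⟨f, g, hsp⟩ := Chains.Root.exists_tangentSpec (hc.root hnd)
    have hsp' : Chains.TangentSpec p t' ⟨a, c, f, g⟩ l r :=
      ⟨hsp.f_le, fun i hi j hj => by rw [hsp.f_iff i hi j hj, (lt_iff_of_sign_eq (hsign _ _ _)).2],
        hsp.g_le, fun j hj i hi => by rw [hsp.g_iff j hj i hi, (lt_iff_of_sign_eq (hsign _ _ _)).2]⟩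
    rw [hc.triOf_eq hnd hsp, hc'.triOf_eq hnd' hsp']
  · have h₁ : ∀ F, ¬ IsFunnelOf p t SL SR b F := fun F ⟨u, v, hb, _⟩ => hex ⟨u, v, hb⟩
    have h₂ : ∀ F, ¬ IsFunnelOf p t' SL SR b F := fun F ⟨u, v, hb, _⟩ =>
      hex ⟨u, v, (hbr u v).1 hb⟩
    simp [triOf, h₁, h₂]

theorem symmDiff_union_subset {α : Type*} (A B C D : Set α) :
    symmDiff (A ∪ B) (C ∪ D) ⊆ symmDiff A C ∪ symmDiff B D := by
  intro x
  simp only [Set.mem_symmDiff, Set.mem_union]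
  grind

/-- Combination of the changes of the boundary and of the chords. -/
theorem controlled_of_simulation {d d' : Chains n} {l r l' r' : ℕ} {x : Fin n}
    {T₁ T₂ : Equiv.Perm (Fin n) → Set (Sym2 (Fin n))} {B B' : Set (Sym2 (Fin n))}
    (hd : d.Wf l r) (hV : ∀ y, d.Inner ⟨0, l, 0, r⟩ y → y ∈ V)
    {rel : Box → Box → Prop} (hsim : ∀ π, Chains.Simulation d d' l r l' r' x π rel)
    (hrel : rel ⟨0, l, 0, r⟩ ⟨0, l', 0, r'⟩) (h₁ : ∀ π, T₁ π = B ∪ d.edges π ⟨0, l, 0, r⟩)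
    (h₂ : ∀ π, T₂ π = B' ∪ d'.edges π ⟨0, l', 0, r'⟩) (hB : (symmDiff B B').ncard ≤ 3) :
    Controlled V T₁ T₂ := by
  refine Or.inr ⟨d, l, r, x, hd, hV, fun π => ?_⟩
  obtain ⟨m, hm, hcard⟩ := (hsim π).ncard_symmDiff_le hrel
  refine ⟨m, hm, ?_⟩
  rw [h₁, h₂]
  have e₁ := Set.ncard_le_ncard (symmDiff_union_subset B (d.edges π ⟨0, l, 0, r⟩) B'
    (d'.edges π ⟨0, l', 0, r'⟩)) (Set.toFinite _)
  have e₂ := Set.ncard_union_le (symmDiff B B')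
    (symmDiff (d.edges π ⟨0, l, 0, r⟩) (d'.edges π ⟨0, l', 0, r'⟩))
  omega

/-- A non-corner vertex of the right chain crosses the line through an edge of the left chain. -/
theorem controlled_visibility {t t' : ℝ} (ht : Near p t₀ T t) (ht' : Near p t₀ T t')
    (hs : Sides p t₀ SL SR b) (hV : Interior p t₀ SL SR b V) (h : Cfg p t₀ SL SR b a c l r)
    {i₀ j₀ : ℕ} (hi₀ : i₀ < l) (hj₀ : j₀ < r) (h₁ : a (i₀ + 1) ∈ T) (h₂ : a i₀ ∈ T)
    (h₃ : c j₀ ∈ T) : Controlled V (triOf p t SL SR b) (triOf p t' SL SR b) := by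
  -- The left hull misses `c j₀`, the right hull misses `a i₀`, and any triple with both bridge
  -- endpoints misses one of these two points. So the configuration is the same at all near times.
  have hcfg : ∀ {t}, Near p t₀ T t → Cfg p t SL SR b a c l r := by
    intro t ht
    refine h.persists ht.lt_iff (fun z => ht.onUpperHull_iff h₃ (hs.c_notMem h hj₀.le))
      (fun z => ht.onUpperHull_iff h₂ (hs.a_notMem h hi₀.le)) fun z hz => ?_
    by_cases hzc : z = c j₀
    · refine (le_iff_of_sign_eq (ht.sign h₂ (h.a_ne hi₀.le le_rfl hi₀.ne)
        (h.a_ne_c hi₀.le le_rfl) ?_)).1.2 (h.bridge.2.2.2.2 z hz)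
      rw [hzc]
      exact h.a_ne_c hi₀.le hj₀.le
    · exact (le_iff_of_sign_eq (ht.sign h₃ (h.a_ne_c le_rfl hj₀.le).symm
        (h.c_ne hj₀.le le_rfl hj₀.ne) (Ne.symm hzc))).1.2 (h.bridge.2.2.2.2 z hz)
  have hc := hcfg ht
  have hc' := hcfg ht'
  obtain ⟨f, g, hsp⟩ := Chains.Root.exists_tangentSpec (hc.root ht.nd)
  obtain ⟨f', g', hsp'⟩ := Chains.Root.exists_tangentSpec (hc'.root ht'.nd)
  -- Such a triple has only one point on the left chain, so it misses `a i₀` or `a (i₀ + 1)`; no `f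
  -- i` changes. For `g j` with `j ≠ j₀` the triple misses `c j₀`.
  have hfs : ∀ {t}, Near p t₀ T t → ∀ i < l, ∀ j < r,
      (0 < det (p (a i) t) (p (c j) t) (p (c (j + 1)) t) ↔
        0 < det (p (a i) t₀) (p (c j) t₀) (p (c (j + 1)) t₀)) := by
    intro t ht i hi j hj
    by_cases hii : i = i₀
    · exact (lt_iff_of_sign_eq (ht.sign h₁ (h.a_ne hi₀ hi.le (by omega))
        (h.a_ne_c hi₀ hj.le) (h.a_ne_c hi₀ hj))).2
    · exact (lt_iff_of_sign_eq (ht.sign h₂ (h.a_ne hi₀.le hi.le (Ne.symm hii))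
        (h.a_ne_c hi₀.le hj.le) (h.a_ne_c hi₀.le hj))).2
  have hgs : ∀ {t}, Near p t₀ T t → ∀ j < r, j ≠ j₀ → ∀ i < l,
      (0 < det (p (a (i + 1)) t) (p (a i) t) (p (c j) t) ↔
        0 < det (p (a (i + 1)) t₀) (p (a i) t₀) (p (c j) t₀)) := by
    intro t ht j hj hjj i hi
    exact (lt_iff_of_sign_eq (ht.sign h₃ (h.a_ne_c hi hj₀.le).symm
      (h.a_ne_c hi.le hj₀.le).symm (h.c_ne hj₀.le hj.le (Ne.symm hjj)))).2
  refine controlled_of_simulation (B := bd a c b l r) (B' := bd a c b l r)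
    ((hc.root ht.nd f g).wf hsp) (fun y hy => h.inner_mem hV hy)
    (fun π => Chains.simulation_tangent (d' := ⟨a, c, f', g'⟩) (j₀ := j₀) π
      (hc.root ht.nd f g).inj rfl rfl (fun i hi => ?_) (fun j hj hjj => ?_))
    ⟨rfl, Chains.within_root l r⟩ (hc.triOf_eq ht.nd hsp) (hc'.triOf_eq ht'.nd hsp') (by simp)
  · refine eq_of_lt_iff (hsp'.f_le i hi) (hsp.f_le i hi) fun j hj => ?_
    rw [hsp'.f_iff i hi j hj, hsp.f_iff i hi j hj]
    exact (hfs ht' i hi j hj).trans (hfs ht i hi j hj).symm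
  · refine eq_of_lt_iff (hsp'.g_le j hj) (hsp.g_le j hj) fun i hi => ?_
    rw [hsp'.g_iff j hj i hi, hsp.g_iff j hj i hi]
    exact (hgs ht' j hj hjj i hi).trans (hgs ht j hj hjj i hi).symm

theorem ncard_le_three_of_subset {α : Type*} {A : Set α} {x y z : α}
    (h : A ⊆ {x, y, z}) : A.ncard ≤ 3 := by
  have hf : ({x, y, z} : Set α).Finite := Set.toFinite _
  refine (Set.ncard_le_ncard h hf).trans ?_
  refine (Set.ncard_insert_le _ _).trans (Nat.succ_le_succ ?_)
  refine (Set.ncard_insert_le _ _).trans (Nat.succ_le_succ ?_)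
  rw [Set.ncard_singleton]

/-- The outermost left edge and the old base are lost, and the new base is gained. -/
theorem bd_cut (a c : ℕ → Fin n) (b : Fin n) (l r : ℕ) :
    (symmDiff (bd a c b (l + 1) r) (bd a c b l r)).ncard ≤ 3 := by
  refine ncard_le_three_of_subset (x := s(a (l + 1), a l)) (y := s(a (l + 1), c r))
    (z := s(a l, c r)) fun e he => ?_
  simp only [Set.mem_insert_iff, Set.mem_singleton_iff]
  rcases he with ⟨he, hn⟩ | ⟨he, hn⟩
  · rcases he with ⟨i, hi, rfl⟩ | he | he | he | rfl
    · by_cases hil : i = l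
      · subst hil; exact Or.inl rfl
      · exact (hn (Or.inl ⟨i, by omega, rfl⟩)).elim
    · exact (hn (Or.inr (Or.inl he))).elim
    · exact (hn (Or.inr (Or.inr (Or.inl he)))).elim
    · exact (hn (Or.inr (Or.inr (Or.inr (Or.inl he))))).elim
    · exact Or.inr (Or.inl rfl)
  · rcases he with ⟨i, hi, rfl⟩ | he | he | he | rfl
    · exact (hn (Or.inl ⟨i, by omega, rfl⟩)).elim
    · exact (hn (Or.inr (Or.inl he))).elim
    · exact (hn (Or.inr (Or.inr (Or.inl he)))).elim
    · exact (hn (Or.inr (Or.inr (Or.inr (Or.inl he))))).elim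
    · exact Or.inr (Or.inr rfl)

/-- Three collinear points span the same line. -/
theorem det_collinear {u q k : ℝ × ℝ} (h₁ : u.1 < q.1) (h₂ : q.1 < k.1) (h : det u q k = 0)
    (z : ℝ × ℝ) : SignType.sign (det u q z) = SignType.sign (det u k z) ∧
      SignType.sign (det q k z) = SignType.sign (det u k z) := by
  have key : ∀ {x y s r : ℝ}, 0 < s → 0 < r → x * s = y * r →
      SignType.sign x = SignType.sign y := by
    intro x y s r hs hr e
    have := congrArg SignType.sign e
    rwa [sign_mul, sign_mul, sign_pos hs, sign_pos hr, mul_one, mul_one] at this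
  have hz : det u q k * (z.1 - u.1) = 0 := by rw [h, zero_mul]
  have hz' : det u q k * (z.1 - k.1) = 0 := by rw [h, zero_mul]
  constructor
  · refine key (sub_pos.2 (h₁.trans h₂)) (sub_pos.2 h₁) ?_
    unfold det at *
    linarith
  · refine key (sub_pos.2 (h₁.trans h₂)) (sub_pos.2 h₂) ?_
    unfold det at *
    linarith

/-- The left endpoint of the bridge moves from `a (l + 1)` to `a l`. -/
theorem controlled_bridge {t t' : ℝ} (ht : Near p t₀ T t) (ht' : Near p t₀ T t')
    (hs : Sides p t₀ SL SR b) (hV : Interior p t₀ SL SR b V) (h : Cfg p t₀ SL SR b a c (l + 1) r)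
    (h₁ : a (l + 1) ∈ T) (h₂ : a l ∈ T) (h₃ : c r ∈ T)
    (h0 : det (p (a (l + 1)) t₀) (p (a l) t₀) (p (c r) t₀) = 0)
    (hneg : det (p (a (l + 1)) t) (p (a l) t) (p (c r) t) > 0)
    (hpos : det (p (a (l + 1)) t') (p (a l) t') (p (c r) t') < 0) :
    Controlled V (triOf p t SL SR b) (triOf p t' SL SR b) := by
  have hal : (p (a (l + 1)) t₀).1 < (p (a l) t₀).1 := h.a_lt _ _ (Nat.lt_succ_self l) le_rfl
  have hac : (p (a l) t₀).1 < (p (c r) t₀).1 := h.a_lt_c (Nat.le_succ l) le_rfl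
  have hne : a l ≠ a (l + 1) := h.a_ne (Nat.le_succ l) le_rfl (by omega)
  have hc : Cfg p t SL SR b a c (l + 1) r := by
    refine h.persists ht.lt_iff (fun z => ht.onUpperHull_iff h₃ (hs.c_notMem h le_rfl))
      (fun z => ht.onUpperHull_iff h₂ (hs.a_notMem h (Nat.le_succ l))) fun z hz => ?_
    by_cases hza : z = a l
    · rw [hza, det_swap_right]; linarith
    · exact (le_iff_of_sign_eq (ht.sign h₂ hne (h.a_ne_c (Nat.le_succ l) le_rfl)
        (Ne.symm hza))).1.2 (h.bridge.2.2.2.2 z hz)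
  have hc' : Cfg p t' SL SR b a c l r := by
    -- At time `t₀` both segments are bridges, since `a (l + 1)`, `a l` and `c r` are collinear;
    -- nearby, the orientation of this triple decides between them.
    have hcl : Cfg p t₀ SL SR b a c l r := by
      refine ⟨⟨h.a_mem (Nat.le_succ l), h.bridge.2.1, h.a_lt_apex l (Nat.le_succ l),
        h.bridge.2.2.2.1, fun z hz => ?_⟩, fun i i' hi hi' => h.a_lt i i' hi (by omega),
        fun i hi => h.a_lt_apex i (by omega), h.c_lt, h.apex_lt_c, fun z => ?_, h.right_iff⟩
      · exact (le_iff_of_sign_eq (det_collinear hal hac h0 (p z t₀)).2).1.2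
          (h.bridge.2.2.2.2 z hz)
      · constructor
        · rintro ⟨hz, hzl⟩
          rcases (h.left_iff z).1 ⟨hz, hal.le.trans hzl⟩ with e | ⟨i, hi, rfl⟩
          · exact Or.inl e
          · refine Or.inr ⟨i, ?_, rfl⟩
            by_contra hil
            obtain rfl : i = l + 1 := by omega
            exact absurd hal (not_lt.2 hzl)
        · intro hz
          refine ⟨((h.left_iff z).2 (hz.imp_right fun ⟨i, hi, e⟩ => ⟨i, by omega, e⟩)).1, ?_⟩
          rcases hz with rfl | ⟨i, hi, rfl⟩
          · exact (h.a_lt_apex l (Nat.le_succ l)).le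
          · rcases hi.eq_or_lt with rfl | hlt
            · exact le_rfl
            · exact (h.a_lt i l hlt (Nat.le_succ l)).le
    refine hcl.persists ht'.lt_iff (fun z => ht'.onUpperHull_iff h₃ (hs.c_notMem h le_rfl))
      (fun z => ht'.onUpperHull_iff h₂ (hs.a_notMem h (Nat.le_succ l))) fun z hz => ?_
    by_cases hza : z = a (l + 1)
    · rw [hza, ← det_rotate]; exact hpos.le
    · exact (le_iff_of_sign_eq (ht'.sign h₁ hne.symm (h.a_ne_c le_rfl le_rfl)
        (Ne.symm hza))).1.2 (hcl.bridge.2.2.2.2 z hz)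
  obtain ⟨f, g, hsp⟩ := Chains.Root.exists_tangentSpec (hc.root ht.nd)
  obtain ⟨f', g', hsp'⟩ := Chains.Root.exists_tangentSpec (hc'.root ht'.nd)
  have hfs : ∀ {t}, Near p t₀ T t → ∀ i < l, ∀ j < r,
      (0 < det (p (a i) t) (p (c j) t) (p (c (j + 1)) t) ↔
        0 < det (p (a i) t₀) (p (c j) t₀) (p (c (j + 1)) t₀)) := by
    intro t ht i hi j hj
    exact (lt_iff_of_sign_eq (ht.sign h₁ (h.a_ne le_rfl (by omega) (by omega))
        (h.a_ne_c le_rfl hj.le) (h.a_ne_c le_rfl hj))).2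
  have hgs : ∀ {t}, Near p t₀ T t → ∀ j < r, ∀ i < l + 1,
      (0 < det (p (a (i + 1)) t) (p (a i) t) (p (c j) t) ↔
        0 < det (p (a (i + 1)) t₀) (p (a i) t₀) (p (c j) t₀)) := by
    intro t ht j hj i hi
    exact (lt_iff_of_sign_eq (ht.sign h₃ (h.a_ne_c (by omega) le_rfl).symm
      (h.a_ne_c (by omega) le_rfl).symm (h.c_ne le_rfl hj.le (by omega)))).2
  refine controlled_of_simulation (B := bd a c b (l + 1) r) (B' := bd a c b l r)
    ((hc.root ht.nd f g).wf hsp) (fun y hy => h.inner_mem hV hy)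
    (fun π => Chains.simulation_cut (d' := ⟨a, c, f', g'⟩) π
      (hc.root ht.nd f g).inj rfl rfl (fun i hi => ?_) (fun j hj => ?_) (fun j hj => ?_))
    ⟨Chains.within_root _ r, Nat.zero_le _, by simp⟩ (hc.triOf_eq ht.nd hsp)
    (hc'.triOf_eq ht'.nd hsp') (bd_cut a c b l r)
  · refine eq_of_lt_iff (hsp'.f_le i hi) (hsp.f_le i (by omega)) fun j hj => ?_
    rw [hsp'.f_iff i hi j hj, hsp.f_iff i (by omega) j hj]
    exact (hfs ht' i hi j hj).trans (hfs ht i hi j hj).symm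
  · have hgl : g j ≤ l := by
      by_contra hlt
      have := (hgs ht j hj l (by omega)).1 ((hsp.g_iff j hj l (by omega)).1 (not_le.1 hlt))
      have hle := h.bridge.2.2.2.2 (c j) (Or.inr (h.c_mem hj.le))
      rw [(lt_iff_of_sign_eq (det_collinear hal hac h0 (p (c j) t₀)).1).2] at this
      linarith
    refine eq_of_lt_iff (hsp'.g_le j hj) hgl fun i hi => ?_
    rw [hsp'.g_iff j hj i hi, hsp.g_iff j hj i (by omega)]
    exact (hgs ht' j hj i (by omega)).trans (hgs ht j hj i (by omega)).symm
  · by_contra hlt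
    have := (hgs ht j hj l (by omega)).1 ((hsp.g_iff j hj l (by omega)).1 (not_le.1 hlt))
    have hle := h.bridge.2.2.2.2 (c j) (Or.inr (h.c_mem hj.le))
    rw [(lt_iff_of_sign_eq (det_collinear hal hac h0 (p (c j) t₀)).1).2] at this
    linarith

/-- The funnel degenerates to a segment and vanishes. -/
theorem controlled_vanish {t t' : ℝ} (h₀ : Critical p t₀ T) (ht : Near p t₀ T t)
    (ht' : Near p t₀ T t') (hs : Sides p t₀ SL SR b) {u v : Fin n} (h : BridgeOf p t₀ SL SR b u v)
    (h₁ : u ∈ T) (h₂ : b ∈ T) (h₃ : v ∈ T) (h0 : det (p u t₀) (p v t₀) (p b t₀) = 0)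
    (hneg : det (p u t) (p v t) (p b t) < 0) (hpos : 0 < det (p u t') (p v t') (p b t')) :
    Controlled V (triOf p t SL SR b) (triOf p t' SL SR b) := by
  have hub := h.2.2.1
  have hbv := h.2.2.2.1
  have hne : ∀ {x y : Fin n}, (p x t₀).1 < (p y t₀).1 → x ≠ y := by
    rintro x y hlt rfl; exact lt_irrefl _ hlt
  -- A bridge `u'v'` other than `uv` would already be on or above `b` at time `t₀`. But `b` is then
  -- on the line `uv`, which is above everything, so `u'` or `v'` would be on this line too, giving
  -- a second collinear triple. The segment `uv` itself is below `b` at time `t'`.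
  have hno : ∀ u' v', ¬ BridgeOf p t' SL SR b u' v' := by
    rintro u' v' ⟨b₁, b₂, b₃, b₄, b₅⟩
    have hb' := b₅ b (Or.inl hs.apex_left)
    rw [ht'.lt_iff] at b₃ b₄
    have key := det_interpolation (p u t₀) (p v t₀) (p u' t₀) (p b t₀) (p v' t₀)
    rw [h0, mul_zero] at key
    have m₁ := h.2.2.2.2 u' (Or.inl b₁)
    have m₂ := h.2.2.2.2 v' (Or.inr b₂)
    have m₃ := mul_nonpos_of_nonneg_of_nonpos (sub_pos.2 b₄).le m₁
    have m₄ := mul_nonpos_of_nonneg_of_nonpos (sub_pos.2 b₃).le m₂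
    by_cases hu : u = u'
    · by_cases hv : v = v'
      · subst hu hv; linarith
      · have m₅ := (le_iff_of_sign_eq (ht'.sign h₃ (hne (b₃.trans hbv)).symm hv (hne hbv).symm)).1.1 hb'
        have m₆ := mul_nonpos_of_nonneg_of_nonpos (sub_pos.2 (hub.trans hbv)).le m₅
        have z : (p b t₀).1 - (p u' t₀).1 ≠ 0 := (sub_pos.2 b₃).ne'
        rcases mul_eq_zero.1 (by linarith :
          ((p b t₀).1 - (p u' t₀).1) * det (p u t₀) (p v t₀) (p v' t₀) = 0) with e | e
        · exact z e
        · exact h₀.det_ne h₂ (hne hub).symm (hne hbv) (hne b₄) (hne (hub.trans hbv)) hv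
            (hne (hub.trans b₄)) e
    · have m₅ := (le_iff_of_sign_eq (ht'.sign h₁ hu (hne (hub.trans b₄)) (hne hub))).1.1 hb'
      have m₆ := mul_nonpos_of_nonneg_of_nonpos (sub_pos.2 (hub.trans hbv)).le m₅
      have z : (p v' t₀).1 - (p b t₀).1 ≠ 0 := (sub_pos.2 b₄).ne'
      rcases mul_eq_zero.1 (by linarith :
        ((p v' t₀).1 - (p b t₀).1) * det (p u t₀) (p v t₀) (p u' t₀) = 0) with e | e
      · exact z e
      · exact h₀.det_ne h₂ (hne hub).symm (hne hbv) (hne b₃).symm (hne (hub.trans hbv))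
          (hne (b₃.trans hbv)).symm hu e
  have hempty : ∀ π, triOf p t' SL SR b π = ∅ := by
    intro π
    have : ∀ F, ¬ IsFunnelOf p t' SL SR b F := fun F ⟨u, v, hb, _⟩ => hno u v hb
    simp [triOf, this]
  obtain ⟨a, c, l, r, hc, rfl, rfl⟩ := exists_cfg hs h
  have hub' : det (p (a l) t₀) (p b t₀) (p (c r) t₀) = 0 := by rw [det_swap_right, h0, neg_zero]
  have hcol := fun z => det_collinear hub hbv hub' (p z t₀)
  -- Another vertex `a 0` of the left chain would be on or above the segment from `a l` to `b`, but
  -- not above the bridge line, which contains this segment at time `t₀`; this is a second collinear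
  -- triple.
  have hl : l = 0 := by
    by_contra hl
    have hlt := h.2.2.2.2 (a 0) (Or.inl (hc.a_mem (Nat.zero_le _)))
    rw [← (le_iff_of_sign_eq (hcol _).1).1] at hlt
    have hhull := (hc.a_hull (Nat.zero_le l)).2 (a l) (hc.a_mem le_rfl) b hs.apex_left hub
      (hc.a_lt 0 l (by omega) le_rfl).le (hc.a_lt_apex 0 (Nat.zero_le _)).le
    exact h₀.det_ne h₃ (hne (hub.trans hbv)).symm (hne hbv).symm
      (hc.a_ne_c (Nat.zero_le _) le_rfl).symm (hne hub) (hc.a_ne_apex (Nat.zero_le _)).symm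
      (hc.a_ne le_rfl (Nat.zero_le _) hl) (le_antisymm hlt hhull)
  have hr : r = 0 := by
    by_contra hr
    have hlt := h.2.2.2.2 (c 0) (Or.inr (hc.c_mem (Nat.zero_le _)))
    rw [← (le_iff_of_sign_eq (hcol _).2).1] at hlt
    have hhull := (hc.c_hull (Nat.zero_le r)).2 b hs.apex_right (c r) (hc.c_mem le_rfl) hbv
      (hc.apex_lt_c 0 (Nat.zero_le _)).le (hc.c_lt 0 r (by omega) le_rfl).le
    exact h₀.det_ne h₁ (hne hub) (hne (hub.trans hbv))
      (hc.a_ne_c le_rfl (Nat.zero_le _)) (hne hbv) (hc.c_ne le_rfl (Nat.zero_le _) hr)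
      (hc.c_ne_apex (Nat.zero_le _)).symm (le_antisymm hlt hhull)
  subst hl hr
  have hct : Cfg p t SL SR b a c 0 0 := by
    refine hc.persists ht.lt_iff (fun z => ht.onUpperHull_iff h₃ (hs.c_notMem hc le_rfl))
      (fun z => ht.onUpperHull_iff h₁ (hs.a_notMem hc le_rfl)) fun z hz => ?_
    by_cases hzb : z = b
    · rw [hzb]; exact hneg.le
    · exact (le_iff_of_sign_eq (ht.sign h₂ (hne hub).symm (hne hbv)
        (Ne.symm hzb))).1.2 (hc.bridge.2.2.2.2 z hz)
  obtain ⟨f, g, hsp⟩ := Chains.Root.exists_tangentSpec (hct.root ht.nd)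
  left
  intro π
  have hno : ∀ x, ¬ Chains.Inner ⟨a, c, f, g⟩ ⟨0, 0, 0, 0⟩ x := by
    rintro x (⟨i, -, hi, -⟩ | ⟨i, -, hi, -⟩) <;> simp at hi
  rw [hempty, hct.triOf_eq ht.nd hsp, Chains.edges_of_not_inner hno]
  refine ncard_le_three_of_subset (x := s(a 0, b)) (y := s(b, c 0)) (z := s(a 0, c 0)) ?_
  intro e he
  simp only [Set.union_empty, Set.mem_symmDiff, Set.mem_empty_iff_false, not_false_eq_true,
    and_true, false_and, or_false] at he
  rcases he with ⟨i, hi, -⟩ | rfl | rfl | ⟨j, hj, -⟩ | rfl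
  · omega
  · simp
  · simp
  · omega
  · simp

end Critical

/-! ### Passing a critical time: a chain loses or gains a vertex -/

section Deletion

/-- The hull condition concerns triples sorted by `x`-coordinate. Among these the critical triple
occurs in one arrangement only, with `q` as the point that is tested. -/
theorem sorted_triple {α : Type*} {x : α → ℝ} {i q k j z m : α} (h₁ : x i < x q) (h₂ : x q < x k)
    (h₃ : x j < x z) (h₄ : x z < x m) :
    (j = i ∧ z = q ∧ m = k) ∨
      ∃ w, (w = i ∨ w = q ∨ w = k) ∧ w ≠ j ∧ w ≠ z ∧ w ≠ m := by
  by_contra! h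
  obtain ⟨h, h'⟩ := h
  have hi := h' i (Or.inl rfl)
  have hq := h' q (Or.inr (Or.inl rfl))
  have hk := h' k (Or.inr (Or.inr rfl))
  by_cases e₁ : i = j
  · by_cases e₂ : q = z
    · by_cases e₃ : k = m
      · exact h e₁.symm e₂.symm e₃.symm
      · have e := hk (by rintro rfl; subst e₁; linarith) (by rintro rfl; subst e₂; linarith)
        exact e₃ e
    · obtain rfl := hq (by rintro rfl; subst e₁; linarith) e₂
      by_cases e₃ : k = z
      · subst e₃; linarith
      · obtain rfl := hk (by rintro rfl; subst e₁; linarith) e₃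
        linarith
  · by_cases e₂ : i = z
    · by_cases e₃ : q = j
      · subst e₂ e₃; linarith
      · obtain rfl := hq e₃ (by rintro rfl; subst e₂; linarith)
        obtain rfl := hk (by rintro rfl; linarith) (by rintro rfl; linarith)
        linarith
    · obtain rfl := hi e₁ e₂
      by_cases e₃ : q = j
      · subst e₃; linarith
      · by_cases e₄ : q = z
        · subst e₄; linarith
        · have e := hq e₃ e₄
          rw [e] at h₁; linarith

variable {n : ℕ} {p : Fin n → ℝ → ℝ × ℝ} {t₀ : ℝ} {T : Set (Fin n)}
variable {SL SR V : Set (Fin n)} {b : Fin n} {a c : ℕ → Fin n} {l r : ℕ}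

/-- Only the middle point of a collinear triple can leave or enter the upper hull. -/
theorem Near.onUpperHull_iff_of_ne {t : ℝ} (ht : Near p t₀ T t)
    (hinj : Function.Injective fun i => (p i t₀).1) {i q k : Fin n} (hi : i ∈ T)
    (hq : q ∈ T) (hk : k ∈ T) (hiq : (p i t₀).1 < (p q t₀).1) (hqk : (p q t₀).1 < (p k t₀).1)
    (h0 : det (p i t₀) (p q t₀) (p k t₀) = 0) {S : Set (Fin n)} {z : Fin n}
    (hz : z ≠ q ∨ det (p i t) (p q t) (p k t) ≤ 0) :
    OnUpperHull p t S z ↔ OnUpperHull p t₀ S z := by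
  refine and_congr_right fun _ => forall₂_congr fun j _ => forall₂_congr fun m _ => ?_
  rw [ht.lt_iff, ht.le_iff, ht.le_iff]
  refine forall_congr' fun hjm => forall_congr' fun hjz => forall_congr' fun hzm => ?_
  rcases hjz.eq_or_lt with e | hjz'
  · obtain rfl : j = z := hinj e
    rw [det_self_left, det_self_left]
  rcases hzm.eq_or_lt with e | hzm'
  · obtain rfl : z = m := hinj e
    rw [det_self_right, det_self_right]
  rcases sorted_triple (x := fun i => (p i t₀).1) hiq hqk hjz' hzm' with
    ⟨rfl, rfl, rfl⟩ | ⟨w, hw, w₁, w₂, w₃⟩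
  · have h := hz.resolve_left (fun h => h rfl)
    rw [det_swap_right, det_swap_right (p j t₀), h0]
    constructor
    · intro _; simp
    · intro _; linarith
  · have hwT : w ∈ T := by rcases hw with rfl | rfl | rfl <;> assumption
    exact (le_iff_of_sign_eq (ht.sign hwT w₁ w₃ w₂)).2

/-- `k` is the neighbour of `a m` towards the apex, the apex itself if `m = 0`. The two edges at `a
m` are replaced by one. -/
theorem bd_delete (a c : ℕ → Fin n) (b : Fin n) {l m : ℕ} (r : ℕ) (hm : m ≤ l) {k : Fin n}
    (hk : (m = 0 ∧ k = b) ∨ (0 < m ∧ k = a (m - 1))) :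
    (symmDiff (bd a c b (l + 1) r)
      (bd (fun i => a (if i < m then i else i + 1)) c b l r)).ncard ≤ 3 := by
  refine ncard_le_three_of_subset (x := s(a (m + 1), a m)) (y := s(a m, k))
    (z := s(a (m + 1), k)) fun e he => ?_
  simp only [Set.mem_insert_iff, Set.mem_singleton_iff]
  rcases he with ⟨he, hn⟩ | ⟨he, hn⟩
  · rcases he with ⟨i, hi, rfl⟩ | rfl | he | he | rfl
    · by_cases h₁ : i = m
      · subst h₁; exact Or.inl rfl
      by_cases h₂ : i + 1 = m
      · subst h₂
        obtain ⟨-, rfl⟩ := hk.resolve_left (by omega)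
        exact Or.inr (Or.inl rfl)
      refine (hn (Or.inl ?_)).elim
      by_cases h₃ : i < m
      · exact ⟨i, by omega, by simp only [h₃, (by omega : i + 1 < m), if_true]⟩
      · refine ⟨i - 1, by omega, ?_⟩
        simp only [if_neg (by omega : ¬ i - 1 < m),
          (by omega : i - 1 + 1 = i)]
        rw [if_neg h₃]
    · rcases hk with ⟨rfl, rfl⟩ | ⟨hm0, -⟩
      · exact Or.inr (Or.inl rfl)
      · exact (hn (Or.inr (Or.inl (by simp only [hm0, if_true])))).elim
    · exact (hn (Or.inr (Or.inr (Or.inl he)))).elim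
    · exact (hn (Or.inr (Or.inr (Or.inr (Or.inl he))))).elim
    · exact (hn (Or.inr (Or.inr (Or.inr (Or.inr (by simp only [not_lt.2 hm, if_false])))))).elim
  · rcases he with ⟨i, hi, rfl⟩ | rfl | he | he | rfl
    · by_cases h₂ : i + 1 = m
      · subst h₂
        obtain ⟨-, rfl⟩ := hk.resolve_left (by omega)
        right; right
        simp
      refine (hn (Or.inl ?_)).elim
      by_cases h₃ : i < m
      · exact ⟨i, by omega, by simp only [h₃, (by omega : i + 1 < m), if_true]⟩
      · exact ⟨i + 1, by omega, by
          simp only [if_neg h₃, if_neg (by omega : ¬ i + 1 < m)]⟩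
    · rcases hk with ⟨rfl, rfl⟩ | ⟨hm0, -⟩
      · exact Or.inr (Or.inr (by simp))
      · exact (hn (Or.inr (Or.inl (by simp only [hm0, if_true])))).elim
    · exact (hn (Or.inr (Or.inr (Or.inl he)))).elim
    · exact (hn (Or.inr (Or.inr (Or.inr (Or.inl he))))).elim
    · exact (hn (Or.inr (Or.inr (Or.inr (Or.inr (by simp only [not_lt.2 hm, if_false])))))).elim

/-- The configuration in which a vertex of the left chain has left the upper hull. -/
theorem Cfg.delete {t' : ℝ} {m : ℕ} (h : Cfg p t₀ SL SR b a c (l + 1) r) (hm : m ≤ l)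
    (hlt : ∀ i j, (p i t').1 < (p j t').1 ↔ (p i t₀).1 < (p j t₀).1)
    (hL : ∀ z, OnUpperHull p t' SL z ↔ OnUpperHull p t₀ SL z ∧ z ≠ a m)
    (hR : ∀ z, OnUpperHull p t' SR z ↔ OnUpperHull p t₀ SR z)
    (hb : ∀ i, i ∈ SL ∨ i ∈ SR → det (p (a (l + 1)) t') (p (c r) t') (p i t') ≤ 0) :
    Cfg p t' SL SR b (fun i => a (if i < m then i else i + 1)) c l r := by
  have hml : (if l < m then l else l + 1) = l + 1 := if_neg (not_lt.2 hm)
  have hsh : ∀ i ≤ l, (if i < m then i else i + 1) ≤ l + 1 := fun i hi => by split_ifs <;> omega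
  refine ⟨⟨?_, h.bridge.2.1, ?_, (hlt _ _).2 h.bridge.2.2.2.1, ?_⟩, fun i i' h₁ h₂ => ?_,
    fun i hi => (hlt _ _).2 (h.a_lt_apex _ (hsh i hi)),
    fun i i' h₁ h₂ => (hlt _ _).2 (h.c_lt i i' h₁ h₂), fun i hi => (hlt _ _).2 (h.apex_lt_c i hi),
    fun z => ?_, fun z => ?_⟩
  · exact h.a_mem (hsh l le_rfl)
  · exact (hlt _ _).2 (h.a_lt_apex _ (hsh l le_rfl))
  · simp only [hml]; exact hb
  · refine (hlt _ _).2 (h.a_lt _ _ ?_ (hsh i' h₂))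
    split_ifs <;> omega
  · simp only [hml]
    rw [hL, ← not_lt, hlt, not_lt, and_right_comm, h.left_iff]
    constructor
    · rintro ⟨rfl | ⟨i, hi, rfl⟩, hne⟩
      · exact Or.inl rfl
      · have him : i ≠ m := fun e => hne (by rw [e])
        by_cases hlt : i < m
        · exact Or.inr ⟨i, by omega, by simp [hlt]⟩
        · refine Or.inr ⟨i - 1, by omega, ?_⟩
          rw [if_neg (by omega), (by omega : i - 1 + 1 = i)]
    · rintro (rfl | ⟨i, hi, rfl⟩)
      · exact ⟨Or.inl rfl, (h.a_ne_apex (by omega)).symm⟩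
      · refine ⟨Or.inr ⟨_, hsh i hi, rfl⟩, h.a_ne (hsh i hi) (by omega) ?_⟩
        split_ifs <;> omega
  · rw [hR, ← not_lt, hlt, not_lt]; exact h.right_iff z

/-- A vertex of the left chain leaves the upper hull. -/
theorem controlled_delete {t t' : ℝ} (ht : Near p t₀ T t) (ht' : Near p t₀ T t')
    (hs : Sides p t₀ SL SR b) (hV : Interior p t₀ SL SR b V) (h : Cfg p t₀ SL SR b a c (l + 1) r)
    {m : ℕ} (hm : m ≤ l) {k : Fin n} (hk : (m = 0 ∧ k = b) ∨ (0 < m ∧ k = a (m - 1)))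
    (h₁ : a (m + 1) ∈ T) (h₂ : a m ∈ T) (h₃ : k ∈ T)
    (h0 : det (p (a (m + 1)) t₀) (p (a m) t₀) (p k t₀) = 0)
    (hneg : det (p (a (m + 1)) t) (p (a m) t) (p k t) < 0)
    (hpos : 0 < det (p (a (m + 1)) t') (p (a m) t') (p k t')) :
    Controlled V (triOf p t SL SR b) (triOf p t' SL SR b) := by
  have hiq : (p (a (m + 1)) t₀).1 < (p (a m) t₀).1 := h.a_lt _ _ (by omega) (by omega)
  have hqk : (p (a m) t₀).1 < (p k t₀).1 := by
    rcases hk with ⟨-, rfl⟩ | ⟨hm0, rfl⟩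
    · exact h.a_lt_apex _ (by omega)
    · exact h.a_lt _ _ (by omega) (by omega)
  have hkL : k ∈ SL := by
    rcases hk with ⟨-, rfl⟩ | ⟨hm0, rfl⟩
    · exact hs.apex_left
    · exact h.a_mem (by omega)
  have hkc : ∀ j ≤ r, k ≠ c j := by
    rcases hk with ⟨-, rfl⟩ | ⟨hm0, rfl⟩
    · exact fun j hj => (h.c_ne_apex hj).symm
    · exact fun j hj => h.a_ne_c (by omega) hj
  have hka : ∀ i, m ≤ i → i ≤ l + 1 → k ≠ a i := by
    rcases hk with ⟨-, rfl⟩ | ⟨hm0, rfl⟩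
    · exact fun i _ hi => (h.a_ne_apex hi).symm
    · exact fun i hi hi' => h.a_ne (by omega) hi' (by omega)
  have hR : ∀ {t}, Near p t₀ T t → ∀ z, OnUpperHull p t SR z ↔ OnUpperHull p t₀ SR z :=
    fun ht z => ht.onUpperHull_iff h₂ (hs.a_notMem h (by omega))
  -- The bridge does not move: a triple with both bridge endpoints misses `k` if its third point is
  -- `a m`, and otherwise it misses `a m`.
  have hB : ∀ {t}, Near p t₀ T t → ∀ z, z ∈ SL ∨ z ∈ SR →
      det (p (a (l + 1)) t) (p (c r) t) (p z t) ≤ 0 := by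
    intro t ht z hz
    refine (le_iff_of_sign_eq ?_).1.2 (h.bridge.2.2.2.2 z hz)
    by_cases hzq : z = a m
    · exact ht.sign h₃ (hka _ (by omega) le_rfl) (hkc r le_rfl) (hzq ▸ hka m le_rfl (by omega))
    · exact ht.sign h₂ (h.a_ne (by omega) le_rfl (by omega)) (h.a_ne_c (by omega) le_rfl)
        (Ne.symm hzq)
  have hc : Cfg p t SL SR b a c (l + 1) r := h.persists ht.lt_iff
    (fun z => ht.onUpperHull_iff_of_ne hs.fst_inj h₁ h₂ h₃ hiq hqk h0 (Or.inr hneg.le)) (hR ht)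
    (hB ht)
  have hc' : Cfg p t' SL SR b (fun i => a (if i < m then i else i + 1)) c l r := by
    refine h.delete hm ht'.lt_iff (fun z => ?_) (hR ht') (hB ht')
    by_cases hzq : z = a m
    · refine iff_of_false (fun hz => ?_) fun hz => hz.2 hzq
      subst hzq
      have := hz.2 _ (h.a_mem (by omega : m + 1 ≤ l + 1)) k hkL ((ht'.lt_iff _ _).2 (hiq.trans hqk))
        ((ht'.lt_iff _ _).2 hiq).le ((ht'.lt_iff _ _).2 hqk).le
      rw [det_swap_right] at this
      linarith
    · rw [ht'.onUpperHull_iff_of_ne hs.fst_inj h₁ h₂ h₃ hiq hqk h0 (Or.inl hzq)]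
      exact (and_iff_left hzq).symm
  obtain ⟨f, g, hsp⟩ := Chains.Root.exists_tangentSpec (hc.root ht.nd)
  obtain ⟨f', g', hsp'⟩ := Chains.Root.exists_tangentSpec (hc'.root ht'.nd)
  have hcol := fun z => det_collinear hiq hqk h0 (p z t₀)
  have hfs : ∀ {t}, Near p t₀ T t → ∀ i ≤ l + 1, i ≠ m → ∀ j < r,
      (0 < det (p (a i) t) (p (c j) t) (p (c (j + 1)) t) ↔
        0 < det (p (a i) t₀) (p (c j) t₀) (p (c (j + 1)) t₀)) := by
    intro t ht i hi him j hj
    exact (lt_iff_of_sign_eq (ht.sign h₂ (h.a_ne (by omega) hi (Ne.symm him))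
        (h.a_ne_c (by omega) hj.le) (h.a_ne_c (by omega) hj))).2
  have hgs : ∀ {t}, Near p t₀ T t → ∀ j ≤ r, ∀ i ≤ l + 1, i ≠ m → ∀ i' ≤ l + 1, i' ≠ m →
      (0 < det (p (a i) t) (p (a i') t) (p (c j) t) ↔
        0 < det (p (a i) t₀) (p (a i') t₀) (p (c j) t₀)) := by
    intro t ht j hj i hi him i' hi' him'
    exact (lt_iff_of_sign_eq (ht.sign h₂ (h.a_ne (by omega) hi (Ne.symm him))
      (h.a_ne (by omega) hi' (Ne.symm him')) (h.a_ne_c (by omega) hj))).2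
  have hG : ∀ j < r, ∀ i < l + 1, (i < g j ↔ 0 < det (p (a (i + 1)) t₀) (p (a i) t₀) (p (c j) t₀)) := by
    intro j hj i hi
    rw [hsp.g_iff j hj i hi]
    by_cases e₁ : i = m
    · subst e₁
      exact (lt_iff_of_sign_eq (ht.sign h₃ (hka _ (by omega) (by omega)) (hka _ le_rfl (by omega))
        (hkc j hj.le))).2
    by_cases e₂ : i + 1 = m
    · exact (lt_iff_of_sign_eq (ht.sign h₁ (h.a_ne (by omega) (by omega) (by omega))
        (h.a_ne (by omega) (by omega) (by omega)) (h.a_ne_c (by omega) hj.le))).2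
    · exact hgs ht j hj.le _ (by omega) e₂ _ (by omega) e₁
  -- At time `t₀` the two edges at `a m` span the same line, so `c j` is above both or above
  -- neither. With `hD₂` this shows that no tangent ends at `a m`.
  have hD₁ : ∀ j < r, (m < g j ↔ 0 < det (p (a (m + 1)) t₀) (p k t₀) (p (c j) t₀)) := by
    intro j hj
    rw [hG j hj m (by omega)]
    exact (lt_iff_of_sign_eq (hcol _).1).2
  have hD₂ : 0 < m → ∀ j < r, (m - 1 < g j ↔ 0 < det (p (a (m + 1)) t₀) (p k t₀) (p (c j) t₀)) := by
    intro hm0 j hj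
    obtain ⟨-, rfl⟩ := hk.resolve_left (by omega)
    rw [hG j hj (m - 1) (by omega), Nat.sub_add_cancel hm0]
    exact (lt_iff_of_sign_eq (hcol _).2).2
  -- If `k` is the apex, there is no edge of the enumeration below `a 0`. Instead, `c r` is above
  -- the line from `a 0` to the apex, and by concavity of the right chain so is every `c j`.
  have hD₀ : m = 0 → ∀ j < r, 0 < g j := by
    rintro rfl j hj
    obtain ⟨-, rfl⟩ := hk.resolve_right (by omega)
    rw [hD₁ j hj, ← (lt_iff_of_sign_eq (hcol _).2).2,
      ← (lt_iff_of_sign_eq (ht.sign h₁ (h.a_ne (by omega) (by omega) (by omega))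
        (h.a_ne_apex (by omega)) (h.a_ne_c (by omega) hj.le))).2]
    have hr := hc.root ht.nd f g
    have ho := hr.good.o_mem_left
    have e₁ := hr.good.det_v_neg (q := a 0) (z := k) (hr.a_mem (i := 0) (by omega))
      (h.a_ne (by omega) le_rfl (by omega)) ho (hc.a_lt_apex 0 (by omega))
    rw [det_swap_right] at e₁
    have e₂ := hr.good.concave_right _ hr.good.o_mem_right _ (hr.c_mem (j := j) hj.le) _
      (hr.c_mem (j := r) le_rfl) (hc.apex_lt_c j hj.le) (hc.c_lt j r hj le_rfl)
    simp only at e₁ e₂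
    rw [det_swap_right] at e₂
    have key := det_interpolation (p (a 0) t) (p k t) (p k t) (p (c j) t) (p (c r) t)
    rw [det_self_right, mul_zero, zero_add] at key
    have m₁ := mul_pos (sub_pos.2 (hc.apex_lt_c j hj.le)) (neg_lt_zero.1 e₁)
    have m₂ := mul_pos (sub_pos.2 (hc.a_lt_apex 0 (by omega))) (neg_lt_zero.1 e₂)
    exact pos_of_mul_pos_right (key ▸ add_pos m₁ m₂) (sub_pos.2 (hc.apex_lt_c r le_rfl)).le
  refine controlled_of_simulation (B := bd a c b (l + 1) r)
    (B' := bd (fun i => a (if i < m then i else i + 1)) c b l r)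
    ((hc.root ht.nd f g).wf hsp) (fun y hy => h.inner_mem hV hy)
    (fun π => Chains.simulation_delete
      (d' := ⟨fun i => a (if i < m then i else i + 1), c, f', g'⟩) (p := m) π
      ((hc.root ht.nd f g).wf hsp) hm (fun i => rfl) rfl (fun i hi => ?_) (fun j hj => ⟨?_, ?_⟩))
    ⟨Chains.within_root _ r, ?_, rfl, rfl, ?_⟩ (hc.triOf_eq ht.nd hsp)
    (hc'.triOf_eq ht'.nd hsp') (bd_delete a c b r hm hk)
  · have hsl : (if i < m then i else i + 1) ≤ l := by split_ifs <;> omega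
    have hsm : (if i < m then i else i + 1) ≠ m := by split_ifs <;> omega
    refine eq_of_lt_iff (hsp'.f_le i hi) (hsp.f_le _ (by omega)) fun j hj => ?_
    rw [hsp'.f_iff i hi j hj, hsp.f_iff _ (by omega) j hj]
    exact (hfs ht' _ (by omega) hsm j hj).trans (hfs ht _ (by omega) hsm j hj).symm
  · intro hgm
    simp only at hgm
    rcases Nat.eq_zero_or_pos m with hm0 | hm0
    · have := hD₀ hm0 j hj; omega
    · have := (hD₁ j hj).2 ((hD₂ hm0 j hj).1 (by omega)); omega
  · simp only
    have hgl := hsp.g_le j hj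
    simp only at hgl
    refine eq_of_lt_iff (hsp'.g_le j hj) (by split_ifs <;> omega) fun i hi => ?_
    rw [hsp'.g_iff j hj i hi]
    simp only
    by_cases e₁ : i + 1 < m
    · simp only [e₁, (by omega : i < m), if_true]
      rw [hgs ht' j hj.le _ (by omega) (by omega) _ (by omega) (by omega), ← hG j hj i (by omega)]
      split_ifs <;> omega
    by_cases e₂ : i + 1 = m
    · subst e₂
      simp only [lt_irrefl, Nat.lt_succ_self, if_true, if_false]
      rw [hgs ht' j hj.le _ (by omega) (by omega) _ (by omega) (by omega)]
      have d₁ := hD₁ j hj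
      have d₂ := hD₂ (by omega) j hj
      obtain ⟨-, rfl⟩ := hk.resolve_left (by omega)
      simp only [Nat.add_sub_cancel] at d₁ d₂
      rw [← d₁] at d₂ ⊢
      split_ifs <;> omega
    · simp only [if_neg e₁, if_neg (by omega : ¬ i < m)]
      rw [hgs ht' j hj.le _ (by omega) (by omega) _ (by omega) (by omega),
        ← hG j hj (i + 1) (by omega)]
      rcases Nat.eq_zero_or_pos m with hm0 | hm0
      · have := hD₀ hm0 j hj
        split_ifs <;> omega
      · have d₁ := hD₁ j hj
        have d₂ := hD₂ hm0 j hj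
        rw [← d₁] at d₂
        split_ifs <;> omega
  · exact ⟨fun _ _ _ => Nat.zero_le _, fun _ _ _ => Nat.zero_le _⟩
  · exact Or.inr (Or.inl ⟨Nat.zero_le _, by simp only; omega, rfl, rfl⟩)

end Deletion

/-! ### Envelope and visibility events -/

section Events

theorem exists_missing_or_perm {α : Type*} {A B C : α} (hAB : A ≠ B) (hBC : B ≠ C) (hAC : A ≠ C)
    (i j k : α) :
    (∃ w, (w = A ∨ w = B ∨ w = C) ∧ w ≠ i ∧ w ≠ j ∧ w ≠ k) ∨
      (i = A ∧ j = B ∧ k = C) ∨ (i = A ∧ j = C ∧ k = B) ∨ (i = B ∧ j = A ∧ k = C) ∨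
      (i = B ∧ j = C ∧ k = A) ∨ (i = C ∧ j = A ∧ k = B) ∨ (i = C ∧ j = B ∧ k = A) := by
  by_contra! h
  obtain ⟨h, h'⟩ := h
  have key : ∀ w, w = A ∨ w = B ∨ w = C → w = i ∨ w = j ∨ w = k := fun w hw => by
    by_cases h₁ : w = i
    · exact Or.inl h₁
    by_cases h₂ : w = j
    · exact Or.inr (Or.inl h₂)
    exact Or.inr (Or.inr (h w hw h₁ h₂))
  clear h
  rcases key A (Or.inl rfl) with hA | hA | hA <;>
    rcases key B (Or.inr (Or.inl rfl)) with hB | hB | hB <;>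
    rcases key C (Or.inr (Or.inr rfl)) with hC | hC | hC <;> grind

variable {n : ℕ} {p : Fin n → ℝ → ℝ × ℝ} {t₀ t t' : ℝ} {T : Set (Fin n)}
variable {SL SR V : Set (Fin n)} {b u v i q k : Fin n}

theorem Sides.near (hs : Sides p t₀ SL SR b) (ht : Near p t₀ T t) : Sides p t SL SR b where
  apex_left := hs.apex_left
  apex_right := hs.apex_right
  left := fun i hi => (hs.left i hi).imp_right (ht.lt_iff _ _).2
  right := fun i hi => (hs.right i hi).imp_right (ht.lt_iff _ _).2
  fst_inj := fun i j e => by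
    by_contra hne
    exact ht.nd.fst_ne hne e

/-- If the critical triple has the same orientation at two times, so have all triples. -/
theorem Near.sign_eq (ht : Near p t₀ T t) (ht' : Near p t₀ T t') {A B C : Fin n} (hA : A ∈ T)
    (hB : B ∈ T) (hC : C ∈ T) (hAB : A ≠ B) (hBC : B ≠ C) (hAC : A ≠ C)
    (h : SignType.sign (det (p A t') (p B t') (p C t')) =
      SignType.sign (det (p A t) (p B t) (p C t))) (i j k : Fin n) :
    SignType.sign (det (p i t') (p j t') (p k t')) =
      SignType.sign (det (p i t) (p j t) (p k t)) := by
  rcases exists_missing_or_perm hAB hBC hAC i j k with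
    ⟨w, hw, h₁, h₂, h₃⟩ | ⟨rfl, rfl, rfl⟩ | ⟨rfl, rfl, rfl⟩ | ⟨rfl, rfl, rfl⟩ | ⟨rfl, rfl, rfl⟩ |
    ⟨rfl, rfl, rfl⟩ | ⟨rfl, rfl, rfl⟩
  · have hwT : w ∈ T := by rcases hw with rfl | rfl | rfl <;> assumption
    rw [ht.sign hwT h₁ h₂ h₃, ht'.sign hwT h₁ h₂ h₃]
  · exact h
  · rw [det_swap_right, det_swap_right (p i t), Left.sign_neg, Left.sign_neg, h]
  · rw [det_swap_left, det_swap_left (p i t), Left.sign_neg, Left.sign_neg, h]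
  · rw [← det_rotate, ← det_rotate (p k t), h]
  · rw [det_rotate, det_rotate (p i t), h]
  · rw [det_swap_ends, det_swap_ends (p i t), Left.sign_neg, Left.sign_neg, h]

/-- Only an orientation change of the critical triple matters. -/
theorem controlled_of_opposite (ht : Near p t₀ T t) (ht' : Near p t₀ T t')
    (hs : Sides p t₀ SL SR b) {A B C : Fin n} (hA : A ∈ T) (hB : B ∈ T) (hC : C ∈ T) (hAB : A ≠ B)
    (hBC : B ≠ C) (hAC : A ≠ C)
    (H : ∀ {t t'}, Near p t₀ T t → Near p t₀ T t' → det (p A t) (p B t) (p C t) < 0 →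
      0 < det (p A t') (p B t') (p C t') → Controlled V (triOf p t SL SR b) (triOf p t' SL SR b)) :
    Controlled V (triOf p t SL SR b) (triOf p t' SL SR b) := by
  have same : SignType.sign (det (p A t') (p B t') (p C t')) =
      SignType.sign (det (p A t) (p B t) (p C t)) →
      Controlled V (triOf p t SL SR b) (triOf p t' SL SR b) := by
    intro h
    left
    intro π
    rw [triOf_eq_of_sign_eq ht.nd ht'.nd (hs.near ht)
      (fun i j => (ht'.lt_iff i j).trans (ht.lt_iff i j).symm)
      (ht.sign_eq ht' hA hB hC hAB hBC hAC h), symmDiff_self]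
    simp
  rcases lt_or_gt_of_ne (ht.nd.det_ne hAB hBC hAC) with h₁ | h₁ <;>
    rcases lt_or_gt_of_ne (ht'.nd.det_ne hAB hBC hAC) with h₂ | h₂
  · exact same (by rw [sign_neg h₁, sign_neg h₂])
  · exact H ht ht' h₁ h₂
  · exact (H ht' ht h₂ h₁).symm
  · exact same (by rw [sign_pos h₁, sign_pos h₂])

theorem ne_of_fst_lt {x y : Fin n} (h : (p x t).1 < (p y t).1) : x ≠ y := by
  rintro rfl; exact lt_irrefl _ h

/-- Collinear points of the upper hull are consecutive. -/
theorem Critical.no_hull_between (h₀ : Critical p t₀ T) {S : Set (Fin n)} (hq : q ∈ T)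
    (hi : OnUpperHull p t₀ S i) (hqS : OnUpperHull p t₀ S q) (hk : OnUpperHull p t₀ S k)
    (hiq : (p i t₀).1 < (p q t₀).1) (hqk : (p q t₀).1 < (p k t₀).1)
    (h0 : det (p i t₀) (p q t₀) (p k t₀) = 0) {z : Fin n} (hz : OnUpperHull p t₀ S z)
    (hiz : (p i t₀).1 < (p z t₀).1) (hzk : (p z t₀).1 < (p k t₀).1) : z = q := by
  by_contra hzq
  have hik := hiq.trans hqk
  -- A further hull point `z` would be strictly above the line through `i`, `q`, `k`, and then `q`
  -- would be strictly below the segment from `z` to `k` or from `i` to `z`.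
  have hpos : 0 < det (p i t₀) (p k t₀) (p z t₀) := lt_of_le_of_ne
    (hz.2 i hi.1 k hk.1 hik hiz.le hzk.le)
    (Ne.symm (h₀.det_ne hq (ne_of_fst_lt hiq).symm (ne_of_fst_lt hqk) (Ne.symm hzq)
      (ne_of_fst_lt hik) (ne_of_fst_lt hzk).symm (ne_of_fst_lt hiz)))
  have h0' : det (p i t₀) (p k t₀) (p q t₀) = 0 := by rw [det_swap_right, h0, neg_zero]
  rcases lt_or_ge (p z t₀).1 (p q t₀).1 with hlt | hge
  · have key := det_interpolation (p i t₀) (p k t₀) (p z t₀) (p q t₀) (p k t₀)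
    rw [h0', det_self_right] at key
    have m₁ := mul_pos (sub_pos.2 hqk) hpos
    have m₂ := mul_nonneg (sub_pos.2 hik).le (hqS.2 z hz.1 k hk.1 hzk hlt.le hqk.le)
    linarith
  · have hlt := lt_of_le_of_ne hge fun e => hzq (h₀.fst_inj e.symm)
    have key := det_interpolation (p i t₀) (p k t₀) (p i t₀) (p q t₀) (p z t₀)
    rw [h0', det_self_left] at key
    have m₁ := mul_pos (sub_pos.2 hiq) hpos
    have m₂ := mul_nonneg (sub_pos.2 hik).le (hqS.2 i hi.1 z hz.1 hiz hiq.le hlt.le)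
    linarith

/-- Three vertices of the left chain become collinear. -/
theorem controlled_envelope (h₀ : Critical p t₀ T) (ht : Near p t₀ T t) (ht' : Near p t₀ T t')
    (hs : Sides p t₀ SL SR b) (hV : Interior p t₀ SL SR b V) (hb : BridgeOf p t₀ SL SR b u v)
    (hiT : i ∈ T) (hqT : q ∈ T) (hkT : k ∈ T) (hi : OnUpperHull p t₀ SL i)
    (hq : OnUpperHull p t₀ SL q) (hk : OnUpperHull p t₀ SL k) (hui : (p u t₀).1 ≤ (p i t₀).1)
    (hiq : (p i t₀).1 < (p q t₀).1) (hqk : (p q t₀).1 < (p k t₀).1)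
    (h0 : det (p i t₀) (p q t₀) (p k t₀) = 0) :
    Controlled V (triOf p t SL SR b) (triOf p t' SL SR b) := by
  refine controlled_of_opposite ht ht' hs hiT hqT hkT (ne_of_fst_lt hiq) (ne_of_fst_lt hqk)
    (ne_of_fst_lt (hiq.trans hqk)) fun ht ht' hneg hpos => ?_
  obtain ⟨a, c, l, r, hc, rfl, rfl⟩ := exists_cfg hs hb
  have hkb : (p k t₀).1 ≤ (p b t₀).1 := by
    rcases hs.left k hk.1 with rfl | h
    · exact le_rfl
    · exact h.le
  have hbetween := fun z hz h₁ h₂ => h₀.no_hull_between (z := z) hqT hi hq hk hiq hqk h0 hz h₁ h₂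
  obtain ⟨m', hm', rfl⟩ := ((hc.left_iff i).1 ⟨hi, hui⟩).resolve_left
    (ne_of_fst_lt (hiq.trans (hqk.trans_le hkb)))
  obtain ⟨m, hm, rfl⟩ := ((hc.left_iff q).1 ⟨hq, hui.trans hiq.le⟩).resolve_left
    (ne_of_fst_lt (hqk.trans_le hkb))
  have hmono : ∀ {x y}, x ≤ l → y ≤ l → (p (a x) t₀).1 < (p (a y) t₀).1 → y < x := by
    intro x y hx hy hlt
    by_contra hle
    rcases (not_lt.1 hle).eq_or_lt with rfl | h
    · exact lt_irrefl _ hlt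
    · exact lt_asymm hlt (hc.a_lt _ _ h hy)
  have hmm := hmono hm' hm hiq
  -- No hull point other than `q` lies between `i` and `k`, so the three are consecutive on the
  -- chain and the event is the deletion of `a m`.
  obtain rfl : m' = m + 1 := by
    by_contra hne
    have := hbetween (a (m + 1)) (hc.a_hull (by omega)) (hc.a_lt _ _ (by omega) hm')
      ((hc.a_lt _ _ (by omega) (by omega)).trans hqk)
    exact hc.a_ne (by omega) hm (by omega) this
  obtain ⟨l, rfl⟩ : ∃ l', l = l' + 1 := ⟨l - 1, by omega⟩
  refine controlled_delete ht ht' hs hV hc (by omega : m ≤ l) ?_ hiT hqT hkT h0 hneg hpos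
  rcases (hc.left_iff k).1 ⟨hk, hui.trans (hiq.trans hqk).le⟩ with rfl | ⟨m'', hm'', rfl⟩
  · by_cases hm0 : m = 0
    · exact Or.inl ⟨hm0, rfl⟩
    · have := hbetween (a (m - 1)) (hc.a_hull (by omega))
        (hiq.trans (hc.a_lt _ _ (by omega) (by omega))) (hc.a_lt_apex _ (by omega))
      exact (hc.a_ne (by omega) hm (by omega) this).elim
  · have hlt := hmono hm hm'' hqk
    by_cases hmm' : m'' = m - 1
    · exact Or.inr ⟨by omega, by rw [hmm']⟩
    · have := hbetween (a (m - 1)) (hc.a_hull (by omega))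
        (hiq.trans (hc.a_lt _ _ (by omega) (by omega))) (hc.a_lt _ _ (by omega) (by omega))
      exact (hc.a_ne (by omega) hm (by omega) this).elim

theorem index_of_hullEdge {a c : ℕ → Fin n} {l r : ℕ} (hc : Cfg p t₀ SL SR b a c l r)
    (h : HullEdge p t₀ SL i k) (hui : (p (a l) t₀).1 ≤ (p i t₀).1)
    (hkb : (p k t₀).1 < (p b t₀).1) : ∃ m < l, a (m + 1) = i ∧ a m = k := by
  obtain ⟨hi, hk, hik, hno⟩ := h
  obtain ⟨m', hm', rfl⟩ := ((hc.left_iff i).1 ⟨hi, hui⟩).resolve_left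
    (ne_of_fst_lt (hik.trans hkb))
  obtain ⟨m, hm, rfl⟩ := ((hc.left_iff k).1 ⟨hk, hui.trans hik.le⟩).resolve_left
    (ne_of_fst_lt hkb)
  have hlt : m < m' := by
    by_contra hle
    rcases (not_lt.1 hle).eq_or_lt with rfl | h
    · exact lt_irrefl _ hik
    · exact lt_asymm hik (hc.a_lt _ _ h hm)
  refine ⟨m, by omega, ?_, rfl⟩
  by_contra hne
  have hne' : m + 1 ≠ m' := fun e => hne (by rw [e])
  exact hno (a (m + 1)) (hc.a_hull (by omega))
    ⟨hc.a_lt _ _ (by omega) hm', hc.a_lt _ _ (by omega) (by omega)⟩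

/-- The apex is collinear with an edge of the left upper hull. -/
theorem controlled_visibility_apex (h₀ : Critical p t₀ T) (ht : Near p t₀ T t)
    (ht' : Near p t₀ T t') (hs : Sides p t₀ SL SR b) (hV : Interior p t₀ SL SR b V)
    (hb : BridgeOf p t₀ SL SR b u v) (hiT : i ∈ T) (hkT : k ∈ T) (hbT : b ∈ T)
    (he : HullEdge p t₀ SL i k) (hkb : (p k t₀).1 < (p b t₀).1)
    (h0 : det (p i t₀) (p k t₀) (p b t₀) = 0) :
    Controlled V (triOf p t SL SR b) (triOf p t' SL SR b) := by
  have hub := hb.2.2.1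
  have huv := hub.trans hb.2.2.2.1
  refine controlled_envelope h₀ ht ht' hs hV hb hiT hkT hbT he.1 he.2.1 hs.onUpperHull_apex ?_
    he.2.2.1 hkb h0
  -- The event is an envelope event with middle point `k`, once the edge is shown to belong to the
  -- chain. If `u` were to the right of `i`, it would be `k`. Then `i` and `b`, which are on
  -- opposite sides of `u` on one line and not above `uv`, would both be on `uv`, giving a second
  -- collinear triple.
  by_contra hlt
  rw [not_le] at hlt
  obtain rfl := h₀.no_hull_between hkT he.1 he.2.1 hs.onUpperHull_apex he.2.2.1 hkb h0
    hb.onUpperHull hlt hub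
  have key := det_interpolation (p u t₀) (p v t₀) (p i t₀) (p u t₀) (p b t₀)
  rw [det_self_left, det_swap_right (p i t₀), h0] at key
  have e₁ := mul_nonpos_of_nonneg_of_nonpos (sub_pos.2 hub).le
    (hb.2.2.2.2 i (Or.inl he.1.1))
  have e₂ := mul_nonpos_of_nonneg_of_nonpos (sub_pos.2 hlt).le
    (hb.2.2.2.2 b (Or.inl hs.apex_left))
  rcases mul_eq_zero.1 (by linarith :
    ((p u t₀).1 - (p i t₀).1) * det (p u t₀) (p v t₀) (p b t₀) = 0) with e | e
  · linarith
  · exact h₀.det_ne hiT (ne_of_fst_lt hlt) (ne_of_fst_lt (hlt.trans huv))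
      (ne_of_fst_lt (hlt.trans hub)) (ne_of_fst_lt huv) (ne_of_fst_lt hb.2.2.2.1).symm
      (ne_of_fst_lt hub) e

/-- The right endpoint of the bridge is collinear with an edge of the left upper hull. -/
theorem controlled_visibility_base (h₀ : Critical p t₀ T) (ht : Near p t₀ T t)
    (ht' : Near p t₀ T t') (hs : Sides p t₀ SL SR b) (hV : Interior p t₀ SL SR b V)
    (hb : BridgeOf p t₀ SL SR b u v) (hiT : i ∈ T) (hkT : k ∈ T) (hvT : v ∈ T)
    (he : HullEdge p t₀ SL i k) (h0 : det (p i t₀) (p k t₀) (p v t₀) = 0) :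
    Controlled V (triOf p t SL SR b) (triOf p t' SL SR b) := by
  have hik := he.2.2.1
  have hkb : (p k t₀).1 ≤ (p b t₀).1 := by
    rcases hs.left k he.2.1.1 with rfl | h
    · exact le_rfl
    · exact h.le
  have hkv := hkb.trans_lt hb.2.2.2.1
  have hiv := hik.trans hkv
  have huv := hb.2.2.1.trans hb.2.2.2.1
  have h0' : det (p i t₀) (p v t₀) (p k t₀) = 0 := by rw [det_swap_right, h0, neg_zero]
  -- Otherwise `u` is strictly above the line through `i`, `k`, `v`, and then `i` or `k` is strictly
  -- below a segment between two points of the left part.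
  have hu : u = i ∨ u = k := by
    by_contra! hne
    have hpos : 0 < det (p i t₀) (p v t₀) (p u t₀) := by
      have h₁ := hb.2.2.2.2 i (Or.inl he.1.1)
      have h₂ := h₀.det_ne hkT hne.2.symm (ne_of_fst_lt hkv) (ne_of_fst_lt hik).symm
        (ne_of_fst_lt huv) (ne_of_fst_lt hiv).symm hne.1
      have h₃ := lt_of_le_of_ne h₁ h₂
      rw [det_swap_ends, det_swap_left, neg_neg, det_rotate] at h₃
      rw [det_swap_right]
      linarith [det_rotate (p u t₀) (p v t₀) (p i t₀), det_rotate (p v t₀) (p i t₀) (p u t₀),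
        det_swap_right (p i t₀) (p u t₀) (p v t₀), lt_of_le_of_ne h₁ h₂]
    rcases lt_or_gt_of_ne (fun e => hne.1 (h₀.fst_inj e) : (p u t₀).1 ≠ (p i t₀).1) with hlt | hlt
    · have key := det_interpolation (p i t₀) (p v t₀) (p u t₀) (p i t₀) (p k t₀)
      rw [det_self_left, h0'] at key
      have m₁ := mul_pos (sub_pos.2 hik) hpos
      have m₂ := mul_nonneg (sub_pos.2 hiv).le
        (he.1.2 u hb.1 k he.2.1.1 (hlt.trans hik) hlt.le hik.le)
      linarith
    · have hku : (p k t₀).1 < (p u t₀).1 := by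
        refine lt_of_le_of_ne (not_lt.1 fun h => he.2.2.2 u hb.onUpperHull ⟨hlt, h⟩)
          fun e => hne.2 (h₀.fst_inj e.symm)
      have key := det_interpolation (p i t₀) (p v t₀) (p i t₀) (p k t₀) (p u t₀)
      rw [det_self_left, h0'] at key
      have m₁ := mul_pos (sub_pos.2 hik) hpos
      have m₂ := mul_nonneg (sub_pos.2 hiv).le
        (he.2.1.2 i he.1.1 u hb.1 (hik.trans hku) hik.le hku.le)
      linarith
  refine controlled_of_opposite ht ht' hs hiT hkT hvT (ne_of_fst_lt hik) (ne_of_fst_lt hkv)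
    (ne_of_fst_lt hiv) fun {t t'} ht ht' hneg hpos => ?_
  refine Controlled.symm ?_
  -- If the edge ends at the apex, the bridge passes through the apex at time `t₀` and the funnel
  -- vanishes; otherwise the bridge moves along the edge `ik`.
  rcases hkb.eq_or_lt with e | hkb
  · obtain rfl : k = b := h₀.fst_inj e
    obtain rfl := hu.resolve_right (ne_of_fst_lt hb.2.2.1)
    refine controlled_vanish h₀ ht' ht hs hb hiT hkT hvT h0' ?_ ?_
    · rw [det_swap_right]; linarith
    · rw [det_swap_right]; linarith
  · have hbi : BridgeOf p t₀ SL SR b i v := by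
      refine ⟨he.1.1, hb.2.1, hik.trans hkb, hb.2.2.2.1, fun z hz => ?_⟩
      have := hb.2.2.2.2 z hz
      rcases hu with rfl | rfl
      · exact this
      · exact (le_iff_of_sign_eq (det_collinear hik hkv h0 (p z t₀)).2).1.1 this
    obtain ⟨a, c, l, r, hc, rfl, rfl⟩ := exists_cfg hs hbi
    obtain ⟨m, hm, e, rfl⟩ := index_of_hullEdge hc he le_rfl hkb
    obtain rfl : m + 1 = l := by
      by_contra hne
      exact hc.a_ne (by omega) le_rfl hne e
    exact controlled_bridge ht' ht hs hV hc hiT hkT hvT h0 hpos hneg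

/-- A non-corner vertex of the right chain is collinear with an edge of the left upper hull. -/
theorem controlled_visibility_inner (h₀ : Critical p t₀ T) (ht : Near p t₀ T t)
    (ht' : Near p t₀ T t') (hs : Sides p t₀ SL SR b) (hV : Interior p t₀ SL SR b V)
    (hb : BridgeOf p t₀ SL SR b u v) (hiT : i ∈ T) (hkT : k ∈ T) (hqT : q ∈ T)
    (he : HullEdge p t₀ SL i k) (hq : OnUpperHull p t₀ SR q) (hbq : (p b t₀).1 < (p q t₀).1)
    (hqv : (p q t₀).1 < (p v t₀).1) (h0 : det (p i t₀) (p k t₀) (p q t₀) = 0) :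
    Controlled V (triOf p t SL SR b) (triOf p t' SL SR b) := by
  have hik := he.2.2.1
  have hkb : (p k t₀).1 ≤ (p b t₀).1 := by
    rcases hs.left k he.2.1.1 with rfl | h
    · exact le_rfl
    · exact h.le
  have hub := hb.2.2.1
  have hbv := hb.2.2.2.1
  have huv := hub.trans hbv
  have hkq := hkb.trans_lt hbq
  have hkv := hkb.trans_lt hbv
  have hiv := hik.trans hkv
  have hcol := fun z => det_collinear hik hkq h0 (p z t₀)
  have hle := hb.2.2.2.2
  -- An edge of the tail is impossible: to the right of `u` its prolongation is not below the bridge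
  -- line. So `q`, which is not above that line, would have to lie on it as well as on the
  -- prolongation, and this is excluded.
  have hui : (p u t₀).1 ≤ (p i t₀).1 := by
    by_contra hlt
    rw [not_le] at hlt
    have hku : (p k t₀).1 ≤ (p u t₀).1 :=
      not_lt.1 fun h => he.2.2.2 u hb.onUpperHull ⟨hlt, h⟩
    rcases hku.eq_or_lt with e | hku
    · obtain rfl : k = u := h₀.fst_inj e
      have key := det_interpolation (p k t₀) (p v t₀) (p i t₀) (p k t₀) (p q t₀)
      rw [det_self_left, det_swap_right (p i t₀), h0] at key
      have e₁ := mul_nonpos_of_nonneg_of_nonpos (sub_pos.2 hkq).le (hle i (Or.inl he.1.1))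
      have e₂ := mul_nonpos_of_nonneg_of_nonpos (sub_pos.2 hik).le (hle q (Or.inr hq.1))
      rcases mul_eq_zero.1 (by linarith :
        ((p k t₀).1 - (p i t₀).1) * det (p k t₀) (p v t₀) (p q t₀) = 0) with e | e
      · linarith
      · exact h₀.det_ne hiT (ne_of_fst_lt hik) (ne_of_fst_lt hiv) (ne_of_fst_lt (hik.trans hkq))
          (ne_of_fst_lt hkv) (ne_of_fst_lt hqv).symm (ne_of_fst_lt hkq) e
    · have h₁ := he.2.1.2 i he.1.1 u hb.1 hlt hik.le hku.le
      rw [det_swap_right] at h₁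
      have huq := hub.trans hbq
      have h₂ : det (p i t₀) (p k t₀) (p u t₀) < 0 := lt_of_le_of_ne (by linarith)
        (h₀.det_ne hqT (ne_of_fst_lt (hik.trans hkq)).symm (ne_of_fst_lt hkq).symm
          (ne_of_fst_lt huq).symm (ne_of_fst_lt hik) (ne_of_fst_lt hku)
          (ne_of_fst_lt hlt))
      rw [(lt_iff_of_sign_eq (hcol u).1).1, ← (lt_iff_of_sign_eq (hcol u).2).1] at h₂
      have key := det_interpolation (p u t₀) (p v t₀) (p k t₀) (p u t₀) (p q t₀)
      rw [det_self_left] at key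
      have e₁ := mul_nonpos_of_nonneg_of_nonpos (sub_pos.2 huq).le (hle k (Or.inl he.2.1.1))
      have e₂ := mul_nonpos_of_nonneg_of_nonpos (sub_pos.2 hku).le (hle q (Or.inr hq.1))
      have e₃ := mul_neg_of_pos_of_neg (sub_pos.2 huv) h₂
      linarith
  -- The edge cannot end at the apex: on the line through `i`, `b`, `q`, concavity of the hulls
  -- leaves `u` on or below and `v` strictly below, so `b` would be strictly above `uv`.
  have hkb' : (p k t₀).1 < (p b t₀).1 := by
    refine lt_of_le_of_ne hkb fun e => ?_
    obtain rfl : k = b := h₀.fst_inj e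
    have h₁ := hq.2 k hs.apex_right v hb.2.1 hbv hbq.le hqv.le
    have h₂ := lt_of_le_of_ne h₁ (Ne.symm (h₀.det_ne hiT (ne_of_fst_lt hik) (ne_of_fst_lt hiv)
      (ne_of_fst_lt (hik.trans hkq)) (ne_of_fst_lt hkv) (ne_of_fst_lt hqv).symm
      (ne_of_fst_lt hkq)))
    rw [det_swap_right] at h₂
    have h₃ : det (p k t₀) (p q t₀) (p u t₀) ≤ 0 := by
      rw [(le_iff_of_sign_eq (hcol u).2).1, ← (le_iff_of_sign_eq (hcol u).1).1, det_swap_ends]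
      have := he.1.2 u hb.1 k hs.apex_left hub hui hik.le
      linarith
    have key := det_interpolation (p k t₀) (p q t₀) (p u t₀) (p k t₀) (p v t₀)
    rw [det_self_left] at key
    have e₁ := mul_nonpos_of_nonneg_of_nonpos (sub_pos.2 hbv).le h₃
    have e₂ := mul_pos (sub_pos.2 hub) h₂
    have e₃ := mul_nonpos_of_nonneg_of_nonpos (sub_pos.2 hkq).le (hle k (Or.inl hs.apex_left))
    linarith
  obtain ⟨a, c, l, r, hc, rfl, rfl⟩ := exists_cfg hs hb
  obtain ⟨m, hm, rfl, rfl⟩ := index_of_hullEdge hc he hui hkb'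
  obtain ⟨j, hj, rfl⟩ := ((hc.right_iff q).1 ⟨hq, hqv.le⟩).resolve_left (ne_of_fst_lt hbq).symm
  refine controlled_visibility ht ht' hs hV hc hm (lt_of_le_of_ne hj ?_) hiT hkT hqT
  rintro rfl
  exact lt_irrefl _ hqv

/-- A vertex of the right chain is collinear with an edge of the left upper hull. -/
theorem controlled_visibility_event (h₀ : Critical p t₀ T) (ht : Near p t₀ T t)
    (ht' : Near p t₀ T t') (hs : Sides p t₀ SL SR b) (hV : Interior p t₀ SL SR b V)
    (hb : BridgeOf p t₀ SL SR b u v) (hiT : i ∈ T) (hkT : k ∈ T) (hqT : q ∈ T)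
    (he : HullEdge p t₀ SL i k) (hq : OnUpperHull p t₀ SR q) (hqv : (p q t₀).1 ≤ (p v t₀).1)
    (hqk : q ≠ k) (h0 : det (p i t₀) (p k t₀) (p q t₀) = 0) :
    Controlled V (triOf p t SL SR b) (triOf p t' SL SR b) := by
  rcases hs.right q hq.1 with rfl | hbq
  · exact controlled_visibility_apex h₀ ht ht' hs hV hb hiT hkT hqT he
      ((hs.left k he.2.1.1).resolve_left hqk.symm) h0
  · rcases hqv.eq_or_lt with e | hqv
    · obtain rfl : q = v := h₀.fst_inj e
      exact controlled_visibility_base h₀ ht ht' hs hV hb hiT hkT hqT he h0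
    · exact controlled_visibility_inner h₀ ht ht' hs hV hb hiT hkT hqT he hq hbq hqv h0

end Events

/-! ### Continuity and general position -/

section Kinetics

theorem det_eq_zero_of_collinear {P Q R : ℝ × ℝ} (h : Collinear ℝ {P, Q, R}) : det P Q R = 0 := by
  obtain ⟨v, hv⟩ := (collinear_iff_of_mem (p₀ := P) (by simp)).1 h
  obtain ⟨r, hr⟩ := hv Q (by simp)
  obtain ⟨s, hs⟩ := hv R (by simp)
  subst hr hs
  simp only [det, vadd_eq_add, Prod.fst_add, Prod.snd_add, Prod.smul_fst, Prod.smul_snd,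
    smul_eq_mul]
  ring

theorem collinear_of_det_eq_zero {P Q R : ℝ × ℝ} (hne : P.1 ≠ Q.1) (h : det P Q R = 0) :
    Collinear ℝ {P, Q, R} := by
  have hne' : Q.1 - P.1 ≠ 0 := sub_ne_zero.2 hne.symm
  refine (collinear_iff_of_mem (p₀ := P) (by simp)).2 ⟨Q - P, ?_⟩
  intro S hS
  simp only [Set.mem_insert_iff, Set.mem_singleton_iff] at hS
  rcases hS with rfl | rfl | rfl
  · exact ⟨0, by simp⟩
  · exact ⟨1, by simp⟩
  · refine ⟨(S.1 - P.1) / (Q.1 - P.1), ?_⟩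
    unfold det at h
    ext
    · simp only [vadd_eq_add, Prod.fst_add, Prod.smul_fst, Prod.fst_sub, smul_eq_mul]
      field_simp
      ring
    · simp only [vadd_eq_add, Prod.snd_add, Prod.smul_snd, Prod.snd_sub, smul_eq_mul]
      field_simp
      linarith

variable {n : ℕ} {p : Fin n → ℝ → ℝ × ℝ} {t t₀ : ℝ} {A B C : Fin n}

theorem degenerate_pair {i j : Fin n} (hne : i ≠ j) (h : (p i t).1 = (p j t).1) :
    Degenerate p t {i, j} := by
  refine Or.inl ⟨Finset.card_pair hne, ?_⟩
  intro x hx y hy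
  simp only [Finset.mem_insert, Finset.mem_singleton] at hx hy
  rcases hx with rfl | rfl <;> rcases hy with rfl | rfl <;> simp [h]

theorem degenerate_triple {i j k : Fin n} (hij : i ≠ j) (hjk : j ≠ k) (hik : i ≠ k)
    (h : Collinear ℝ {p i t, p j t, p k t}) : Degenerate p t {i, j, k} := by
  refine Or.inr ⟨Finset.card_eq_three.2 ⟨i, j, k, hij, hik, hjk, rfl⟩, ?_⟩
  simpa [Set.image_insert_eq] using h

/-- Distinct degeneracies occur at distinct times, so the collinearity of `A`, `B`, `C` excludes a
common `x`-coordinate and any other collinear triple at time `t₀`. -/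
theorem GeneralPosition.critical (hp : GeneralPosition p) (hAB : A ≠ B) (hBC : B ≠ C)
    (hAC : A ≠ C) (h : Collinear ℝ {p A t₀, p B t₀, p C t₀}) : Critical p t₀ {A, B, C} := by
  have hd := degenerate_triple hAB hBC hAC h
  have hinj : Function.Injective fun i => (p i t₀).1 := by
    intro i j e
    by_contra hne
    have h₁ := congrArg Finset.card (hp.distinct_times t₀ (degenerate_pair hne e) hd)
    rw [Finset.card_pair hne, Finset.card_eq_three.2 ⟨A, B, C, hAB, hAC, hBC, rfl⟩] at h₁
    omega
  refine ⟨hinj, fun {i j k w} hw h₁ h₂ h₃ hij hjk hik h0 => ?_⟩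
  have hd' := degenerate_triple hij hjk hik
    (collinear_of_det_eq_zero (fun e => hij (hinj e)) h0)
  have e := hp.distinct_times t₀ hd hd'
  have hw' : w ∈ ({A, B, C} : Finset (Fin n)) := by simpa using hw
  rw [e] at hw'
  simp only [Finset.mem_insert, Finset.mem_singleton] at hw'
  rcases hw' with rfl | rfl | rfl
  · exact h₁ rfl
  · exact h₂ rfl
  · exact h₃ rfl

theorem nonDegenerate_of_not_degenerate (h : ∀ s, ¬ Degenerate p t s) : NonDegenerate p t where
  fst_ne := fun hne e => h _ (degenerate_pair hne e)
  det_ne := fun hij hjk hik e => h _ (degenerate_triple hij hjk hik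
    (collinear_of_det_eq_zero (fun e => h _ (degenerate_pair hij e)) e))

theorem GeneralPosition.eventually_nonDegenerate (hp : GeneralPosition p) (t₀ : ℝ) :
    ∀ᶠ t in 𝓝[≠] t₀, NonDegenerate p t := by
  have hfin : {t : ℝ | ∃ s, Degenerate p t s}.Finite := by
    have : {t : ℝ | ∃ s, Degenerate p t s} = ⋃ s, {t : ℝ | Degenerate p t s} := by
      ext t; simp
    rw [this]
    exact Set.finite_iUnion hp.finite_times
  have hmem : ({t : ℝ | ∃ s, Degenerate p t s} \ {t₀})ᶜ ∈ 𝓝 t₀ :=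
    (hfin.subset Set.sdiff_subset).isClosed.isOpen_compl.mem_nhds (by simp)
  filter_upwards [mem_nhdsWithin_of_mem_nhds hmem, self_mem_nhdsWithin] with t ht hne
  refine nonDegenerate_of_not_degenerate fun s hs => ht ⟨⟨s, hs⟩, hne⟩

theorem eventually_sign_eq {f : ℝ → ℝ} (hf : Continuous f) (h : f t₀ ≠ 0) :
    ∀ᶠ t in 𝓝 t₀, SignType.sign (f t) = SignType.sign (f t₀) := by
  rcases lt_or_gt_of_ne h with h | h
  · filter_upwards [hf.continuousAt.eventually_lt continuousAt_const h] with t ht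
    rw [sign_neg h, sign_neg ht]
  · filter_upwards [continuousAt_const.eventually_lt hf.continuousAt h] with t ht
    rw [sign_pos h, sign_pos ht]

/-- Continuous quantities that do not vanish at `t₀` keep their sign nearby, and the finitely many
degenerate times other than `t₀` are avoided. The punctured neighbourhood is needed because `t₀`
itself is degenerate. -/
theorem GeneralPosition.eventually_near (hp : GeneralPosition p) {T : Set (Fin n)}
    (h₀ : Critical p t₀ T) : ∀ᶠ t in 𝓝[≠] t₀, Near p t₀ T t := by
  have hc : ∀ i, Continuous fun t => (p i t).1 := fun i => continuous_fst.comp (hp.continuous i)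
  have hc' : ∀ i, Continuous fun t => (p i t).2 := fun i => continuous_snd.comp (hp.continuous i)
  have h₁ : ∀ᶠ t in 𝓝 t₀, ∀ i j, (p i t).1 < (p j t).1 ↔ (p i t₀).1 < (p j t₀).1 := by
    refine eventually_all.2 fun i => eventually_all.2 fun j => ?_
    by_cases hij : i = j
    · subst hij; simp
    · have hne : (p i t₀).1 - (p j t₀).1 ≠ 0 := sub_ne_zero.2 fun e => hij (h₀.fst_inj e)
      filter_upwards [eventually_sign_eq ((hc i).sub (hc j)) hne] with t ht
      exact sub_neg.symm.trans ((lt_iff_of_sign_eq ht).1.trans sub_neg)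
  have h₂ : ∀ᶠ t in 𝓝 t₀, ∀ i j k, (∃ w ∈ T, w ≠ i ∧ w ≠ j ∧ w ≠ k) →
      SignType.sign (det (p i t) (p j t) (p k t)) =
        SignType.sign (det (p i t₀) (p j t₀) (p k t₀)) := by
    refine eventually_all.2 fun i => eventually_all.2 fun j => eventually_all.2 fun k => ?_
    by_cases hw : ∃ w ∈ T, w ≠ i ∧ w ≠ j ∧ w ≠ k
    · by_cases hij : i = j
      · subst hij; simp [det_self]
      by_cases hjk : j = k
      · subst hjk; simp [det_self_right]
      by_cases hik : i = k
      · subst hik; simp [det_self_left]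
      obtain ⟨w, hwT, w₁, w₂, w₃⟩ := hw
      have hcont : Continuous fun t => det (p i t) (p j t) (p k t) := by
        unfold det
        exact (((hc j).sub (hc i)).mul ((hc' k).sub (hc' i))).sub
          (((hc' j).sub (hc' i)).mul ((hc k).sub (hc i)))
      filter_upwards [eventually_sign_eq hcont (h₀.det_ne hwT w₁ w₂ w₃ hij hjk hik)] with t ht _
      exact ht
    · exact Eventually.of_forall fun t h => (hw h).elim
  filter_upwards [hp.eventually_nonDegenerate t₀, mem_nhdsWithin_of_mem_nhds h₁,
    mem_nhdsWithin_of_mem_nhds h₂] with t ht₀ ht₁ ht₂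
  exact ⟨ht₀, ht₁, fun hw w₁ w₂ w₃ => ht₂ _ _ _ ⟨_, hw, w₁, w₂, w₃⟩⟩

end Kinetics

/-! ### Translation from pseudo-triangles to the two parts of their range -/

section Positions

variable {n : ℕ} {p : Fin n → ℝ → ℝ × ℝ} {t t₀ : ℝ} {T : Set (Fin n)} {τ : PseudoTriangle n}

theorem pos_negInf_lt (i : Fin n) : pos p t Pt.negInf < pos p t (Pt.pt i) := by
  simp only [pos, Prod.Lex.toLex_lt_toLex]
  exact Or.inl (EReal.bot_lt_coe _)

theorem pos_lt_posInf (i : Fin n) : pos p t (Pt.pt i) < pos p t Pt.posInf := by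
  simp only [pos, Prod.Lex.toLex_lt_toLex]
  exact Or.inl (EReal.coe_lt_top _)

theorem pos_negInf_lt_posInf : pos p t Pt.negInf < pos p t Pt.posInf := by
  simp only [pos, Prod.Lex.toLex_lt_toLex]
  exact Or.inl bot_lt_top

theorem pos_lt_of_fst_lt {i j : Fin n} (h : (p i t).1 < (p j t).1) :
    pos p t (Pt.pt i) < pos p t (Pt.pt j) := by
  simp only [pos, Prod.Lex.toLex_lt_toLex]
  exact Or.inl (EReal.coe_lt_coe_iff.2 h)

theorem pos_lt_iff_fst_lt (hinj : Function.Injective fun i => (p i t).1) {i j : Fin n} :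
    pos p t (Pt.pt i) < pos p t (Pt.pt j) ↔ (p i t).1 < (p j t).1 := by
  refine ⟨fun h => ?_, pos_lt_of_fst_lt⟩
  by_contra hle
  rcases (not_lt.1 hle).eq_or_lt with e | hlt
  · rw [hinj e] at h
    exact lt_irrefl _ h
  · exact lt_asymm h (pos_lt_of_fst_lt hlt)

theorem pos_le_iff_fst_le (hinj : Function.Injective fun i => (p i t).1) {i j : Fin n} :
    pos p t (Pt.pt i) ≤ pos p t (Pt.pt j) ↔ (p i t).1 ≤ (p j t).1 := by
  rw [← not_lt, pos_lt_iff_fst_lt hinj, not_lt]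

theorem NonDegenerate.fst_inj (h : NonDegenerate p t) : Function.Injective fun i => (p i t).1 := by
  intro i j e
  by_contra hne
  exact h.fst_ne hne e

/-- The `x`-order of the augmented points agrees with that at time `t₀`. -/
theorem Near.pos_le_iff (h₀ : Critical p t₀ T) (h : Near p t₀ T t) (x y : Pt n) :
    pos p t x ≤ pos p t y ↔ pos p t₀ x ≤ pos p t₀ y := by
  cases x <;> cases y
  case pt.pt i j => rw [pos_le_iff_fst_le h.nd.fst_inj, pos_le_iff_fst_le h₀.fst_inj, h.le_iff]
  case pt.negInf => exact iff_of_false (not_le.2 (pos_negInf_lt _)) (not_le.2 (pos_negInf_lt _))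
  case posInf.pt => exact iff_of_false (not_le.2 (pos_lt_posInf _)) (not_le.2 (pos_lt_posInf _))
  case posInf.negInf =>
    exact iff_of_false (not_le.2 pos_negInf_lt_posInf) (not_le.2 pos_negInf_lt_posInf)
  case negInf.negInf => exact iff_of_true le_rfl le_rfl
  case posInf.posInf => exact iff_of_true le_rfl le_rfl
  case negInf.pt => exact iff_of_true (pos_negInf_lt _).le (pos_negInf_lt _).le
  case pt.posInf => exact iff_of_true (pos_lt_posInf _).le (pos_lt_posInf _).le
  case negInf.posInf => exact iff_of_true pos_negInf_lt_posInf.le pos_negInf_lt_posInf.le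

theorem range_eq_union (t : ℝ) (τ : PseudoTriangle n) (i : Fin n) :
    i ∈ range p t τ ↔ i ∈ rangeL p t τ ∨ i ∈ rangeR p t τ := by
  refine ⟨fun h => (le_total _ _).imp (fun h' => ⟨h, h'⟩) fun h' => ⟨h, h'⟩, ?_⟩
  rintro (h | h) <;> exact h.1

theorem Near.rangeL_eq (h₀ : Critical p t₀ T) (h : Near p t₀ T t) :
    rangeL p t τ = rangeL p t₀ τ := by
  ext i
  simp only [rangeL, range, Set.mem_ofPred_eq, h.pos_le_iff h₀]

theorem Near.rangeR_eq (h₀ : Critical p t₀ T) (h : Near p t₀ T t) :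
    rangeR p t τ = rangeR p t₀ τ := by
  ext i
  simp only [rangeR, range, Set.mem_ofPred_eq, h.pos_le_iff h₀]

theorem isBridge_iff {u v : Fin n} :
    IsBridge p t τ u v ↔ BridgeOf p t (rangeL p t τ) (rangeR p t τ) τ.apex u v := by
  simp only [IsBridge, BridgeOf, range_eq_union]

theorem isFunnel_iff {F : Funnel n} :
    IsFunnel p t τ F ↔ IsFunnelOf p t (rangeL p t τ) (rangeR p t τ) τ.apex F := by
  simp only [IsFunnel, IsFunnelOf, isBridge_iff, OnLeftChain, OnRightChain]

theorem Near.triangulation_eq (h₀ : Critical p t₀ T) (h : Near p t₀ T t)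
    (π : Equiv.Perm (Fin n)) :
    triangulation p π t τ = triOf p t (rangeL p t₀ τ) (rangeR p t₀ τ) τ.apex π := by
  simp only [triangulation, triOf, isFunnel_iff, h.rangeL_eq h₀, h.rangeR_eq h₀]

theorem sides_of_lt (hinj : Function.Injective fun i => (p i t).1)
    (h₁ : pos p t τ.left < pos p t (Pt.pt τ.apex)) (h₂ : pos p t (Pt.pt τ.apex) < pos p t τ.right) :
    Sides p t (rangeL p t τ) (rangeR p t τ) τ.apex where
  apex_left := ⟨⟨h₁.le, h₂.le⟩, le_rfl⟩
  apex_right := ⟨⟨h₁.le, h₂.le⟩, le_rfl⟩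
  left := fun _ hi => ((pos_le_iff_fst_le hinj).1 hi.2).eq_or_lt.imp_left fun e => hinj e
  right := fun _ hi => ((pos_le_iff_fst_le hinj).1 hi.2).eq_or_lt.imp_left fun e => (hinj e).symm
  fst_inj := hinj

/-- This places the non-corner vertices of the funnel among the points whose priorities are
exchangeable. -/
theorem interior_pointSet (ht : t ∈ τ.life) :
    Interior p t (rangeL p t τ) (rangeR p t τ) τ.apex (pointSet p τ) := by
  intro y z z' _ hz hz' hne h₁ h₂
  rw [← range_eq_union] at hz hz'
  exact ⟨hne, t, ht, hz.1.trans_lt (pos_lt_of_fst_lt h₁), (pos_lt_of_fst_lt h₂).trans_le hz'.2⟩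

theorem Interior.near {SL SR V : Set (Fin n)} {b : Fin n} (hV : Interior p t₀ SL SR b V)
    (h : Near p t₀ T t) : Interior p t SL SR b V := by
  intro y z z' hy hz hz' hne h₁ h₂
  exact hV y z z' hy hz hz' hne ((h.lt_iff _ _).1 h₁) ((h.lt_iff _ _).1 h₂)

theorem hullEdge_mirror {S : Set (Fin n)} {i k : Fin n} (h : HullEdge p t S i k) :
    HullEdge (mirror p) t S k i := by
  refine ⟨onUpperHull_mirror.2 h.2.1, onUpperHull_mirror.2 h.1, ?_, fun j hj hlt => ?_⟩
  · simpa only [mirror_fst, neg_lt_neg_iff] using h.2.2.1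
  · simp only [mirror_fst, neg_lt_neg_iff] at hlt
    exact h.2.2.2 j (onUpperHull_mirror.1 hj) hlt.symm

/-- The effect of an event on the triangulation is controlled. -/
theorem GeneralPosition.exists_controlled (hp : GeneralPosition p) (ht₀ : t₀ ∈ τ.life)
    (h₁ : pos p t₀ τ.left < pos p t₀ (Pt.pt τ.apex))
    (h₂ : pos p t₀ (Pt.pt τ.apex) < pos p t₀ τ.right) {q : Fin n}
    (he : EnvelopeEvent p t₀ τ q ∨ VisibilityEvent p t₀ τ q) :
    ∃ T, Critical p t₀ T ∧ ∀ t t', Near p t₀ T t → Near p t₀ T t' →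
      Controlled (pointSet p τ) (fun π => triangulation p π t τ)
        (fun π => triangulation p π t' τ) := by
  have hV := interior_pointSet (p := p) ht₀
  suffices h : ∃ T, Critical p t₀ T ∧ ∀ t t', Near p t₀ T t → Near p t₀ T t' →
      Controlled (pointSet p τ) (triOf p t (rangeL p t₀ τ) (rangeR p t₀ τ) τ.apex)
        (triOf p t' (rangeL p t₀ τ) (rangeR p t₀ τ) τ.apex) by
    obtain ⟨T, h₀, h⟩ := h
    refine ⟨T, h₀, fun t t' ht ht' => ?_⟩
    simp only [ht.triangulation_eq h₀, ht'.triangulation_eq h₀]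
    exact h t t' ht ht'
  have mirrored : ∀ {t t'}, Controlled (pointSet p τ)
      (triOf (mirror p) t (rangeR p t₀ τ) (rangeL p t₀ τ) τ.apex)
      (triOf (mirror p) t' (rangeR p t₀ τ) (rangeL p t₀ τ) τ.apex) →
      Controlled (pointSet p τ) (triOf p t (rangeL p t₀ τ) (rangeR p t₀ τ) τ.apex)
        (triOf p t' (rangeL p t₀ τ) (rangeR p t₀ τ) τ.apex) := by
    intro t t' h
    simpa only [Controlled, triOf_mirror] using h
  rcases he with ⟨u, v, hb, i, k, hiq, hqk, hcol, he⟩ | ⟨u, v, hb, i, k, hqi, hqk, hcol, he⟩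
  · have h₀ := hp.critical (ne_of_fst_lt hiq) (ne_of_fst_lt hqk) (ne_of_fst_lt (hiq.trans hqk)) hcol
    have h0 := det_eq_zero_of_collinear hcol
    have hs := sides_of_lt h₀.fst_inj h₁ h₂
    rw [isBridge_iff] at hb
    refine ⟨_, h₀, fun t t' ht ht' => ?_⟩
    rcases he with ⟨hi, hq, hk⟩ | ⟨hi, hq, hk⟩
    · exact controlled_envelope h₀ ht ht' hs hV hb (by simp) (by simp) (by simp) hi.1 hq.1 hk.1 hi.2
        hiq hqk h0
    · refine mirrored (controlled_envelope (i := k) (q := q) (k := i) h₀.mirror ht.mirror ht'.mirror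
        hs.mirror hV.mirror (bridgeOf_mirror.2 hb) (by simp) (by simp) (by simp)
        (onUpperHull_mirror.2 hk.1) (onUpperHull_mirror.2 hq.1) (onUpperHull_mirror.2 hi.1)
        ?_ ?_ ?_ ?_)
      · simpa only [mirror_fst, neg_le_neg_iff] using hk.2
      · simpa only [mirror_fst, neg_lt_neg_iff] using hqk
      · simpa only [mirror_fst, neg_lt_neg_iff] using hiq
      · rw [det_mirror]; exact h0
  · have hik : i ≠ k := by
      rcases he with ⟨-, he⟩ | ⟨-, he⟩ <;> exact ne_of_fst_lt he.2.2.1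
    have h₀ := hp.critical hqi hik hqk hcol
    have h0 := det_eq_zero_of_collinear hcol
    have hs := sides_of_lt h₀.fst_inj h₁ h₂
    rw [isBridge_iff] at hb
    refine ⟨_, h₀, fun t t' ht ht' => ?_⟩
    rcases he with ⟨hq, he⟩ | ⟨hq, he⟩
    · refine controlled_visibility_event h₀ ht ht' hs hV hb (by simp) (by simp) (by simp) he hq.1 hq.2
        hqk ?_
      rw [← det_rotate]; exact h0
    · refine mirrored (controlled_visibility_event (i := k) (q := q) (k := i) h₀.mirror ht.mirror
        ht'.mirror hs.mirror hV.mirror (bridgeOf_mirror.2 hb) (by simp) (by simp) (by simp)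
        (hullEdge_mirror he) (onUpperHull_mirror.2 hq.1) ?_ hqi ?_)
      · simpa only [mirror_fst, neg_le_neg_iff] using hq.2
      · rw [det_mirror]; exact h0

/-- A point that generates a chord in a large sub-pseudo-triangle does so in a large part of the
index set of the chains. -/
theorem Near.generatesLarge (h₀ : Critical p t₀ T) (h : Near p t₀ T t) (ht₀ : t₀ ∈ τ.life)
    (h₁ : pos p t₀ τ.left < pos p t₀ (Pt.pt τ.apex))
    (h₂ : pos p t₀ (Pt.pt τ.apex) < pos p t₀ τ.right) :
    (∀ π q F, ¬ GeneratesIn p π t τ q F) ∨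
    ∃ (d : Chains n) (l r : ℕ), d.Wf l r ∧ (∀ y, d.Inner ⟨0, l, 0, r⟩ y → y ∈ pointSet p τ) ∧
      ∀ π q k, (∃ F, GeneratesIn p π t τ q F ∧ k < F.numVertices) → d.GeneratesLarge l r π q k := by
  have hs := (sides_of_lt h₀.fst_inj h₁ h₂).near h
  have hV := (interior_pointSet (p := p) ht₀).near h
  by_cases hb : ∃ u v, BridgeOf p t (rangeL p t₀ τ) (rangeR p t₀ τ) τ.apex u v
  · right
    obtain ⟨u, v, hb⟩ := hb
    obtain ⟨a, c, l, r, hc, rfl, rfl⟩ := exists_cfg hs hb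
    obtain ⟨f, g, hsp⟩ := Chains.Root.exists_tangentSpec (hc.root h.nd)
    have hr := hc.root h.nd f g
    refine ⟨⟨a, c, f, g⟩, l, r, hr.wf hsp, fun y hy => hc.inner_mem hV hy, ?_⟩
    rintro π q k ⟨F, ⟨F₀, hF₀, hsub, w, Fu, Fl, hsplit⟩, hk⟩
    rw [isFunnel_iff, h.rangeL_eq h₀, h.rangeR_eq h₀, hc.isFunnelOf_iff h.nd f g] at hF₀
    subst hF₀
    obtain ⟨o', s, rfl, hg, hreach⟩ := hr.subFunnel hsp hsub
    obtain ⟨u, v, hst, -, -⟩ := (hg.split_iff hr hsp).1 hsplit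
    exact ⟨s, w, u, v, hreach, hst, hk.trans_le
      (Chains.numVertices_funnel_le hg.1.hi hg.1.hj)⟩
  · left
    rintro π q F ⟨F₀, ⟨u, v, hF₀, -⟩, -⟩
    rw [isBridge_iff, h.rangeL_eq h₀, h.rangeR_eq h₀] at hF₀
    exact hb ⟨u, v, hF₀⟩

end Positions

/-! ### Independence of the appearance from the order of the priorities in the range -/

section Appearance

variable {n : ℕ} {p : Fin n → ℝ → ℝ × ℝ} {t : ℝ} {τ : PseudoTriangle n}
variable {π : Equiv.Perm (Fin n)} {b x y : Fin n}

theorem priority_pt_lt_iff {i j : Fin n} :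
    priority π (Pt.pt i) < priority π (Pt.pt j) ↔ π i < π j := by
  simp [priority]

/-- Only the priorities of `x` and `y` change, and both exceed that of `b`. -/
theorem priority_mul_swap_of_le (hx : π b < π x) (hy : π b < π y) {q : Pt n}
    (hq : priority π q ≤ priority π (Pt.pt b)) :
    priority (π * Equiv.swap x y) q = priority π q := by
  cases q with
  | negInf => rfl
  | posInf => rfl
  | pt z =>
    have h₁ : z ≠ x := by rintro rfl; exact absurd (priority_pt_lt_iff.2 hx) (not_lt.2 hq)
    have h₂ : z ≠ y := by rintro rfl; exact absurd (priority_pt_lt_iff.2 hy) (not_lt.2 hq)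
    simp [priority, Equiv.swap_apply_of_ne_of_ne h₁ h₂]

theorem le_priority_mul_swap (hx : π b < π x) (hy : π b < π y) {q : Pt n} {m : ℤ}
    (hm : m ≤ priority π (Pt.pt b)) (hq : m ≤ priority π q) :
    m ≤ priority (π * Equiv.swap x y) q := by
  cases q with
  | negInf => exact hq
  | posInf => exact hq
  | pt z =>
    have hx' := priority_pt_lt_iff.2 hx
    have hy' := priority_pt_lt_iff.2 hy
    simp only [priority, Equiv.Perm.mul_apply] at hm hq hx' hy' ⊢
    by_cases h₁ : z = x
    · rw [h₁, Equiv.swap_apply_left]; omega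
    by_cases h₂ : z = y
    · rw [h₂, Equiv.swap_apply_right]; omega
    rwa [Equiv.swap_apply_of_ne_of_ne h₁ h₂]

/-- An interval around `b` keeps its point of minimum priority when two points of larger priority
than `b` are exchanged. -/
theorem IsMid.mul_swap (hx : π b < π x) (hy : π b < π y) {a m c : Pt n}
    (h : IsMid p π t a m c) (hab : pos p t a < pos p t (Pt.pt b))
    (hbc : pos p t (Pt.pt b) < pos p t c) : IsMid p (π * Equiv.swap x y) t a m c := by
  have hm := h.2 _ hab hbc
  refine ⟨h.1, fun q h₁ h₂ => ?_⟩
  rw [priority_mul_swap_of_le hx hy hm]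
  exact le_priority_mul_swap hx hy hm (h.2 q h₁ h₂)

/-- All ranges on the way of the recursion to `a`, `c` have `b` strictly inside. So the points at
which they are split have priority at most that of `b` and are unaffected by the exchange. -/
theorem IsRange.mul_swap (hx : π b < π x) (hy : π b < π y) {a c : Pt n} (h : IsRange p π t a c) :
    pos p t a < pos p t (Pt.pt b) → pos p t (Pt.pt b) < pos p t c →
      IsRange p (π * Equiv.swap x y) t a c := by
  induction h with
  | root => exact fun _ _ => IsRange.root
  | left _ hm ih =>
    intro h₁ h₂
    exact IsRange.left (ih h₁ (h₂.trans hm.1.2)) (hm.mul_swap hx hy h₁ (h₂.trans hm.1.2))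
  | right _ hm ih =>
    intro h₁ h₂
    exact IsRange.right (ih (hm.1.1.trans h₁) h₂) (hm.mul_swap hx hy (hm.1.1.trans h₁) h₂)

theorem InPT.mul_swap (hx : π b < π x) (hy : π b < π y) {a c : Pt n}
    (h : InPT p π t a (Pt.pt b) c) : InPT p (π * Equiv.swap x y) t a (Pt.pt b) c :=
  ⟨h.1.mul_swap hx hy h.2.1.1 h.2.1.2, h.2.mul_swap hx hy h.2.1.1 h.2.1.2⟩

theorem Appears.lt_of_mem (h : Appears p π τ) (hx : x ∈ pointSet p τ) : π τ.apex < π x := by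
  obtain ⟨hne, t, ht, h₁, h₂⟩ := hx
  have hle := (h.1.2.2 t ht).2.2 _ h₁ h₂
  refine lt_of_le_of_ne (not_lt.1 fun hlt => ?_) fun e => hne (π.injective e.symm)
  exact absurd (priority_pt_lt_iff.2 hlt) (not_lt.2 hle)

/-- The appearance of a pseudo-triangle does not depend on the relative order of the priorities of
the points in its range. -/
theorem Appears.mul_swap (h : Appears p π τ) (hx : x ∈ pointSet p τ) (hy : y ∈ pointSet p τ) :
    Appears p (π * Equiv.swap x y) τ := by
  have hx' := h.lt_of_mem hx
  have hy' := h.lt_of_mem hy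
  refine ⟨⟨h.1.1, h.1.2.1, fun t ht => (h.1.2.2 t ht).mul_swap hx' hy'⟩, ?_⟩
  rintro J ⟨hJ, hJ', hJ''⟩ hle
  -- Maximality: exchanging `x` and `y` once more turns a longer interval for the new permutation
  -- into one for `π`.
  refine h.2 ⟨hJ, hJ', fun t ht => ?_⟩ hle
  have hb : (π * Equiv.swap x y) τ.apex = π τ.apex := by
    simp [Equiv.swap_apply_of_ne_of_ne hx.1.symm hy.1.symm]
  have := (hJ'' t ht).mul_swap (x := x) (y := y) (by rw [hb]; simpa using hy')
    (by rw [hb]; simpa using hx')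
  rwa [mul_assoc, Equiv.swap_mul_self, mul_one] at this

theorem mem_appearing : π ∈ appearing p τ ↔ Appears p π τ := by
  classical
  simp [appearing]

theorem swapClosed_appearing (p : Fin n → ℝ → ℝ × ℝ) (τ : PseudoTriangle n) :
    SwapClosed (appearing p τ) (pointSet p τ) := fun _ hπ _ hx _ hy =>
  mem_appearing.2 ((mem_appearing.1 hπ).mul_swap hx hy)

end Appearance

/-! ### Expected number of changes -/

section Expectation

variable {n : ℕ}

theorem Chains.Inj.add_le_ncard {d : Chains n} {l r : ℕ} (hd : d.Inj l r) {V : Set (Fin n)}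
    (hV : ∀ y, d.Inner ⟨0, l, 0, r⟩ y → y ∈ V) : l + r ≤ V.ncard := by
  classical
  have h₁ : ((Finset.range l).image d.a).card = l := by
    rw [Finset.card_image_of_injOn, Finset.card_range]
    intro i hi j hj e
    simp only [Finset.coe_range, Set.mem_Iio] at hi hj
    exact hd.a_inj i hi.le j hj.le e
  have h₂ : ((Finset.range r).image d.c).card = r := by
    rw [Finset.card_image_of_injOn, Finset.card_range]
    intro i hi j hj e
    simp only [Finset.coe_range, Set.mem_Iio] at hi hj
    exact hd.c_inj i hi.le j hj.le e
  have hdisj : Disjoint ((Finset.range l).image d.a) ((Finset.range r).image d.c) := by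
    refine Finset.disjoint_left.2 fun z h₁ h₂ => ?_
    simp only [Finset.mem_image, Finset.mem_range] at h₁ h₂
    obtain ⟨i, hi, rfl⟩ := h₁
    obtain ⟨j, hj, e⟩ := h₂
    exact hd.a_ne_c i hi.le j hj.le e.symm
  rw [← h₁, ← h₂, ← Finset.card_union_of_disjoint hdisj, ← Set.ncard_coe_finset]
  refine Set.ncard_le_ncard (fun z hz => hV z ?_) (Set.toFinite _)
  simp only [Finset.coe_union, Finset.coe_image, Finset.coe_range, Set.mem_union, Set.mem_image,
    Set.mem_Iio] at hz
  rcases hz with ⟨i, hi, rfl⟩ | ⟨j, hj, rfl⟩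
  · exact Or.inl ⟨i, Nat.zero_le _, hi, rfl⟩
  · exact Or.inr ⟨j, Nat.zero_le _, hj, rfl⟩

theorem Chains.BoundedBy.le {d : Chains n} {l r m : ℕ} {π : Equiv.Perm (Fin n)} {x : Fin n}
    (h : d.BoundedBy l r π x m) : m ≤ l + r := by
  rcases h with rfl | ⟨s, w, u, v, hr, -, rfl⟩
  · exact Nat.zero_le _
  · have := hr.within (Chains.within_root l r)
    obtain ⟨h₁, h₂, h₃, h₄⟩ := this
    unfold Box.size
    omega

theorem Chains.BoundedBy.generatesLarge {d : Chains n} {l r m k : ℕ} {π : Equiv.Perm (Fin n)}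
    {x : Fin n} (h : d.BoundedBy l r π x m) (hk : k < m) : d.GeneratesLarge l r π x (k + 1) := by
  rcases h with rfl | ⟨s, w, u, v, hr, hs, rfl⟩
  · omega
  · exact ⟨s, w, u, v, hr, hs, by omega⟩

/-- The expected number of vertices of the part in which `x` generates its chord is logarithmic. -/
theorem Chains.sum_boundedBy_le {d : Chains n} {l r : ℕ} (hd : d.Wf l r)
    {X : Finset (Equiv.Perm (Fin n))} {V : Set (Fin n)} (hX : SwapClosed X V)
    (hV : ∀ y, d.Inner ⟨0, l, 0, r⟩ y → y ∈ V) (x : Fin n) {m : Equiv.Perm (Fin n) → ℕ}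
    (hm : ∀ π, d.BoundedBy l r π x (m π)) :
    ((∑ π ∈ X, m π : ℕ) : ℝ) ≤ 25 * X.card * (1 + Real.log V.ncard) := by
  classical
  have hmN : ∀ π, m π ≤ V.ncard := fun π => (hm π).le.trans (hd.toInj.add_le_ncard hV)
  -- The expectation as the sum of the tails. It ends at `V.ncard`, because the non-corner vertices
  -- are distinct points of `V`; the bounds 25/(k+1) then add up to a harmonic number.
  have e₁ : ∑ π ∈ X, m π = ∑ k ∈ Finset.range V.ncard, (X.filter fun π => k < m π).card := by
    simp only [Finset.card_filter]
    rw [Finset.sum_comm]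
    refine Finset.sum_congr rfl fun π _ => ?_
    rw [← Finset.card_filter]
    have : (Finset.range V.ncard).filter (fun k => k < m π) = Finset.range (m π) := by
      ext k
      simp only [Finset.mem_filter, Finset.mem_range]
      have := hmN π
      omega
    rw [this, Finset.card_range]
  rw [e₁, Nat.cast_sum]
  have e₂ : ∀ k ∈ Finset.range V.ncard, ((X.filter fun π => k < m π).card : ℝ) ≤
      25 * X.card * ((k + 1 : ℕ) : ℝ)⁻¹ := by
    intro k _
    have h₁ := Chains.card_generatesLarge_le hd hX hV x (Nat.succ_pos k)
    have h₂ : (X.filter fun π => k < m π).card ≤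
        (X.filter fun π => d.GeneratesLarge l r π x (k + 1)).card :=
      Finset.card_le_card fun π hπ => by
        rw [Finset.mem_filter] at hπ ⊢
        exact ⟨hπ.1, (hm π).generatesLarge hπ.2⟩
    have h₃ : ((X.filter fun π => k < m π).card : ℝ) ≤
      (X.filter fun π => d.GeneratesLarge l r π x (k + 1)).card := by exact_mod_cast h₂
    refine h₃.trans (h₁.trans (le_of_eq ?_))
    rw [div_eq_mul_inv]
    ring
  refine (Finset.sum_le_sum e₂).trans ?_
  rw [← Finset.mul_sum]
  refine mul_le_mul_of_nonneg_left ?_ (by positivity)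
  have := harmonic_le_one_add_log V.ncard
  rw [harmonic] at this
  push_cast at this ⊢
  exact this

/-- The expected number of changes in a controlled transition is logarithmic. -/
theorem Controlled.sum_le {V : Set (Fin n)}
    {T₁ T₂ : Equiv.Perm (Fin n) → Set (Sym2 (Fin n))} (h : Controlled V T₁ T₂)
    {X : Finset (Equiv.Perm (Fin n))} (hX : SwapClosed X V) :
    ∑ π ∈ X, ((symmDiff (T₁ π) (T₂ π)).ncard : ℝ) ≤
      150 * Real.log (V.ncard + 2) * X.card := by
  have hN : Real.log V.ncard ≤ Real.log (V.ncard + 2) := by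
    rcases Nat.eq_zero_or_pos V.ncard with h0 | h0
    · rw [h0]; simpa using Real.log_nonneg (by norm_num : (1 : ℝ) ≤ 2)
    · exact Real.log_le_log (by exact_mod_cast h0) (by linarith)
  -- The bound log 2 > 0.6 absorbs the additive constants: 3 + 2·25·(1 + log N) = 53 + 50 log N is
  -- at most (53/0.6 + 50) log(N + 2), and this is below 150 log(N + 2).
  have hL : (0.6 : ℝ) ≤ Real.log (V.ncard + 2) := by
    have h₁ := Real.log_two_gt_d9
    have h₂ : Real.log 2 ≤ Real.log (V.ncard + 2) :=
      Real.log_le_log (by norm_num) (by linarith [(Nat.cast_nonneg V.ncard : (0 : ℝ) ≤ V.ncard)])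
    linarith
  have hXc : (0 : ℝ) ≤ X.card := Nat.cast_nonneg _
  have hXL := mul_le_mul_of_nonneg_right hL hXc
  rcases h with h | ⟨d, l, r, x, hd, hV, h⟩
  · have : ∑ π ∈ X, ((symmDiff (T₁ π) (T₂ π)).ncard : ℝ) ≤ ∑ _π ∈ X, (3 : ℝ) :=
      Finset.sum_le_sum fun π _ => by exact_mod_cast h π
    rw [Finset.sum_const, nsmul_eq_mul] at this
    nlinarith
  · choose m hm hle using h
    have h₁ := Chains.sum_boundedBy_le hd hX hV x hm
    have h₂ : ∑ π ∈ X, ((symmDiff (T₁ π) (T₂ π)).ncard : ℝ) ≤ ∑ π ∈ X, (3 + 2 * (m π : ℝ)) :=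
      Finset.sum_le_sum fun π _ => by exact_mod_cast hle π
    rw [Finset.sum_add_distrib, Finset.sum_const, nsmul_eq_mul, ← Finset.mul_sum] at h₂
    rw [Nat.cast_sum] at h₁
    have h₃ := mul_le_mul_of_nonneg_right hN hXc
    nlinarith

end Expectation

end KineticTriangulation

end

/-! ### The proposition -/

open KineticTriangulation in
theorem mainTheorem3 :
    ∃ C : ℝ, 0 < C ∧ ∀ (n : ℕ) (p : Fin n → ℝ → ℝ × ℝ), GeneralPosition p →
      ∀ τ : PseudoTriangle n, (∃ π, Appears p π τ) →
      ∀ t₀ ∈ τ.life, ∀ p₀ : Fin n, (EnvelopeEvent p t₀ τ p₀ ∨ VisibilityEvent p t₀ τ p₀) →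
      ∀ᶠ tm in 𝓝[<] t₀, ∀ᶠ tp in 𝓝[>] t₀,
        condExpect p τ (fun π => (changes p π τ tm tp : ℝ)) ≤
            C * Real.log ((pointSet p τ).ncard + 2) ∧
        condExpect p τ (fun π => (changes p π τ tm tp : ℝ)) ≤ C * Real.log (n + 2) ∧
        ∀ t ∈ ({tm, tp} : Set ℝ), ∀ k : ℕ, 0 < k →
          condProb p τ (fun π => ∃ F, GeneratesIn p π t τ p₀ F ∧ k < F.numVertices) ≤ C / k := by
  classical
  refine ⟨150, by norm_num, fun n p hp τ ⟨π₀, hπ₀⟩ t₀ ht₀ p₀ he => ?_⟩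
  have hmid := (hπ₀.1.2.2 t₀ ht₀).2.1
  have hcard : (0 : ℝ) < (appearing p τ).card := by
    exact_mod_cast Finset.card_pos.2 ⟨π₀, mem_appearing.2 hπ₀⟩
  have hX := swapClosed_appearing p τ
  -- `T` is the collinear triple of the event. From here on it matters only that both times are near
  -- `t₀` with respect to `T`.
  obtain ⟨T, h₀, hT⟩ := hp.exists_controlled ht₀ hmid.1 hmid.2 he
  have hnear := hp.eventually_near h₀
  have hprob : ∀ t, Near p t₀ T t → ∀ k : ℕ, 0 < k →
      condProb p τ (fun π => ∃ F, GeneratesIn p π t τ p₀ F ∧ k < F.numVertices) ≤ 150 / k := by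
    intro t ht k hk
    have hk' : (0 : ℝ) < k := by exact_mod_cast hk
    rw [condProb, div_le_iff₀ hcard]
    rcases ht.generatesLarge h₀ ht₀ hmid.1 hmid.2 with hno | ⟨d, l, r, hd, hV, hgen⟩
    · rw [Finset.filter_false_of_mem fun π _ ⟨F, hF, _⟩ => hno π p₀ F hF]
      simp only [Finset.card_empty, Nat.cast_zero]
      positivity
    · have h₁ := Chains.card_generatesLarge_le hd hX hV p₀ hk
      have h₂ : (((appearing p τ).filter fun π => ∃ F, GeneratesIn p π t τ p₀ F ∧
          k < F.numVertices).card : ℝ) ≤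
          ((appearing p τ).filter fun π => d.GeneratesLarge l r π p₀ k).card := by
        exact_mod_cast Finset.card_le_card fun π hπ => by
          rw [Finset.mem_filter] at hπ ⊢
          exact ⟨hπ.1, hgen π p₀ k hπ.2⟩
      refine le_trans (le_trans (le_of_eq ?_) (h₂.trans h₁)) ?_
      · congr!
      · refine mul_le_mul_of_nonneg_right ?_ hcard.le
        exact div_le_div_of_nonneg_right (by norm_num) hk'.le
  filter_upwards [nhdsLT_le_nhdsNE t₀ hnear] with tm htm
  filter_upwards [nhdsGT_le_nhdsNE t₀ hnear] with tp htp
  have hexp : condExpect p τ (fun π => (changes p π τ tm tp : ℝ)) ≤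
      150 * Real.log ((pointSet p τ).ncard + 2) := by
    rw [condExpect, div_le_iff₀ hcard]
    exact (hT tm tp htm htp).sum_le hX
  refine ⟨hexp, hexp.trans ?_, ?_⟩
  · have hN : ((pointSet p τ).ncard : ℝ) ≤ n := by
      have := Set.ncard_le_ncard (Set.subset_univ (pointSet p τ)) (Set.toFinite _)
      rw [Set.ncard_univ, Nat.card_fin] at this
      exact_mod_cast this
    refine mul_le_mul_of_nonneg_left (Real.log_le_log (by positivity) (by linarith)) (by norm_num)
  · rintro t (rfl | rfl)
    · exact hprob _ htm
    · exact hprob _ htp
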